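/- Let $n\ge 1$, $p\ge 2$, $0<s<1$, $\Lambda\ge 1$, $p'=p/(p-1)$, let $\Omega\subset\mathbb R^n$ be a bounded domain and $t_1<t_2$. Let $K:\mathbb R^n\times\mathbb R^n\times\mathbb R\to\mathbb R$ be measurable with $$\frac{\Lambda^{-1}}{|x-y|^{n+sp}}\le K(x,y,t)\le\frac{\Lambda}{|x-y|^{n+sp}}\qquad (x\ne y),$$ and write $\mathcal A u(x,y,t)=K(x,y,t)\,|u(x,t)-u(y,t)|^{p-2}(u(x,t)-u(y,t))$. For open $D\subset\mathbb R^n$, let $W^{s,p}(D)$ be the space of $f\in L^p(D)$ with finite norm $\|f\|_{L^p(D)}+\big(\int_D\int_D\frac{|f(x)-f(y)|^p}{|x-y|^{n+sp}}\,dx\,dy\big)^{1/p}$, and let $W^{s,p}_0(\Omega)=\{f\in W^{s,p}(\mathbb R^n): f=0 \text{ a.e. in }\mathbb R^n\setminus\Omega\}$. A function $u\in L^p(t_1,t_2;W^{s,p}(\mathbb R^n))$ is called a weak subsolution to $\partial_t u+Lu=0$ in $\Omega\times(t_1,t_2)$, where $Lu(x,t)=\mathrm{P.V.}\int_{\mathbb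 R^n}\mathcal A u(x,y,t)\,dy$ formally, if $$\int_{t_1}^{t_2}\int_{\mathbb R^n}\int_{\mathbb R^n}\mathcal A u(x,y,t)\,(\eta(x,t)-\eta(y,t))\,dx\,dy\,dt-\int_{t_1}^{t_2}\langle\partial_t\eta(t),u(\cdot,t)|_\Omega\rangle\,dt\le 0$$ for all nonnegative $\eta\in L^p(t_1,t_2;W^{s,p}_0(\Omega))$ with distributional time derivative $\partial_t\eta\in L^{p'}(t_1,t_2;(W^{s,p}(\Omega))^*)$ and $\eta(\cdot,t_1)=\eta(\cdot,t_2)=0$ in $\Omega$. Here $\langle\cdot,\cdot\rangle$ is the duality pairing, $\eta(\cdot,t)$ is identified with the functional $w\mapsto\int_\Omega\eta(x,t)w(x)\,dx$, and the values at $t_1,t_2$ are taken as limits in $L^2(\Omega)$ (up to null sets of times). If $u$ is a weak subsolution to $\partial_t u+Lu=0$ in $\Omega\times(t_1,t_2)$, then its positive part $u_+=\max\{u,0\}$ is also a weak subsolution to $\partial_t u+Lu=0$ in $\Omega\times(t_1,t_2)$. -/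

import Mathlib

open MeasureTheory Set Filter Topology
open scoped ContDiff

noncomputable section

namespace FracParabolic

/-- An exponent `p ≥ 2` is an admissible exponent for Mathlib's Lebesgue spaces. -/
instance factOneLeOfReal (p : ℝ) [hp : Fact (2 ≤ p)] : Fact (1 ≤ ENNReal.ofReal p) :=
  ⟨by
    rw [ENNReal.one_le_ofReal]
    linarith [hp.out]⟩

/-- The measure `|x - y|^{-(n + s p)} dx dy` on `D × D`. -/
def gagliardoMeasure {n : ℕ} (s p : ℝ) (D : Set (EuclideanSpace ℝ (Fin n))) :
    Measure (EuclideanSpace ℝ (Fin n) × EuclideanSpace ℝ (Fin n)) :=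
  ((volume.restrict D).prod (volume.restrict D)).withDensity
    fun z => ENNReal.ofReal (1 / ‖z.1 - z.2‖ ^ ((n : ℝ) + s * p))

/-- The norm `‖f‖_{L^p(D)} + (∫_D ∫_D |f(x) - f(y)|^p / |x - y|^{n + s p} dx dy)^{1/p}` of
`W^{s,p}(D)`, with values in `[0, ∞]`. -/
def sobolevNorm {n : ℕ} (s p : ℝ) (D : Set (EuclideanSpace ℝ (Fin n)))
    (f : EuclideanSpace ℝ (Fin n) → ℝ) : ENNReal :=
  eLpNorm f (ENNReal.ofReal p) (volume.restrict D) +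
    eLpNorm (fun z : EuclideanSpace ℝ (Fin n) × EuclideanSpace ℝ (Fin n) => f z.1 - f z.2)
      (ENNReal.ofReal p) (gagliardoMeasure s p D)

/-- The function `f` belongs to `W^{s,p}(D)`: it is in `L^p(D)` and has a finite seminorm. -/
def MemSobolev {n : ℕ} (s p : ℝ) (D : Set (EuclideanSpace ℝ (Fin n)))
    (f : EuclideanSpace ℝ (Fin n) → ℝ) : Prop :=
  MemLp f (ENNReal.ofReal p) (volume.restrict D) ∧
    MemLp (fun z : EuclideanSpace ℝ (Fin n) × EuclideanSpace ℝ (Fin n) => f z.1 - f z.2)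
      (ENNReal.ofReal p) (gagliardoMeasure s p D)

theorem ae_fst_gagliardo {n : ℕ} (s p : ℝ) (D : Set (EuclideanSpace ℝ (Fin n)))
    {P : EuclideanSpace ℝ (Fin n) → Prop} (h : ∀ᵐ x ∂(volume.restrict D), P x) :
    ∀ᵐ z ∂(gagliardoMeasure s p D), P z.1 :=
  (withDensity_absolutelyContinuous _ _).ae_le (Measure.quasiMeasurePreserving_fst.ae h)

theorem ae_snd_gagliardo {n : ℕ} (s p : ℝ) (D : Set (EuclideanSpace ℝ (Fin n)))
    {P : EuclideanSpace ℝ (Fin n) → Prop} (h : ∀ᵐ x ∂(volume.restrict D), P x) :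
    ∀ᵐ z ∂(gagliardoMeasure s p D), P z.2 :=
  (withDensity_absolutelyContinuous _ _).ae_le (Measure.quasiMeasurePreserving_snd.ae h)

/-- The normed space `W^{s,p}(D)` of (classes of) functions. A class `f` is stored together with
the class of `(x, y) ↦ f x - f y`, as an element of the `ℓ¹`-product of `L^p(D)` and of `L^p` of
`|x - y|^{-(n + s p)} dx dy`, so that the induced norm is
`‖f‖_{L^p(D)} + (∫_D ∫_D |f(x) - f(y)|^p / |x - y|^{n + s p} dx dy)^{1/p}`. -/
def Sobolev {n : ℕ} (s p : ℝ) [Fact (2 ≤ p)] (D : Set (EuclideanSpace ℝ (Fin n))) :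
    Submodule ℝ (WithLp 1 (Lp ℝ (ENNReal.ofReal p) (volume.restrict D) ×
      Lp ℝ (ENNReal.ofReal p) (gagliardoMeasure s p D))) where
  carrier := {F | F.snd =ᵐ[gagliardoMeasure s p D] fun z => F.fst z.1 - F.fst z.2}
  zero_mem' := by
    have h0 := Lp.coeFn_zero ℝ (ENNReal.ofReal p) (volume.restrict D)
    filter_upwards [Lp.coeFn_zero ℝ (ENNReal.ofReal p) (gagliardoMeasure s p D),
      ae_fst_gagliardo s p D h0, ae_snd_gagliardo s p D h0] with z h1 h2 h3
    simp only [WithLp.zero_snd, WithLp.zero_fst]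
    rw [h1, h2, h3]
    simp
  add_mem' := by
    intro F G hF hG
    have h0 := Lp.coeFn_add F.fst G.fst
    filter_upwards [Lp.coeFn_add F.snd G.snd, hF, hG,
      ae_fst_gagliardo s p D h0, ae_snd_gagliardo s p D h0] with z h1 hF hG h2 h3
    simp only [WithLp.add_snd, WithLp.add_fst]
    rw [h1, h2, h3]
    simp only [Pi.add_apply, hF, hG]
    ring
  smul_mem' := by
    intro c F hF
    have h0 := Lp.coeFn_smul c F.fst
    filter_upwards [Lp.coeFn_smul c F.snd, hF,
      ae_fst_gagliardo s p D h0, ae_snd_gagliardo s p D h0] with z h1 hF h2 h3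
    simp only [WithLp.smul_snd, WithLp.smul_fst]
    rw [h1, h2, h3]
    simp only [Pi.smul_apply, hF, smul_eq_mul]
    ring

/-- A representative of an element of `W^{s,p}(D)`. -/
def Sobolev.rep {n : ℕ} {s p : ℝ} [Fact (2 ≤ p)] {D : Set (EuclideanSpace ℝ (Fin n))}
    (w : Sobolev s p D) : EuclideanSpace ℝ (Fin n) → ℝ :=
  (w : WithLp 1 (Lp ℝ (ENNReal.ofReal p) (volume.restrict D) ×
      Lp ℝ (ENNReal.ofReal p) (gagliardoMeasure s p D))).fst

open Classical in
/-- The element of `W^{s,p}(D)` given by the restriction of `f` to `D` (and `0` by convention if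
that restriction is not in `W^{s,p}(D)`). -/
def Sobolev.ofFun {n : ℕ} (s p : ℝ) [Fact (2 ≤ p)] (D : Set (EuclideanSpace ℝ (Fin n)))
    (f : EuclideanSpace ℝ (Fin n) → ℝ) : Sobolev s p D :=
  if h : MemSobolev s p D f then
    ⟨WithLp.toLp 1 (h.1.toLp f, h.2.toLp _), by
      have h0 := h.1.coeFn_toLp
      show h.2.toLp _ =ᵐ[gagliardoMeasure s p D] fun z => (h.1.toLp f) z.1 - (h.1.toLp f) z.2
      filter_upwards [h.2.coeFn_toLp, ae_fst_gagliardo s p D h0, ae_snd_gagliardo s p D h0]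
        with z h1 h2 h3
      rw [h1, h2, h3]⟩
  else 0

/-- `u ∈ L^p(t₁, t₂; W^{s,p}(ℝⁿ))`, where `u t x` stands for `u(x, t)`. -/
structure MemLpSobolev {n : ℕ} (s p t₁ t₂ : ℝ) (u : ℝ → EuclideanSpace ℝ (Fin n) → ℝ) :
    Prop where
  aestronglyMeasurable : AEStronglyMeasurable
    (fun q : ℝ × EuclideanSpace ℝ (Fin n) => u q.1 q.2)
    ((volume.restrict (Ioo t₁ t₂)).prod volume)
  lintegral_lt_top : ∫⁻ t in Ioo t₁ t₂, sobolevNorm s p univ (u t) ^ p < ⊤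

/-- `ξ` is the distributional derivative `∂_t η` on `(t₁, t₂)`, as a function with values in the
dual of `W^{s,p}(Ω)`; the function `η(·, t)` is identified with the functional
`w ↦ ∫_Ω η(x, t) w(x) dx`. -/
def IsTimeDeriv {n : ℕ} {s p : ℝ} [Fact (2 ≤ p)] {Ω : Set (EuclideanSpace ℝ (Fin n))}
    (t₁ t₂ : ℝ) (η : ℝ → EuclideanSpace ℝ (Fin n) → ℝ)
    (ξ : ℝ → StrongDual ℝ (Sobolev s p Ω)) : Prop :=
  ∀ φ : ℝ → ℝ, ContDiff ℝ ∞ φ → HasCompactSupport φ → tsupport φ ⊆ Ioo t₁ t₂ →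
    ∀ w : Sobolev s p Ω,
      ∫ t in Ioo t₁ t₂, deriv φ t * ∫ x in Ω, η t x * Sobolev.rep w x =
        -∫ t in Ioo t₁ t₂, φ t * ξ t w

/-- `η` is a test function for the equation in `Ω × (t₁, t₂)`, with time derivative `ξ`:
`η ∈ L^p(t₁, t₂; W₀^{s,p}(Ω))`, `ξ = ∂_t η ∈ L^{p'}(t₁, t₂; (W^{s,p}(Ω))^*)` with
`p' = p / (p - 1)`, and `η(·, t₁) = η(·, t₂) = 0` in `Ω`. The initial and terminal values are those
of the representative of `η` that is continuous with values in `L²(Ω)`, that is, they are taken as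
limits in `L²(Ω)` for `t → t₁` and `t → t₂`, up to null sets of times. -/
structure IsTestFunction {n : ℕ} {s p : ℝ} [Fact (2 ≤ p)] {Ω : Set (EuclideanSpace ℝ (Fin n))}
    (t₁ t₂ : ℝ) (η : ℝ → EuclideanSpace ℝ (Fin n) → ℝ)
    (ξ : ℝ → StrongDual ℝ (Sobolev s p Ω)) : Prop where
  mem : MemLpSobolev s p t₁ t₂ η
  eq_zero_outside : ∀ᵐ t ∂(volume.restrict (Ioo t₁ t₂)), ∀ᵐ x, x ∉ Ω → η t x = 0
  deriv_mem : MemLp ξ (ENNReal.ofReal (p / (p - 1))) (volume.restrict (Ioo t₁ t₂))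
  deriv_eq : IsTimeDeriv t₁ t₂ η ξ
  initial : Tendsto (fun t => eLpNorm (η t) 2 (volume.restrict Ω))
    (𝓝[>] t₁ ⊓ ae volume) (𝓝 0)
  terminal : Tendsto (fun t => eLpNorm (η t) 2 (volume.restrict Ω))
    (𝓝[<] t₂ ⊓ ae volume) (𝓝 0)

/-- `𝒜u(x, y, t) = K(x, y, t) |u(x, t) - u(y, t)|^{p - 2} (u(x, t) - u(y, t))`. -/
def flux {n : ℕ} (p : ℝ) (K : EuclideanSpace ℝ (Fin n) → EuclideanSpace ℝ (Fin n) → ℝ → ℝ)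
    (u : ℝ → EuclideanSpace ℝ (Fin n) → ℝ) (x y : EuclideanSpace ℝ (Fin n)) (t : ℝ) : ℝ :=
  K x y t * |u t x - u t y| ^ (p - 2) * (u t x - u t y)

/-- The kernel `K` is measurable and satisfies
`Λ⁻¹ / |x - y|^{n + s p} ≤ K(x, y, t) ≤ Λ / |x - y|^{n + s p}` off the diagonal. -/
structure IsEllipticKernel {n : ℕ} (s p Λ : ℝ)
    (K : EuclideanSpace ℝ (Fin n) → EuclideanSpace ℝ (Fin n) → ℝ → ℝ) : Prop where
  measurable : Measurable
    fun q : EuclideanSpace ℝ (Fin n) × EuclideanSpace ℝ (Fin n) × ℝ => K q.1 q.2.1 q.2.2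
  lower : ∀ x y t, x ≠ y → Λ⁻¹ / ‖x - y‖ ^ ((n : ℝ) + s * p) ≤ K x y t
  upper : ∀ x y t, x ≠ y → K x y t ≤ Λ / ‖x - y‖ ^ ((n : ℝ) + s * p)

/-- `u` is a weak subsolution to `∂_t u + L u = 0` in `Ω × (t₁, t₂)`: `u` belongs to
`L^p(t₁, t₂; W^{s,p}(ℝⁿ))` and
`∫_{t₁}^{t₂} ∫ ∫ 𝒜u(x, y, t) (η(x, t) - η(y, t)) dx dy dt - ∫_{t₁}^{t₂} ∫ u ∂_t η dx dt ≤ 0`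
for all nonnegative test functions `η`. The second term is the duality pairing of `∂_t η(t)` in
`(W^{s,p}(Ω))^*` with the restriction of `u(·, t)` to `Ω`, integrated over `t`. -/
def IsSubsolution {n : ℕ} (s p : ℝ) [Fact (2 ≤ p)]
    (K : EuclideanSpace ℝ (Fin n) → EuclideanSpace ℝ (Fin n) → ℝ → ℝ)
    (Ω : Set (EuclideanSpace ℝ (Fin n))) (t₁ t₂ : ℝ)
    (u : ℝ → EuclideanSpace ℝ (Fin n) → ℝ) : Prop :=
  MemLpSobolev s p t₁ t₂ u ∧
    ∀ (η : ℝ → EuclideanSpace ℝ (Fin n) → ℝ) (ξ : ℝ → StrongDual ℝ (Sobolev s p Ω)),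
      IsTestFunction t₁ t₂ η ξ →
      (∀ᵐ t ∂(volume.restrict (Ioo t₁ t₂)), ∀ᵐ x, 0 ≤ η t x) →
      (∫ t in Ioo t₁ t₂, ∫ x, ∫ y, flux p K u x y t * (η t x - η t y)) -
        ∫ t in Ioo t₁ t₂, ξ t (Sobolev.ofFun s p Ω (u t)) ≤ 0

end FracParabolic

end

open MeasureTheory Set Filter Topology
open scoped ContDiff

noncomputable section

namespace FracParabolic

/-! Formally one tests the equation with `η` times the indicator of `{u > 0}`: the elliptic term
does not increase when `u` is replaced by `u₊`, and the indicator times `∂_t u` is `∂_t u₊`. The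
indicator is not admissible, so with a nonnegative representative `N` of `η` and a cutoff `χ` in
time the proof uses `ψ = min {χ N, m u₊}` (`truncTest`). It is nonnegative, vanishes outside `Ω`,
near both ends of the time interval and where `u ≤ 0`, and tends to `N` on `{u > 0}` as `m → ∞`.

Neither `ψ` nor `u` has a time derivative, so `ψ` enters through its forward Steklov averages, whose
time derivative is a difference quotient (`isTestFunction_steklov`). This bounds `h` times an
averaged energy by `∫ (ψ(t+h) - ψ(t)) u(t)` (`IsSubsolution.steklov_le`).

The parabolic term is handled by a discrete chain rule (`truncTest_diff_mul_le`). With `d = χ N /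
m`, the truncation is `m min {d, u₊}`; twice the primitive of `min {d, r₊}` in `r` is convex in `r`
and concave in `d`, so two tangent inequalities remove all time differences of `u` up to an exact
difference `G(t+h) - G(t)`, whose integral vanishes. What is left is `N(t+h) - N(t)` against `χ (u₊
- d)₊`, and a term from the growth of `χ` near `t₁`; the decay of `χ` near `t₂` has the favourable
sign. Since `N` is the primitive of `ξ = ∂_t η` starting from the value zero at `t₁`
(`IsTestFunction.ae_integral_mul`), the first term becomes `h` times an average of shifted pairings
with `ξ`. Dividing by `h` and letting `h → 0` gives `IsSubsolution.shiftedEnergy_truncTest_le`; the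
shifted pairings and energies converge because translations are continuous in `L^p`.

Finally `m → ∞`. The functions `χ (u₊ - d)₊` tend to `u₊` in `W^{s,p}(Ω)` for almost every time,
with an `L^p` bound. The layer at `t₁` is at most `m` times a product of two integrals over an
interval of length `3 / m`, hence vanishes by Hölder. For the energy, the flux of `u₊` is a lower
bound, and writing `ψ = χ N - (χ N - m u₊)₊` the contribution of the last part is bounded on its
unfavourable side uniformly in `m` (`exists_tendsto_le_shiftedEnergy`). -/

/-! ### Translations, averages and dominated convergence in Lebesgue spaces -/

/-- The `L^q`-`L^p` pairing of a function with the translates of another one is continuous. -/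
theorem continuous_integral_bilin_translate {G F₁ F₂ : Type*} [NormedAddCommGroup G]
    [ProperSpace G] [SecondCountableTopology G]
    [MeasurableSpace G] [BorelSpace G] (μ : Measure G) [μ.IsAddHaarMeasure]
    [NormedAddCommGroup F₁] [NormedSpace ℝ F₁] [NormedAddCommGroup F₂] [NormedSpace ℝ F₂]
    (B : F₁ →L[ℝ] F₂ →L[ℝ] ℝ) {p q : ENNReal} [ENNReal.HolderConjugate q p] [Fact (1 ≤ p)]
    [Fact (1 ≤ q)]
    (hp : p ≠ ⊤) {f : G → F₁} {g : G → F₂} (hf : MemLp f q μ) (hg : MemLp g p μ) :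
    Continuous fun c : G => ∫ z, B (f z) (g (c + z)) ∂μ := by
  have : Fact (p ≠ ⊤) := ⟨hp⟩
  -- The integral is the duality pairing of fixed classes moved by the translation action, and that
  -- action is continuous on `L^p` for finite `p`.
  have key : ∀ c : G, ∫ z, B (f z) (g (c + z)) ∂μ =
      B.lpPairing μ q p (hf.toLp f) (DomAddAct.mk c +ᵥ hg.toLp g) := by
    intro c
    rw [ContinuousLinearMap.lpPairing_eq_integral]
    apply integral_congr_ae
    have h1 := hf.coeFn_toLp
    rw [DomAddAct.mk_vadd_toLp]
    have h2 := (hg.comp_measurePreserving (measurePreserving_vadd c μ)).coeFn_toLp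
    filter_upwards [h1, h2] with z h1 h2
    rw [h1]
    simp only [vadd_eq_add, Function.comp_def] at h2 ⊢
    rw [h2]
  simp_rw [key]
  refine (B.lpPairing μ q p (hf.toLp f)).continuous.comp ?_
  exact (continuous_vadd.comp ((DomAddAct.continuous_mk.comp continuous_id).prodMk
    continuous_const))

/-- Averages over `(0, h)` are rescaled to the fixed interval `(0, 1)`. This turns inequalities
between averaged shifts into inequalities at shift zero. -/
theorem tendsto_average {I : ℝ → ℝ} (hI : Continuous I) :
    Tendsto (fun h : ℝ => ∫ r in Ioc (0 : ℝ) 1, I (h * r)) (𝓝[>] 0) (𝓝 (I 0)) := by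
  have h1 : Continuous fun h : ℝ => ∫ r in (0 : ℝ)..1, I (h * r) :=
    intervalIntegral.continuous_parametric_intervalIntegral_of_continuous' (by fun_prop) _ _
  have h2 := h1.tendsto 0
  simp only [zero_mul, intervalIntegral.integral_const, sub_zero, one_smul] at h2
  simp_rw [intervalIntegral.integral_of_le (zero_le_one' ℝ)] at h2
  exact h2.mono_left nhdsWithin_le_nhds

/-- A map into a second countable space is strongly measurable as soon as all distances are. -/
theorem stronglyMeasurable_of_measurable_dist {α X : Type*} [MeasurableSpace α]
    [PseudoMetricSpace X] [SecondCountableTopology X] {f : α → X}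
    (h : ∀ x, Measurable fun a => dist (f a) x) : StronglyMeasurable f := by
  borelize X
  refine Measurable.stronglyMeasurable ?_
  refine measurable_of_isOpen fun U hU => ?_
  have : ∀ x : U, ∃ r > 0, Metric.ball (x : X) r ⊆ U := fun x => Metric.isOpen_iff.1 hU x x.2
  choose r hr hrU using this
  -- Lindelöf: countably many of these balls cover `U`, and preimages of balls are sublevel sets of
  -- the given distances.
  obtain ⟨T, hT, hTU⟩ := TopologicalSpace.isOpen_iUnion_countable
    (fun x : U => Metric.ball (x : X) (r x)) fun _ => Metric.isOpen_ball
  have hU' : U = ⋃ i ∈ T, Metric.ball (i : X) (r i) := by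
    rw [hTU]
    refine Subset.antisymm (fun x hx => ?_) (iUnion_subset hrU)
    exact mem_iUnion.2 ⟨⟨x, hx⟩, Metric.mem_ball_self (hr _)⟩
  rw [hU', preimage_iUnion₂]
  exact MeasurableSet.biUnion hT fun i _ => measurableSet_lt (h i) measurable_const

/-- Averaging over a probability space is a contraction of `L^p`. -/
theorem MemLp.integral_average {α β : Type*} [MeasurableSpace α] [MeasurableSpace β]
    {ρ : Measure α} [IsProbabilityMeasure ρ] {μ : Measure β} [SigmaFinite μ] {p : ℝ}
    (hp : 1 ≤ p) {g : α × β → ℝ} (hg : MemLp g (ENNReal.ofReal p) (ρ.prod μ)) :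
    MemLp (fun z => ∫ r, g (r, z) ∂ρ) (ENNReal.ofReal p) μ := by
  have hp0 : 0 < p := by linarith
  have hpne : ENNReal.ofReal p ≠ 0 := by simpa using hp0
  have hm : AEStronglyMeasurable (fun z => ∫ r, g (r, z) ∂ρ) μ :=
    hg.1.prod_swap.integral_prod_right'
  refine ⟨hm, ?_⟩
  rw [eLpNorm_lt_top_iff_lintegral_rpow_enorm_lt_top hpne ENNReal.ofReal_ne_top]
  have hfin := (eLpNorm_lt_top_iff_lintegral_rpow_enorm_lt_top hpne ENNReal.ofReal_ne_top).1 hg.2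
  rw [ENNReal.toReal_ofReal hp0.le] at *
  refine lt_of_le_of_lt ?_ hfin
  rw [lintegral_prod_symm _ (hg.1.enorm.pow_const p)]
  refine lintegral_mono_ae ?_
  have hs : ∀ᵐ z ∂μ, AEStronglyMeasurable (fun r => g (r, z)) ρ :=
    hg.1.prod_swap.prodMk_left
  filter_upwards [hs] with z hz
  -- Jensen on each slice, in the form that the `L¹` norm is at most the `L^p` norm for a
  -- probability measure; Tonelli has exchanged the variables.
  calc ‖∫ r, g (r, z) ∂ρ‖ₑ ^ p ≤ (eLpNorm (fun r => g (r, z)) 1 ρ) ^ p := by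
        gcongr
        rw [eLpNorm_one_eq_lintegral_enorm]
        exact enorm_integral_le_lintegral_enorm _
    _ ≤ (eLpNorm (fun r => g (r, z)) (ENNReal.ofReal p) ρ) ^ p := by
        gcongr
        exact eLpNorm_le_eLpNorm_of_exponent_le (by rw [ENNReal.one_le_ofReal]; exact hp) hz
    _ = ∫⁻ r, ‖g (r, z)‖ₑ ^ p ∂ρ := by
        rw [eLpNorm_eq_lintegral_rpow_enorm_toReal hpne ENNReal.ofReal_ne_top,
          ENNReal.toReal_ofReal hp0.le, ← ENNReal.rpow_mul, one_div, inv_mul_cancel₀ hp0.ne',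
          ENNReal.rpow_one]

/-- Dominated convergence in `L^p`. -/
theorem tendsto_eLpNorm_zero_of_dominated {α : Type*} [MeasurableSpace α] {μ : Measure α} {p : ℝ}
    (hp : 1 ≤ p) {f : ℕ → α → ℝ} {g : α → ℝ} (hf : ∀ m, AEStronglyMeasurable (f m) μ)
    (hg : eLpNorm g (ENNReal.ofReal p) μ ≠ ⊤) (hfg : ∀ m, ∀ᵐ x ∂μ, |f m x| ≤ g x)
    (hlim : ∀ᵐ x ∂μ, Tendsto (fun m => f m x) atTop (𝓝 0)) :
    Tendsto (fun m => eLpNorm (f m) (ENNReal.ofReal p) μ) atTop (𝓝 0) := by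
  have hp0 : 0 < p := by linarith
  have hpne : ENNReal.ofReal p ≠ 0 := by simpa using hp0
  have hg' := (eLpNorm_lt_top_iff_lintegral_rpow_enorm_lt_top hpne ENNReal.ofReal_ne_top).1
    hg.lt_top
  simp_rw [eLpNorm_eq_lintegral_rpow_enorm_toReal hpne ENNReal.ofReal_ne_top]
  rw [ENNReal.toReal_ofReal hp0.le] at *
  have h0 : Tendsto (fun m => ∫⁻ x, ‖f m x‖ₑ ^ p ∂μ) atTop (𝓝 (∫⁻ _, 0 ∂μ)) := by
    refine tendsto_lintegral_of_dominated_convergence' (fun x => ‖g x‖ₑ ^ p)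
      (fun m => (hf m).enorm.pow_const p) (fun m => ?_) hg'.ne ?_
    · filter_upwards [hfg m] with x hx
      gcongr
      rw [enorm_le_iff_norm_le, Real.norm_eq_abs, Real.norm_eq_abs]
      exact hx.trans (le_abs_self _)
    · filter_upwards [hlim] with x hx
      have := (ENNReal.continuous_rpow_const (y := p)).continuousAt.tendsto.comp hx.enorm
      simpa [Function.comp_def, ENNReal.zero_rpow_of_pos hp0] using this
  have := (ENNReal.continuous_rpow_const (y := 1 / p)).continuousAt.tendsto.comp h0
  simpa [Function.comp_def, ENNReal.zero_rpow_of_pos, hp0] using this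

/-! ### Weak derivatives of scalar functions of time -/

theorem exists_Icc_of_compact_subset_Ioo {t₁ t₂ : ℝ} {s : Set ℝ} (ht : t₁ < t₂)
    (hs : IsCompact s) (hst : s ⊆ Ioo t₁ t₂) :
    ∃ a b, t₁ < a ∧ a ≤ b ∧ b < t₂ ∧ s ⊆ Icc a b := by
  rcases s.eq_empty_or_nonempty with rfl | hne
  · exact ⟨(t₁ + t₂) / 2, (t₁ + t₂) / 2, by linarith, le_rfl, by linarith, empty_subset _⟩
  · have h1 := hst (hs.sInf_mem hne)
    have h2 := hst (hs.sSup_mem hne)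
    refine ⟨sInf s, sSup s, h1.1, ?_, h2.2, fun x hx => ?_⟩
    · exact csInf_le hs.bddBelow (hs.sSup_mem hne)
    · exact ⟨csInf_le hs.bddBelow hx, le_csSup hs.bddAbove hx⟩

/-- A smooth function with compact support in an interval and vanishing integral has a primitive
with these properties. -/
theorem exists_primitive_compactSupport {t₁ t₂ : ℝ} (ht : t₁ < t₂) {κ : ℝ → ℝ}
    (hκ : ContDiff ℝ ∞ κ) (hκc : HasCompactSupport κ) (hκs : tsupport κ ⊆ Ioo t₁ t₂)
    (hκ0 : ∫ t, κ t = 0) :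
    ∃ φ : ℝ → ℝ, ContDiff ℝ ∞ φ ∧ HasCompactSupport φ ∧ tsupport φ ⊆ Ioo t₁ t₂ ∧
      deriv φ = κ := by
  obtain ⟨a, b, ha, hab, hb, hs⟩ := exists_Icc_of_compact_subset_Ioo ht hκc hκs
  have hz : ∀ t, t ∉ Icc a b → κ t = 0 := fun t h =>
    image_eq_zero_of_notMem_tsupport fun h' => h (hs h')
  have hd : ∀ t, HasDerivAt (fun t => ∫ τ in a..t, κ τ) (κ t) t := fun t =>
    intervalIntegral.integral_hasDerivAt_right (hκ.continuous.intervalIntegrable _ _)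
      (hκ.continuous.stronglyMeasurableAtFilter _ _) hκ.continuous.continuousAt
  have hder : deriv (fun t => ∫ τ in a..t, κ τ) = κ := funext fun t => (hd t).deriv
  have hsupp : Function.support (fun t => ∫ τ in a..t, κ τ) ⊆ Icc a b := by
    intro t h
    by_contra hn
    apply h
    rw [mem_Icc, not_and_or, not_le, not_le] at hn
    rcases hn with hn | hn
    · change ∫ τ in a..t, κ τ = 0
      rw [intervalIntegral.integral_symm, intervalIntegral.integral_of_le hn.le,
        integral_Ioc_eq_integral_Ioo]
      rw [setIntegral_eq_zero_of_forall_eq_zero, neg_zero]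
      exact fun x hx => hz x fun h' => absurd h'.1 (not_le.2 hx.2)
    · change ∫ τ in a..t, κ τ = 0
      rw [intervalIntegral.integral_of_le (hab.trans hn.le), ← integral_Icc_eq_integral_Ioc,
        setIntegral_eq_integral_of_forall_compl_eq_zero, hκ0]
      exact fun x hx => hz x fun h' => hx ⟨h'.1, h'.2.trans hn.le⟩
  refine ⟨_, ?_, HasCompactSupport.of_support_subset_isCompact isCompact_Icc hsupp, ?_, hder⟩
  · rw [contDiff_infty_iff_deriv]
    exact ⟨fun t => (hd t).differentiableAt, by rw [hder]; exact hκ⟩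
  · exact (closure_minimal hsupp isClosed_Icc).trans fun x hx => ⟨ha.trans_le hx.1, hx.2.trans_lt hb⟩

/-- An integrable function with vanishing weak derivative on an interval is constant. -/
theorem ae_eq_const_of_integral_deriv_mul_eq_zero {t₁ t₂ : ℝ} (ht : t₁ < t₂) {H : ℝ → ℝ}
    (hH : IntegrableOn H (Ioo t₁ t₂))
    (h : ∀ φ : ℝ → ℝ, ContDiff ℝ ∞ φ → HasCompactSupport φ → tsupport φ ⊆ Ioo t₁ t₂ →
      ∫ t in Ioo t₁ t₂, deriv φ t * H t = 0) :
    ∃ c, ∀ᵐ t ∂(volume.restrict (Ioo t₁ t₂)), H t = c := by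
  -- A bump at the midpoint with outer radius a quarter of the length, so that its support stays
  -- inside the open interval.
  let ρ : ContDiffBump ((t₁ + t₂) / 2) :=
    ⟨(t₂ - t₁) / 8, (t₂ - t₁) / 4, by linarith, by linarith⟩
  have hρc : HasCompactSupport (ρ : ℝ → ℝ) := ρ.hasCompactSupport
  have hρs : tsupport (ρ : ℝ → ℝ) ⊆ Ioo t₁ t₂ := by
    rw [ρ.tsupport_eq, Real.closedBall_eq_Icc]
    intro x hx
    change x ∈ Icc ((t₁ + t₂) / 2 - (t₂ - t₁) / 4) ((t₁ + t₂) / 2 + (t₂ - t₁) / 4) at hx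
    exact ⟨by linarith [hx.1], by linarith [hx.2]⟩
  have hρi : (0 : ℝ) < ∫ t, ρ t := ρ.integral_pos
  have hρd : ContDiff ℝ ∞ (ρ : ℝ → ℝ) := ρ.contDiff
  have hbd : ∀ θ : ℝ → ℝ, Continuous θ → HasCompactSupport θ →
      Integrable (fun t => θ t * H t) (volume.restrict (Ioo t₁ t₂)) := by
    intro θ hθ hθc
    obtain ⟨C, hC⟩ := hθc.exists_bound_of_continuous hθ
    exact hH.bdd_mul hθ.aestronglyMeasurable (ae_of_all _ hC)
  set c : ℝ := (∫ t in Ioo t₁ t₂, ρ t * H t) / ∫ t, ρ t with hc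
  refine ⟨c, ?_⟩
  have hloc : LocallyIntegrableOn (fun t => H t - c) (Ioo t₁ t₂) volume :=
    IntegrableOn.locallyIntegrableOn (hH.sub (integrableOn_const (by simp)))
  have := isOpen_Ioo.ae_eq_zero_of_integral_contDiff_smul_eq_zero hloc ?_
  · rw [ae_restrict_iff' measurableSet_Ioo]
    filter_upwards [this] with t ht1 ht2
    linarith [ht1 ht2]
  · intro θ hθ hθc hθs
    have hiθ : Integrable θ := hθ.continuous.integrable_of_hasCompactSupport hθc
    have hiρ : Integrable (ρ : ℝ → ℝ) := hρd.continuous.integrable_of_hasCompactSupport hρc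
    -- With this `d` the function `θ - d ρ` has integral zero, hence is the derivative of an
    -- admissible `φ`. The hypothesis then compares `θ` with the fixed `ρ`, which forces the
    -- constant to be the `ρ`-weighted mean of `H`.
    set d : ℝ := (∫ t, θ t) / ∫ t, ρ t with hd
    have hcs : HasCompactSupport fun t => d * ρ t := hρc.mul_left
    have hts : tsupport (fun t => d * ρ t) ⊆ tsupport (ρ : ℝ → ℝ) :=
      tsupport_mul_subset_right
    obtain ⟨φ, hφ, hφc, hφs, hφd⟩ := exists_primitive_compactSupport ht
      (κ := fun t => θ t - d * ρ t) (hθ.sub (contDiff_const.mul hρd)) (hθc.sub hcs)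
      ((tsupport_sub _ _).trans (union_subset hθs (hts.trans hρs))) (by
        rw [integral_sub hiθ (hiρ.const_mul d), integral_const_mul, hd, div_mul_cancel₀ _ hρi.ne',
          sub_self])
    have h0 := h φ hφ hφc hφs
    rw [hφd] at h0
    have e1 : ∫ t in Ioo t₁ t₂, (θ t - d * ρ t) * H t =
        (∫ t in Ioo t₁ t₂, θ t * H t) - d * ∫ t in Ioo t₁ t₂, ρ t * H t := by
      rw [← integral_const_mul, ← integral_sub (hbd θ hθ.continuous hθc)
        ((hbd ρ hρd.continuous hρc).const_mul d)]
      congr 1; ext t; ring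
    have e2 : ∫ t in Ioo t₁ t₂, θ t = ∫ t, θ t :=
      setIntegral_eq_integral_of_forall_compl_eq_zero fun x hx =>
        image_eq_zero_of_notMem_tsupport fun h' => hx (hθs h')
    have e3 : ∫ t, θ t • (H t - c) = ∫ t in Ioo t₁ t₂, θ t * (H t - c) := by
      symm
      refine setIntegral_eq_integral_of_forall_compl_eq_zero fun x hx => ?_
      rw [image_eq_zero_of_notMem_tsupport fun h' => hx (hθs h'), zero_mul]
    rw [e3]
    simp_rw [mul_sub]
    rw [integral_sub (hbd θ hθ.continuous hθc) (hiθ.integrableOn.mul_const c),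
      integral_mul_const, e2]
    rw [e1] at h0
    rw [hc, mul_div_assoc', sub_eq_zero, eq_div_iff hρi.ne']
    rw [hd, sub_eq_zero] at h0
    rw [h0]
    field_simp

/-- Integration by parts against the primitive of an integrable function. -/
theorem integral_deriv_mul_primitive {t₁ t₂ : ℝ} {f φ : ℝ → ℝ}
    (hf : IntegrableOn f (Ioo t₁ t₂)) (hφ : ContDiff ℝ ∞ φ) (hφc : HasCompactSupport φ)
    (hφs : tsupport φ ⊆ Ioo t₁ t₂) :
    ∫ t in Ioo t₁ t₂, deriv φ t * ∫ τ in Ioo t₁ t, f τ = -∫ t in Ioo t₁ t₂, φ t * f t := by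
  set ν := volume.restrict (Ioo t₁ t₂) with hν
  have hφ' : Continuous (deriv φ) := hφ.continuous_deriv (by simp)
  have hi : Integrable (deriv φ) ν :=
    (hφ'.integrable_of_hasCompactSupport hφc.deriv).integrableOn
  -- The iterated integral is taken over the triangle `τ < t`. Fubini leaves `φ(t₂) - φ(τ)` inside,
  -- and `φ(t₂) = 0`.
  have hprod : Integrable (Function.uncurry fun t τ =>
      {z : ℝ × ℝ | z.2 < z.1}.indicator (fun z => deriv φ z.1 * f z.2) (t, τ)) (ν.prod ν) :=
    (hi.mul_prod hf).indicator (measurableSet_lt measurable_snd measurable_fst)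
  have hswap := integral_integral_swap hprod
  have e1 : ∀ t ∈ Ioo t₁ t₂, ∫ τ, {z : ℝ × ℝ | z.2 < z.1}.indicator
      (fun z => deriv φ z.1 * f z.2) (t, τ) ∂ν = deriv φ t * ∫ τ in Ioo t₁ t, f τ := by
    intro t ht
    rw [← integral_const_mul]
    have : (fun τ => {z : ℝ × ℝ | z.2 < z.1}.indicator (fun z => deriv φ z.1 * f z.2) (t, τ)) =
        (Iio t).indicator fun τ => deriv φ t * f τ := by
      ext τ; simp [indicator]
    rw [this, integral_indicator measurableSet_Iio, hν, Measure.restrict_restrict measurableSet_Iio]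
    congr 2
    ext x
    simp only [mem_inter_iff, mem_Iio, mem_Ioo]
    exact ⟨fun h => ⟨h.2.1, h.1⟩, fun h => ⟨h.2, h.1, h.2.trans ht.2⟩⟩
  have e2 : ∀ τ ∈ Ioo t₁ t₂, ∫ t, {z : ℝ × ℝ | z.2 < z.1}.indicator
      (fun z => deriv φ z.1 * f z.2) (t, τ) ∂ν = -(φ τ * f τ) := by
    intro τ hτ
    have : (fun t => {z : ℝ × ℝ | z.2 < z.1}.indicator (fun z => deriv φ z.1 * f z.2) (t, τ)) =
        (Ioi τ).indicator fun t => deriv φ t * f τ := by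
      ext t; simp [indicator]
    rw [this, integral_indicator measurableSet_Ioi, hν, Measure.restrict_restrict measurableSet_Ioi]
    have hs : Ioi τ ∩ Ioo t₁ t₂ = Ioo τ t₂ := by
      ext x
      simp only [mem_inter_iff, mem_Ioi, mem_Ioo]
      exact ⟨fun h => ⟨h.1, h.2.2⟩, fun h => ⟨h.1, hτ.1.trans h.1, h.2⟩⟩
    rw [hs, integral_mul_const, ← integral_Ioc_eq_integral_Ioo,
      ← intervalIntegral.integral_of_le hτ.2.le, intervalIntegral.integral_deriv_eq_sub
        (fun x _ => hφ.differentiable (by simp) x) (hφ'.intervalIntegrable _ _),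
      image_eq_zero_of_notMem_tsupport (f := φ) (x := t₂) fun h => lt_irrefl _ (hφs h).2]
    ring
  rw [setIntegral_congr_fun measurableSet_Ioo e1, setIntegral_congr_fun measurableSet_Ioo e2,
    integral_neg] at hswap
  exact hswap

/-- An integrable function with an integrable weak derivative is a primitive of it, up to a
constant. -/
theorem ae_eq_const_add_primitive {t₁ t₂ : ℝ} (ht : t₁ < t₂) {f g : ℝ → ℝ}
    (hf : IntegrableOn f (Ioo t₁ t₂)) (hg : IntegrableOn g (Ioo t₁ t₂))
    (h : ∀ φ : ℝ → ℝ, ContDiff ℝ ∞ φ → HasCompactSupport φ → tsupport φ ⊆ Ioo t₁ t₂ →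
      ∫ t in Ioo t₁ t₂, deriv φ t * g t = -∫ t in Ioo t₁ t₂, φ t * f t) :
    ∃ c, ∀ᵐ t ∂(volume.restrict (Ioo t₁ t₂)), g t = c + ∫ τ in Ioo t₁ t, f τ := by
  have hcont : ContinuousOn (fun t => ∫ τ in Ioo t₁ t, f τ) (Icc t₁ t₂) := by
    have hf' : IntegrableOn f (Icc t₁ t₂) := (integrableOn_Icc_iff_integrableOn_Ioo (by finiteness) (by finiteness)).2 hf
    refine (intervalIntegral.continuousOn_primitive hf').congr fun t _ => ?_
    exact integral_Ioc_eq_integral_Ioo.symm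
  have hG : IntegrableOn (fun t => ∫ τ in Ioo t₁ t, f τ) (Ioo t₁ t₂) :=
    (hcont.integrableOn_compact isCompact_Icc).mono_set Ioo_subset_Icc_self
  obtain ⟨c, hc⟩ := ae_eq_const_of_integral_deriv_mul_eq_zero ht (hg.sub hG) (by
    intro φ hφ hφc hφs
    have hφ' : Continuous (deriv φ) := hφ.continuous_deriv (by simp)
    obtain ⟨C, hC⟩ := hφc.deriv.exists_bound_of_continuous hφ'
    have e := integral_deriv_mul_primitive hf hφ hφc hφs
    simp only [Pi.sub_apply, mul_sub]
    rw [integral_sub (hg.bdd_mul hφ'.aestronglyMeasurable (ae_of_all _ hC))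
      (hG.bdd_mul hφ'.aestronglyMeasurable (ae_of_all _ hC)), h φ hφ hφc hφs, e, sub_self])
  refine ⟨c, ?_⟩
  filter_upwards [hc] with t ht
  simp only [Pi.sub_apply] at ht
  linarith

/-! ### Convexity inequalities behind the discrete chain rule -/

/-- The primitive in time of the truncation `e ↦ min e (k r₊)`, as a function of `r` and `e = k d`,
up to the factor `k / 2`. -/
def truncPrimitive (d r : ℝ) : ℝ := max r 0 ^ 2 - max (max r 0 - d) 0 ^ 2

/-- The derivative in `r` is `2 min {d, r₊}`, which is nondecreasing, so the function is convex in
`r` and lies above its tangent at `r`. -/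
theorem truncPrimitive_sub_le {d r r' : ℝ} (hd : 0 ≤ d) :
    min d (max r 0) * (r' - r) * 2 ≤ truncPrimitive d r' - truncPrimitive d r := by
  have h1 : min d (max r 0) * (r' - r) ≤ min d (max r 0) * (max r' 0 - max r 0) := by
    rcases le_total r 0 with h | h
    · simp [max_eq_right h, min_eq_right hd]
    · rw [max_eq_left h]
      exact mul_le_mul_of_nonneg_left (sub_le_sub_right (le_max_left _ _) _) (le_min hd h)
  have key : ∀ R R' : ℝ, min d R * (R' - R) * 2 ≤
      (R' ^ 2 - max (R' - d) 0 ^ 2) - (R ^ 2 - max (R - d) 0 ^ 2) := by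
    intro R R'
    rcases le_total d R with h | h <;> rcases le_total d R' with h' | h'
    · rw [min_eq_left h, max_eq_left (sub_nonneg.2 h), max_eq_left (sub_nonneg.2 h')]
      nlinarith
    · rw [min_eq_left h, max_eq_left (sub_nonneg.2 h), max_eq_right (sub_nonpos.2 h')]
      nlinarith
    · rw [min_eq_right h, max_eq_right (sub_nonpos.2 h), max_eq_left (sub_nonneg.2 h')]
      nlinarith
    · rw [min_eq_right h, max_eq_right (sub_nonpos.2 h), max_eq_right (sub_nonpos.2 h')]
      nlinarith [sq_nonneg (R - R')]
  unfold truncPrimitive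
  linarith [key (max r 0) (max r' 0)]

/-- The derivative in `d` is `2 (r₊ - d)₊`, which is nonincreasing, so the function is concave in
`d` and lies below its tangent at `d`. -/
theorem truncPrimitive_sub_le' (d d' r : ℝ) :
    truncPrimitive d' r - truncPrimitive d r ≤ 2 * max (max r 0 - d) 0 * (d' - d) := by
  unfold truncPrimitive
  set R := max r 0
  rcases le_total d R with h | h <;> rcases le_total d' R with h' | h'
  · rw [max_eq_left (sub_nonneg.2 h), max_eq_left (sub_nonneg.2 h')]
    nlinarith [sq_nonneg (d - d')]
  · rw [max_eq_left (sub_nonneg.2 h), max_eq_right (sub_nonpos.2 h')]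
    nlinarith
  · rw [max_eq_right (sub_nonpos.2 h), max_eq_left (sub_nonneg.2 h')]
    nlinarith
  · rw [max_eq_right (sub_nonpos.2 h), max_eq_right (sub_nonpos.2 h')]
    nlinarith

/-! ### Separability and the weighted form of the Gagliardo seminorm -/

instance sigmaFinite_gagliardo {n : ℕ} (s p : ℝ) (D : Set (EuclideanSpace ℝ (Fin n))) :
    SigmaFinite (gagliardoMeasure s p D) := by
  unfold gagliardoMeasure
  infer_instance

/-- Separability is needed twice: to get strong measurability of curves in this space from
distances, and to choose one null set of times for all test directions. -/
instance secondCountable_sobolev {n : ℕ} (s p : ℝ) [Fact (2 ≤ p)]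
    (D : Set (EuclideanSpace ℝ (Fin n))) : SecondCountableTopology (Sobolev s p D) := by
  have : Fact (ENNReal.ofReal p ≠ ⊤) := ⟨ENNReal.ofReal_ne_top⟩
  have h1 : SecondCountableTopology (Lp ℝ (ENNReal.ofReal p) (volume.restrict D)) := inferInstance
  have h2 : SecondCountableTopology (Lp ℝ (ENNReal.ofReal p) (gagliardoMeasure s p D)) :=
    inferInstance
  have : SecondCountableTopology (WithLp 1 (Lp ℝ (ENNReal.ofReal p) (volume.restrict D) ×
      Lp ℝ (ENNReal.ofReal p) (gagliardoMeasure s p D))) := inferInstance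
  infer_instance

/-- The `p`-th root of the kernel `|x - y|^{-(n + s p)}`. -/
def weight {n : ℕ} (s p : ℝ) (z : EuclideanSpace ℝ (Fin n) × EuclideanSpace ℝ (Fin n)) : ℝ :=
  ‖z.1 - z.2‖ ^ (-(((n : ℝ) + s * p) / p))

theorem weight_nonneg {n : ℕ} (s p : ℝ)
    (z : EuclideanSpace ℝ (Fin n) × EuclideanSpace ℝ (Fin n)) : 0 ≤ weight s p z := by
  unfold weight; positivity

theorem measurable_weight {n : ℕ} (s p : ℝ) :
    Measurable (weight s p : EuclideanSpace ℝ (Fin n) × EuclideanSpace ℝ (Fin n) → ℝ) := by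
  unfold weight; fun_prop

theorem weight_rpow {n : ℕ} (s : ℝ) {p : ℝ} (hp : 0 < p)
    (z : EuclideanSpace ℝ (Fin n) × EuclideanSpace ℝ (Fin n)) :
    weight s p z ^ p = 1 / ‖z.1 - z.2‖ ^ ((n : ℝ) + s * p) := by
  unfold weight
  rw [← Real.rpow_mul (norm_nonneg _), neg_mul, div_mul_cancel₀ _ hp.ne',
    Real.rpow_neg (norm_nonneg _), one_div]

section ENorm

variable {α : Type*} [MeasurableSpace α]

theorem eLpNorm_rpow {p : ℝ} (hp : 0 < p) (μ : Measure α) (f : α → ℝ) :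
    eLpNorm f (ENNReal.ofReal p) μ ^ p = ∫⁻ x, ‖f x‖ₑ ^ p ∂μ := by
  rw [eLpNorm_eq_lintegral_rpow_enorm_toReal (by simpa using hp) ENNReal.ofReal_ne_top,
    ENNReal.toReal_ofReal hp.le, ← ENNReal.rpow_mul, one_div, inv_mul_cancel₀ hp.ne',
    ENNReal.rpow_one]

theorem eLpNorm_lt_top_iff {p : ℝ} (hp : 0 < p) (μ : Measure α) (f : α → ℝ) :
    eLpNorm f (ENNReal.ofReal p) μ < ⊤ ↔ ∫⁻ x, ‖f x‖ₑ ^ p ∂μ < ⊤ := by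
  rw [← eLpNorm_rpow hp, ENNReal.rpow_lt_top_iff_of_pos hp]

theorem measurable_eLpNorm_slice {β : Type*} [MeasurableSpace β] {p : ℝ} (hp : 0 < p)
    (ν : Measure α) [SFinite ν] {F : β × α → ℝ} (hF : Measurable F) :
    Measurable fun t => eLpNorm (fun x => F (t, x)) (ENNReal.ofReal p) ν := by
  simp_rw [eLpNorm_eq_lintegral_rpow_enorm_toReal (by simpa using hp) ENNReal.ofReal_ne_top]
  exact (Measurable.lintegral_prod_right' (hF.enorm.pow_const _)).pow_const _

theorem lintegral_eLpNorm_slice {β : Type*} [MeasurableSpace β] {p : ℝ} (hp : 0 < p)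
    (μ : Measure β) (ν : Measure α) [SFinite ν] {F : β × α → ℝ}
    (hF : AEMeasurable F (μ.prod ν)) :
    ∫⁻ t, eLpNorm (fun x => F (t, x)) (ENNReal.ofReal p) ν ^ p ∂μ =
      ∫⁻ z, ‖F z‖ₑ ^ p ∂(μ.prod ν) := by
  simp_rw [eLpNorm_rpow hp]
  rw [lintegral_prod _ (hF.enorm.pow_const _)]

end ENorm

/-- Moving the kernel from the measure into the function turns the seminorm into a norm for Lebesgue
measure, on which translation arguments can be run. -/
theorem eLpNorm_gagliardo {n : ℕ} (s : ℝ) {p : ℝ} (hp : 0 < p)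
    (D : Set (EuclideanSpace ℝ (Fin n)))
    {F : EuclideanSpace ℝ (Fin n) × EuclideanSpace ℝ (Fin n) → ℝ} (hF : Measurable F) :
    eLpNorm F (ENNReal.ofReal p) (gagliardoMeasure s p D) =
      eLpNorm (fun z => weight s p z * F z) (ENNReal.ofReal p)
        ((volume.restrict D).prod (volume.restrict D)) := by
  simp_rw [eLpNorm_eq_lintegral_rpow_enorm_toReal (p := ENNReal.ofReal p) (by simpa using hp)
    ENNReal.ofReal_ne_top, ENNReal.toReal_ofReal hp.le]
  congr 1
  rw [gagliardoMeasure, lintegral_withDensity_eq_lintegral_mul _ (by fun_prop)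
    (hF.enorm.pow_const p)]
  refine lintegral_congr fun z => ?_
  rw [Pi.mul_apply, enorm_mul, ENNReal.mul_rpow_of_nonneg _ _ hp.le,
    Real.enorm_of_nonneg (weight_nonneg s p z),
    ENNReal.ofReal_rpow_of_nonneg (weight_nonneg s p z) hp.le, weight_rpow s hp]

theorem gagliardoMeasure_eq_restrict {n : ℕ} (s p : ℝ) (D : Set (EuclideanSpace ℝ (Fin n))) :
    gagliardoMeasure s p D = (gagliardoMeasure s p univ).restrict (D ×ˢ D) := by
  unfold gagliardoMeasure
  rw [Measure.prod_restrict, Measure.restrict_univ, restrict_withDensity']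

theorem MemSobolev.mono_univ {n : ℕ} {s p : ℝ} (D : Set (EuclideanSpace ℝ (Fin n)))
    {f : EuclideanSpace ℝ (Fin n) → ℝ} (h : MemSobolev s p univ f) : MemSobolev s p D f := by
  obtain ⟨h1, h2⟩ := h
  rw [Measure.restrict_univ] at h1
  refine ⟨h1.restrict D, ?_⟩
  rw [gagliardoMeasure_eq_restrict]
  exact h2.restrict _

theorem sobolevNorm_le_univ {n : ℕ} (s p : ℝ) (D : Set (EuclideanSpace ℝ (Fin n)))
    (f : EuclideanSpace ℝ (Fin n) → ℝ) : sobolevNorm s p D f ≤ sobolevNorm s p univ f := by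
  unfold sobolevNorm
  rw [gagliardoMeasure_eq_restrict s p D, Measure.restrict_univ]
  exact add_le_add (eLpNorm_mono_measure _ Measure.restrict_le_self)
    (eLpNorm_mono_measure _ Measure.restrict_le_self)

/-! ### Elements of the Sobolev space given by functions -/

section ofFun

variable {n : ℕ} {s p : ℝ} [Fact (2 ≤ p)] {D : Set (EuclideanSpace ℝ (Fin n))}
  {f : EuclideanSpace ℝ (Fin n) → ℝ}

theorem fst_ofFun (h : MemSobolev s p D f) (h1 : MemLp f (ENNReal.ofReal p) (volume.restrict D)) :
    (Sobolev.ofFun s p D f).1.fst = h1.toLp f := by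
  unfold Sobolev.ofFun
  rw [dif_pos h]
  rfl

theorem snd_ofFun (h : MemSobolev s p D f)
    (h2 : MemLp (fun z : EuclideanSpace ℝ (Fin n) × EuclideanSpace ℝ (Fin n) => f z.1 - f z.2)
      (ENNReal.ofReal p) (gagliardoMeasure s p D)) :
    (Sobolev.ofFun s p D f).1.snd = h2.toLp _ := by
  unfold Sobolev.ofFun
  rw [dif_pos h]
  rfl

theorem rep_ofFun (h : MemSobolev s p D f) :
    Sobolev.rep (Sobolev.ofFun s p D f) =ᵐ[volume.restrict D] f := by
  have h1 : MemLp f (ENNReal.ofReal p) (volume.restrict D) := h.1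
  unfold Sobolev.rep
  rw [fst_ofFun h h1]
  exact h1.coeFn_toLp

theorem norm_sobolev (w : Sobolev s p D) : ‖w‖ = ‖w.1.fst‖ + ‖w.1.snd‖ :=
  WithLp.prod_norm_eq_of_L1 w.1

theorem norm_ofFun_sub (h : MemSobolev s p D f) (w : Sobolev s p D) :
    ‖Sobolev.ofFun s p D f - w‖ =
      (eLpNorm (fun x => f x - w.1.fst x) (ENNReal.ofReal p) (volume.restrict D)).toReal +
      (eLpNorm (fun z => (f z.1 - f z.2) - w.1.snd z) (ENNReal.ofReal p)
        (gagliardoMeasure s p D)).toReal := by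
  have h1 : MemLp f (ENNReal.ofReal p) (volume.restrict D) := h.1
  have h2 : MemLp (fun z : EuclideanSpace ℝ (Fin n) × EuclideanSpace ℝ (Fin n) => f z.1 - f z.2)
      (ENNReal.ofReal p) (gagliardoMeasure s p D) := h.2
  have e : ‖Sobolev.ofFun s p D f - w‖ = ‖h1.toLp f - w.1.fst‖ + ‖h2.toLp _ - w.1.snd‖ := by
    rw [norm_sobolev, ← fst_ofFun h h1, ← snd_ofFun h h2]
    rfl
  rw [e, Lp.norm_def, Lp.norm_def]
  congr 2
  · refine eLpNorm_congr_ae ?_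
    filter_upwards [Lp.coeFn_sub (h1.toLp f) w.1.fst, h1.coeFn_toLp] with x h3 h4
    rw [h3, Pi.sub_apply, h4]
  · refine eLpNorm_congr_ae ?_
    filter_upwards [Lp.coeFn_sub (h2.toLp _) w.1.snd, h2.coeFn_toLp] with x h3 h4
    rw [h3, Pi.sub_apply, h4]

theorem norm_ofFun (h : MemSobolev s p D f) :
    ‖Sobolev.ofFun s p D f‖ = (sobolevNorm s p D f).toReal := by
  have h1 : MemLp f (ENNReal.ofReal p) (volume.restrict D) := h.1
  have h2 : MemLp (fun z : EuclideanSpace ℝ (Fin n) × EuclideanSpace ℝ (Fin n) => f z.1 - f z.2)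
      (ENNReal.ofReal p) (gagliardoMeasure s p D) := h.2
  rw [norm_sobolev, fst_ofFun h h1, snd_ofFun h h2, Lp.norm_toLp, Lp.norm_toLp,
    sobolevNorm, ENNReal.toReal_add h1.2.ne h2.2.ne]

/-- No membership is required: otherwise the class is zero by convention. -/
theorem enorm_ofFun_le : ‖Sobolev.ofFun s p D f‖ₑ ≤ sobolevNorm s p D f := by
  by_cases h : MemSobolev s p D f
  · rw [← ofReal_norm, norm_ofFun h]
    exact ENNReal.ofReal_toReal_le
  · unfold Sobolev.ofFun
    rw [dif_neg h]
    exact enorm_zero.trans_le zero_le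

/-- Membership itself is invariant under changes on null sets, so both sides fall into the same
branch of the definition. -/
theorem ofFun_congr {g : EuclideanSpace ℝ (Fin n) → ℝ} (h : f =ᵐ[volume] g) :
    Sobolev.ofFun s p D f = Sobolev.ofFun s p D g := by
  have h1 : f =ᵐ[volume.restrict D] g := ae_restrict_of_ae h
  have h2 : (fun z : EuclideanSpace ℝ (Fin n) × EuclideanSpace ℝ (Fin n) => f z.1 - f z.2)
      =ᵐ[gagliardoMeasure s p D] fun z => g z.1 - g z.2 := by
    filter_upwards [ae_fst_gagliardo s p D h1, ae_snd_gagliardo s p D h1] with z h3 h4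
    rw [h3, h4]
  have hiff : MemSobolev s p D f ↔ MemSobolev s p D g :=
    and_congr (memLp_congr_ae h1) (memLp_congr_ae h2)
  by_cases h : MemSobolev s p D f
  · have hg := hiff.1 h
    rw [← sub_eq_zero, ← norm_eq_zero, norm_sobolev]
    have e1 : (Sobolev.ofFun s p D f).1.fst = (Sobolev.ofFun s p D g).1.fst := by
      rw [fst_ofFun h h.1, fst_ofFun hg hg.1]
      exact (MemLp.toLp_eq_toLp_iff _ _).2 h1
    have e2 : (Sobolev.ofFun s p D f).1.snd = (Sobolev.ofFun s p D g).1.snd := by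
      rw [snd_ofFun h h.2, snd_ofFun hg hg.2]
      exact (MemLp.toLp_eq_toLp_iff _ _).2 h2
    change ‖(Sobolev.ofFun s p D f).1.fst - (Sobolev.ofFun s p D g).1.fst‖ +
      ‖(Sobolev.ofFun s p D f).1.snd - (Sobolev.ofFun s p D g).1.snd‖ = 0
    rw [e1, e2, sub_self, sub_self, norm_zero, norm_zero, add_zero]
  · have hg := mt hiff.2 h
    unfold Sobolev.ofFun
    rw [dif_neg h, dif_neg hg]

end ofFun

/-! ### Curves in the Sobolev space on the whole time axis -/

/-- A jointly measurable representative, on the whole time axis, of an element of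
`L^p(ℝ; W^{s,p}(ℝⁿ))`. -/
structure IsSobolevCurve {n : ℕ} (s p : ℝ) (u : ℝ → EuclideanSpace ℝ (Fin n) → ℝ) : Prop where
  measurable : Measurable fun q : ℝ × EuclideanSpace ℝ (Fin n) => u q.1 q.2
  memLp : MemLp (fun q : ℝ × EuclideanSpace ℝ (Fin n) => u q.1 q.2) (ENNReal.ofReal p) volume
  memLp_diff : MemLp (fun z : ℝ × EuclideanSpace ℝ (Fin n) × EuclideanSpace ℝ (Fin n) =>
    weight s p z.2 * (u z.1 z.2.1 - u z.1 z.2.2)) (ENNReal.ofReal p) volume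

theorem measurable_diff {n : ℕ} {u : ℝ → EuclideanSpace ℝ (Fin n) → ℝ}
    (hu : Measurable fun q : ℝ × EuclideanSpace ℝ (Fin n) => u q.1 q.2) :
    Measurable fun z : ℝ × EuclideanSpace ℝ (Fin n) × EuclideanSpace ℝ (Fin n) =>
      u z.1 z.2.1 - u z.1 z.2.2 :=
  (hu.comp (measurable_fst.prodMk (measurable_fst.comp measurable_snd))).sub
    (hu.comp (measurable_fst.prodMk (measurable_snd.comp measurable_snd)))

theorem measurable_weight_diff {n : ℕ} (s p : ℝ) {u : ℝ → EuclideanSpace ℝ (Fin n) → ℝ}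
    (hu : Measurable fun q : ℝ × EuclideanSpace ℝ (Fin n) => u q.1 q.2) :
    Measurable fun z : ℝ × EuclideanSpace ℝ (Fin n) × EuclideanSpace ℝ (Fin n) =>
      weight s p z.2 * (u z.1 z.2.1 - u z.1 z.2.2) :=
  ((measurable_weight s p).comp measurable_snd).mul (measurable_diff hu)

theorem measurable_slice {n : ℕ} {u : ℝ → EuclideanSpace ℝ (Fin n) → ℝ}
    (hu : Measurable fun q : ℝ × EuclideanSpace ℝ (Fin n) => u q.1 q.2) (t : ℝ) :
    Measurable (u t) :=
  hu.comp measurable_prodMk_left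

theorem measurable_slice_diff {n : ℕ} {f : EuclideanSpace ℝ (Fin n) → ℝ} (hf : Measurable f) :
    Measurable fun z : EuclideanSpace ℝ (Fin n) × EuclideanSpace ℝ (Fin n) => f z.1 - f z.2 :=
  (hf.comp measurable_fst).sub (hf.comp measurable_snd)

theorem sobolevNorm_univ_eq {n : ℕ} (s : ℝ) {p : ℝ} (hp : 0 < p)
    {f : EuclideanSpace ℝ (Fin n) → ℝ} (hf : Measurable f) :
    sobolevNorm s p univ f = eLpNorm f (ENNReal.ofReal p) volume +
      eLpNorm (fun z => weight s p z * (f z.1 - f z.2)) (ENNReal.ofReal p) volume := by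
  rw [sobolevNorm, eLpNorm_gagliardo s hp univ (measurable_slice_diff hf), Measure.restrict_univ]
  rfl

theorem memSobolev_of_sobolevNorm_lt_top {n : ℕ} {s p : ℝ} {D : Set (EuclideanSpace ℝ (Fin n))}
    {f : EuclideanSpace ℝ (Fin n) → ℝ} (hf : Measurable f) (h : sobolevNorm s p D f < ⊤) :
    MemSobolev s p D f :=
  ⟨⟨hf.aestronglyMeasurable, (le_self_add.trans_lt h)⟩,
    ⟨(measurable_slice_diff hf).aestronglyMeasurable, le_add_self.trans_lt h⟩⟩

theorem measurable_sobolevNorm {n : ℕ} (s : ℝ) {p : ℝ} (hp : 0 < p)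
    (D : Set (EuclideanSpace ℝ (Fin n))) {u : ℝ → EuclideanSpace ℝ (Fin n) → ℝ}
    (hu : Measurable fun q : ℝ × EuclideanSpace ℝ (Fin n) => u q.1 q.2) :
    Measurable fun t => sobolevNorm s p D (u t) :=
  (measurable_eLpNorm_slice hp (volume.restrict D)
    (F := fun q : ℝ × EuclideanSpace ℝ (Fin n) => u q.1 q.2) hu).add
    (measurable_eLpNorm_slice hp (gagliardoMeasure s p D)
      (F := fun z : ℝ × EuclideanSpace ℝ (Fin n) × EuclideanSpace ℝ (Fin n) =>
        u z.1 z.2.1 - u z.1 z.2.2) (measurable_diff hu))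

/-- Tonelli identifies the time integrals of the two parts with norms on the product. The `p`-th
power of their sum is comparable to the sum of their `p`-th powers. -/
theorem lintegral_sobolevNorm_lt_top_iff {n : ℕ} (s : ℝ) {p : ℝ} (hp : 1 ≤ p)
    {u : ℝ → EuclideanSpace ℝ (Fin n) → ℝ}
    (hu : Measurable fun q : ℝ × EuclideanSpace ℝ (Fin n) => u q.1 q.2) :
    ∫⁻ t, sobolevNorm s p univ (u t) ^ p < ⊤ ↔ IsSobolevCurve s p u := by
  have hp0 : 0 < p := by linarith
  have e1 := lintegral_eLpNorm_slice hp0 (volume : Measure ℝ)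
    (volume : Measure (EuclideanSpace ℝ (Fin n)))
    (F := fun q : ℝ × EuclideanSpace ℝ (Fin n) => u q.1 q.2) hu.aemeasurable
  have e2 := lintegral_eLpNorm_slice hp0 (volume : Measure ℝ)
    (volume : Measure (EuclideanSpace ℝ (Fin n) × EuclideanSpace ℝ (Fin n)))
    (F := fun z : ℝ × EuclideanSpace ℝ (Fin n) × EuclideanSpace ℝ (Fin n) =>
      weight s p z.2 * (u z.1 z.2.1 - u z.1 z.2.2))
    (measurable_weight_diff s p hu).aemeasurable
  have m1 : Measurable fun t => eLpNorm (u t) (ENNReal.ofReal p) volume :=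
    measurable_eLpNorm_slice hp0 volume
      (F := fun q : ℝ × EuclideanSpace ℝ (Fin n) => u q.1 q.2) hu
  have hiff : IsSobolevCurve s p u ↔
      ∫⁻ t, eLpNorm (u t) (ENNReal.ofReal p) volume ^ p < ⊤ ∧
      ∫⁻ t, eLpNorm (fun z : EuclideanSpace ℝ (Fin n) × EuclideanSpace ℝ (Fin n) =>
        weight s p z * (u t z.1 - u t z.2)) (ENNReal.ofReal p) volume ^ p < ⊤ := by
    rw [e1, e2, ← eLpNorm_lt_top_iff hp0, ← eLpNorm_lt_top_iff hp0]
    exact ⟨fun h => ⟨h.memLp.2, h.memLp_diff.2⟩, fun h => ⟨hu, ⟨hu.aestronglyMeasurable, h.1⟩,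
      ⟨(measurable_weight_diff s p hu).aestronglyMeasurable, h.2⟩⟩⟩
  rw [hiff]
  simp_rw [sobolevNorm_univ_eq s hp0 (measurable_slice hu _)]
  constructor
  · intro h
    exact ⟨(lintegral_mono fun t => by gcongr; exact le_self_add).trans_lt h,
      (lintegral_mono fun t => by gcongr; exact le_add_self).trans_lt h⟩
  · intro h
    refine (lintegral_mono fun t => ENNReal.rpow_add_le_mul_rpow_add_rpow _ _ hp).trans_lt ?_
    rw [lintegral_const_mul' _ _ (ENNReal.rpow_ne_top_of_nonneg (by linarith) (by simp)),
      lintegral_add_left (m1.pow_const p)]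
    exact ENNReal.mul_lt_top (ENNReal.rpow_lt_top_of_nonneg (by linarith) (by simp))
      (ENNReal.add_lt_top.2 h)

namespace IsSobolevCurve

variable {n : ℕ} {s p : ℝ} {u v w : ℝ → EuclideanSpace ℝ (Fin n) → ℝ}

theorem lintegral_lt_top (hu : IsSobolevCurve s p u) (hp : 1 ≤ p) :
    ∫⁻ t, sobolevNorm s p univ (u t) ^ p < ⊤ :=
  (lintegral_sobolevNorm_lt_top_iff s hp hu.measurable).2 hu

theorem memLpSobolev (hu : IsSobolevCurve s p u) (hp : 1 ≤ p) (t₁ t₂ : ℝ) :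
    MemLpSobolev s p t₁ t₂ u where
  aestronglyMeasurable := hu.measurable.aestronglyMeasurable
  lintegral_lt_top := (setLIntegral_le_lintegral _ _).trans_lt (hu.lintegral_lt_top hp)

theorem ae_memSobolev (hu : IsSobolevCurve s p u) (hp : 1 ≤ p)
    (D : Set (EuclideanSpace ℝ (Fin n))) : ∀ᵐ t, MemSobolev s p D (u t) := by
  have hp0 : 0 < p := by linarith
  have := ae_lt_top ((measurable_sobolevNorm s hp0 univ hu.measurable).pow_const p)
    (hu.lintegral_lt_top hp).ne
  filter_upwards [this] with t ht
  rw [ENNReal.rpow_lt_top_iff_of_pos hp0] at ht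
  exact (memSobolev_of_sobolevNorm_lt_top (measurable_slice hu.measurable t) ht).mono_univ D

theorem of_le (hv : IsSobolevCurve s p v) (hw : IsSobolevCurve s p w)
    (hu : Measurable fun q : ℝ × EuclideanSpace ℝ (Fin n) => u q.1 q.2)
    (h1 : ∀ t x, |u t x| ≤ |v t x| + |w t x|)
    (h2 : ∀ t x y, |u t x - u t y| ≤ |v t x - v t y| + |w t x - w t y|) :
    IsSobolevCurve s p u where
  measurable := hu
  memLp := by
    refine (hv.memLp.norm.add hw.memLp.norm).mono hu.aestronglyMeasurable (ae_of_all _ fun z => ?_)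
    exact (h1 z.1 z.2).trans (le_abs_self _)
  memLp_diff := by
    refine (hv.memLp_diff.norm.add hw.memLp_diff.norm).mono
      (measurable_weight_diff s p hu).aestronglyMeasurable (ae_of_all _ fun z => ?_)
    refine le_trans ?_ (le_abs_self _)
    simp only [Pi.add_apply, norm_mul, Real.norm_eq_abs, ← mul_add]
    exact mul_le_mul_of_nonneg_left (h2 _ _ _) (abs_nonneg _)

theorem zero : IsSobolevCurve s p (fun (_ : ℝ) (_ : EuclideanSpace ℝ (Fin n)) => 0) where
  measurable := measurable_const
  memLp := MemLp.zero
  memLp_diff := by simp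

theorem mono (hv : IsSobolevCurve s p v)
    (hu : Measurable fun q : ℝ × EuclideanSpace ℝ (Fin n) => u q.1 q.2)
    (h1 : ∀ t x, |u t x| ≤ |v t x|)
    (h2 : ∀ t x y, |u t x - u t y| ≤ |v t x - v t y|) : IsSobolevCurve s p u :=
  hv.of_le zero hu (by simpa using h1) (by simpa using h2)

variable [Fact (2 ≤ p)]

/-- The distance to a fixed `w` is a sum of `L^p` norms of slices, measurable in time by Tonelli. At
times where the slice is not in the space, the class is zero and the distance is `‖w‖`. -/
theorem stronglyMeasurable_ofFun (hu : Measurable fun q : ℝ × EuclideanSpace ℝ (Fin n) => u q.1 q.2)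
    (D : Set (EuclideanSpace ℝ (Fin n))) :
    StronglyMeasurable fun t => Sobolev.ofFun s p D (u t) := by
  have hp0 : 0 < p := by linarith [(Fact.out : 2 ≤ p)]
  refine stronglyMeasurable_of_measurable_dist fun w => ?_
  have hm : MeasurableSet {t | sobolevNorm s p D (u t) < ⊤} :=
    measurableSet_lt (measurable_sobolevNorm s hp0 D hu) measurable_const
  have hset : {t | MemSobolev s p D (u t)} = {t | sobolevNorm s p D (u t) < ⊤} := by
    ext t
    exact ⟨fun h => ENNReal.add_lt_top.2 ⟨h.1.2, h.2.2⟩,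
      fun h => memSobolev_of_sobolevNorm_lt_top (measurable_slice hu t) h⟩
  classical
  have : (fun t => dist (Sobolev.ofFun s p D (u t)) w) = fun t =>
      if t ∈ {t | sobolevNorm s p D (u t) < ⊤} then
        (eLpNorm (fun x => u t x - w.1.fst x) (ENNReal.ofReal p) (volume.restrict D)).toReal +
        (eLpNorm (fun z => (u t z.1 - u t z.2) - w.1.snd z) (ENNReal.ofReal p)
          (gagliardoMeasure s p D)).toReal
      else ‖w‖ := by
    ext t
    rw [dist_eq_norm]
    split_ifs with h
    · rw [← hset] at h
      exact norm_ofFun_sub h w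
    · rw [← hset] at h
      have h0 : Sobolev.ofFun s p D (u t) = 0 := by
        unfold Sobolev.ofFun; exact dif_neg h
      rw [h0, zero_sub, norm_neg]
  rw [this]
  refine Measurable.ite hm (Measurable.add ?_ ?_) measurable_const
  · exact (measurable_eLpNorm_slice hp0 (volume.restrict D)
      (F := fun q : ℝ × EuclideanSpace ℝ (Fin n) => u q.1 q.2 - w.1.fst q.2)
      (hu.sub ((Lp.stronglyMeasurable w.1.fst).measurable.comp measurable_snd))).ennreal_toReal
  · exact (measurable_eLpNorm_slice hp0 (gagliardoMeasure s p D)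
      (F := fun z : ℝ × EuclideanSpace ℝ (Fin n) × EuclideanSpace ℝ (Fin n) =>
        (u z.1 z.2.1 - u z.1 z.2.2) - w.1.snd z.2)
      ((measurable_diff hu).sub
        ((Lp.stronglyMeasurable w.1.snd).measurable.comp measurable_snd))).ennreal_toReal

theorem memLp_ofFun (hu : IsSobolevCurve s p u) (D : Set (EuclideanSpace ℝ (Fin n))) :
    MemLp (fun t => Sobolev.ofFun s p D (u t)) (ENNReal.ofReal p) volume := by
  have hp0 : 1 ≤ p := by linarith [(Fact.out : 2 ≤ p)]
  refine ⟨(stronglyMeasurable_ofFun hu.measurable D).aestronglyMeasurable, ?_⟩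
  rw [eLpNorm_lt_top_iff_lintegral_rpow_enorm_lt_top (by simp; linarith) ENNReal.ofReal_ne_top,
    ENNReal.toReal_ofReal (by linarith)]
  refine lt_of_le_of_lt (lintegral_mono fun t => ?_) (hu.lintegral_lt_top hp0)
  gcongr
  exact enorm_ofFun_le.trans (sobolevNorm_le_univ _ _ _ _)

end IsSobolevCurve

theorem sobolevNorm_congr {n : ℕ} (s p : ℝ) (D : Set (EuclideanSpace ℝ (Fin n)))
    {f g : EuclideanSpace ℝ (Fin n) → ℝ} (h : f =ᵐ[volume] g) :
    sobolevNorm s p D f = sobolevNorm s p D g := by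
  have h1 : f =ᵐ[volume.restrict D] g := ae_restrict_of_ae h
  unfold sobolevNorm
  rw [eLpNorm_congr_ae h1]
  congr 1
  refine eLpNorm_congr_ae ?_
  filter_upwards [ae_fst_gagliardo s p D h1, ae_snd_gagliardo s p D h1] with z h3 h4
  rw [h3, h4]

/-- Only the slices up to null sets enter the equation, so a jointly measurable version may replace
`u`. Its extension by zero makes all time translates meaningful. -/
theorem MemLpSobolev.exists_curve {n : ℕ} {s p t₁ t₂ : ℝ} (hp : 1 ≤ p)
    {u : ℝ → EuclideanSpace ℝ (Fin n) → ℝ} (hu : MemLpSobolev s p t₁ t₂ u) :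
    ∃ U : ℝ → EuclideanSpace ℝ (Fin n) → ℝ, IsSobolevCurve s p U ∧
      (∀ t, t ∉ Ioo t₁ t₂ → ∀ x, U t x = 0) ∧
      ∀ᵐ t ∂(volume.restrict (Ioo t₁ t₂)), u t =ᵐ[volume] U t := by
  have hp0 : 0 < p := by linarith
  obtain ⟨hm, hfin⟩ := hu
  set g := hm.mk _ with hg
  have hgm : Measurable g := hm.stronglyMeasurable_mk.measurable
  set U : ℝ → EuclideanSpace ℝ (Fin n) → ℝ :=
    fun t x => (Ioo t₁ t₂ ×ˢ univ).indicator g (t, x) with hU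
  have hUm : Measurable fun q : ℝ × EuclideanSpace ℝ (Fin n) => U q.1 q.2 :=
    hgm.indicator (measurableSet_Ioo.prod MeasurableSet.univ)
  have hae : ∀ᵐ t ∂(volume.restrict (Ioo t₁ t₂)), u t =ᵐ[volume] U t := by
    have := Measure.ae_ae_of_ae_prod hm.ae_eq_mk
    filter_upwards [this, ae_restrict_mem measurableSet_Ioo] with t h1 h2
    filter_upwards [h1] with x hx
    simp [hU, h2.1, h2.2, hx, hg]
  have h0 : ∀ t, t ∉ Ioo t₁ t₂ → ∀ x, U t x = 0 := fun t ht x =>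
    indicator_of_notMem (fun h => ht h.1) _
  refine ⟨U, ?_, h0, hae⟩
  rw [← lintegral_sobolevNorm_lt_top_iff s hp hUm, ← setLIntegral_eq_of_support_subset (s := Ioo t₁ t₂)]
  · refine lt_of_le_of_lt (lintegral_mono_ae ?_) hfin
    filter_upwards [hae] with t ht
    rw [sobolevNorm_congr s p univ ht]
  · intro t ht
    by_contra hn
    apply ht
    have : U t = fun _ => 0 := funext (h0 t hn)
    simp [this, sobolevNorm, hp0]

/-! ### Steklov averages and their time derivative -/

section Product

variable {α β γ : Type*} [MeasurableSpace α] [MeasurableSpace β] [MeasurableSpace γ]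

/-- For each fixed first coordinate the map is a translation in time. It transports `L^p` bounds to
the integrand of a Steklov average, jointly in the averaging variable. -/
theorem measurePreserving_shear (ρ : Measure ℝ) [SFinite ρ] (ν : Measure α) [SFinite ν] (h : ℝ) :
    MeasurePreserving (fun z : ℝ × ℝ × α => (z.1, (z.2.1 + h * z.1, z.2.2)))
      (ρ.prod ((volume : Measure ℝ).prod ν)) (ρ.prod ((volume : Measure ℝ).prod ν)) := by
  refine (MeasurePreserving.id ρ).skew_product (g := fun r (q : ℝ × α) => (q.1 + h * r, q.2)) ?_
    (ae_of_all _ fun r => ?_)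
  · unfold Function.uncurry; fun_prop
  · exact ((measurePreserving_add_right volume (h * r)).prod (MeasurePreserving.id ν)).map_eq

theorem measurePreserving_swap_mid (μ₁ : Measure α) (μ₂ : Measure β) (μ₃ : Measure γ)
    [SFinite μ₁] [SFinite μ₂] [SFinite μ₃] :
    MeasurePreserving (fun z : α × β × γ => (z.2.1, (z.1, z.2.2)))
      (μ₁.prod (μ₂.prod μ₃)) (μ₂.prod (μ₁.prod μ₃)) :=
  (measurePreserving_prodAssoc μ₂ μ₁ μ₃).comp
    (((Measure.measurePreserving_swap (μ := μ₁) (ν := μ₂)).prod (MeasurePreserving.id μ₃)).comp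
      (measurePreserving_prodAssoc μ₁ μ₂ μ₃).symm)

theorem memLp_translate {ρ : Measure ℝ} [IsFiniteMeasure ρ] {ν : Measure α} [SFinite ν] (h : ℝ)
    {q : ENNReal} {g : ℝ × α → ℝ} (hg : MemLp g q ((volume : Measure ℝ).prod ν)) :
    MemLp (fun z : ℝ × ℝ × α => g (z.2.1 + h * z.1, z.2.2)) q
      (ρ.prod ((volume : Measure ℝ).prod ν)) :=
  (hg.comp_snd ρ).comp_measurePreserving (measurePreserving_shear ρ ν h)

end Product

instance : IsProbabilityMeasure ((volume : Measure ℝ).restrict (Ioc 0 1)) :=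
  ⟨by simp⟩

/-- The mean value of `ψ` over the time interval `(t, t + h)`. -/
def steklov {n : ℕ} (h : ℝ) (ψ : ℝ → EuclideanSpace ℝ (Fin n) → ℝ) (t : ℝ)
    (x : EuclideanSpace ℝ (Fin n)) : ℝ :=
  ∫ r in Ioc (0 : ℝ) 1, ψ (t + h * r) x

theorem ae_integrable_translate {n : ℕ} {p : ℝ} (hp : 1 ≤ p) (h : ℝ)
    {ψ : ℝ → EuclideanSpace ℝ (Fin n) → ℝ}
    (hψ : MemLp (fun q : ℝ × EuclideanSpace ℝ (Fin n) => ψ q.1 q.2) (ENNReal.ofReal p) volume) :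
    ∀ᵐ q : ℝ × EuclideanSpace ℝ (Fin n), Integrable (fun r => ψ (q.1 + h * r) q.2)
      (volume.restrict (Ioc (0 : ℝ) 1)) := by
  have h1 := memLp_translate (ρ := volume.restrict (Ioc (0 : ℝ) 1)) h hψ
  have hp0 : 0 < p := by linarith
  have h2 := h1.2
  rw [eLpNorm_lt_top_iff hp0, lintegral_prod_symm _ (h1.1.enorm.pow_const p)] at h2
  have h3 := ae_lt_top' (h1.1.enorm.pow_const p).prod_swap.lintegral_prod_right' h2.ne
  have h4 := h1.1.prod_swap.prodMk_left
  filter_upwards [h3, h4] with q hq3 hq4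
  have : MemLp (fun r => ψ (q.1 + h * r) q.2) (ENNReal.ofReal p)
      (volume.restrict (Ioc (0 : ℝ) 1)) := ⟨hq4, (eLpNorm_lt_top_iff hp0 _ _).2 hq3⟩
  exact this.integrable (by rwa [ENNReal.one_le_ofReal])

/-- Splitting the integral needs integrability of both translates in `r`, which is available only
for almost every point of space-time. -/
theorem IsSobolevCurve.steklov_diff_ae {n : ℕ} {s p : ℝ} (hp : 1 ≤ p)
    {ψ : ℝ → EuclideanSpace ℝ (Fin n) → ℝ} (hψ : IsSobolevCurve s p ψ) (h : ℝ) :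
    ∀ᵐ z : ℝ × EuclideanSpace ℝ (Fin n) × EuclideanSpace ℝ (Fin n),
      steklov h ψ z.1 z.2.1 - steklov h ψ z.1 z.2.2 =
        ∫ r in Ioc (0 : ℝ) 1, (ψ (z.1 + h * r) z.2.1 - ψ (z.1 + h * r) z.2.2) := by
  have h0 := ae_integrable_translate hp h hψ.memLp
  have h1 := (QuasiMeasurePreserving.prodMap (Measure.QuasiMeasurePreserving.id (volume : Measure ℝ))
    (Measure.quasiMeasurePreserving_fst (μ := (volume : Measure (EuclideanSpace ℝ (Fin n))))
      (ν := (volume : Measure (EuclideanSpace ℝ (Fin n)))))).ae h0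
  have h2 := (QuasiMeasurePreserving.prodMap (Measure.QuasiMeasurePreserving.id (volume : Measure ℝ))
    (Measure.quasiMeasurePreserving_snd (μ := (volume : Measure (EuclideanSpace ℝ (Fin n))))
      (ν := (volume : Measure (EuclideanSpace ℝ (Fin n)))))).ae h0
  filter_upwards [h1, h2] with z hz1 hz2
  exact (integral_sub hz1 hz2).symm

theorem measurable_steklov {n : ℕ} (h : ℝ) {ψ : ℝ → EuclideanSpace ℝ (Fin n) → ℝ}
    (hψ : Measurable fun q : ℝ × EuclideanSpace ℝ (Fin n) => ψ q.1 q.2) :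
    Measurable fun q : ℝ × EuclideanSpace ℝ (Fin n) => steklov h ψ q.1 q.2 := by
  have : Measurable fun z : (ℝ × EuclideanSpace ℝ (Fin n)) × ℝ => ψ (z.1.1 + h * z.2) z.1.2 :=
    hψ.comp (((measurable_fst.comp measurable_fst).add (measurable_snd.const_mul h)).prodMk
      (measurable_snd.comp measurable_fst))
  exact (this.stronglyMeasurable.integral_prod_right'
    (ν := volume.restrict (Ioc (0 : ℝ) 1))).measurable

theorem IsSobolevCurve.steklov {n : ℕ} {s p : ℝ} (hp : 1 ≤ p)
    {ψ : ℝ → EuclideanSpace ℝ (Fin n) → ℝ} (hψ : IsSobolevCurve s p ψ) (h : ℝ) :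
    IsSobolevCurve s p (steklov h ψ) where
  measurable := measurable_steklov h hψ.measurable
  memLp := MemLp.integral_average hp (ρ := volume.restrict (Ioc (0 : ℝ) 1))
    (memLp_translate h hψ.memLp)
  memLp_diff := by
    refine (MemLp.integral_average hp (ρ := volume.restrict (Ioc (0 : ℝ) 1))
      (memLp_translate h hψ.memLp_diff)).ae_eq ?_
    filter_upwards [hψ.steklov_diff_ae hp h] with z hz
    rw [hz, integral_const_mul]

/-- The time derivative of a Steklov average is a difference quotient. -/
theorem integral_deriv_mul_average {g φ : ℝ → ℝ} (hg : Integrable g) (hφ : ContDiff ℝ ∞ φ)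
    (hφc : HasCompactSupport φ) {h : ℝ} (hh : 0 < h) :
    ∫ t, deriv φ t * ∫ r in Ioc (0 : ℝ) 1, g (t + h * r) =
      -∫ t, φ t * (h⁻¹ * (g (t + h) - g t)) := by
  set ρ := (volume : Measure ℝ).restrict (Ioc 0 1) with hρ
  have hφ' : Continuous (deriv φ) := hφ.continuous_deriv (by simp)
  obtain ⟨C, hC⟩ := hφc.deriv.exists_bound_of_continuous hφ'
  obtain ⟨C₀, hC₀⟩ := hφc.exists_bound_of_continuous hφ.continuous
  have hmp : MeasurePreserving (fun z : ℝ × ℝ => (z.1, z.2 + h * z.1)) (ρ.prod volume)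
      (ρ.prod volume) :=
    (MeasurePreserving.id ρ).skew_product (g := fun r t => t + h * r)
      (by unfold Function.uncurry; fun_prop)
      (ae_of_all _ fun r => (measurePreserving_add_right volume (h * r)).map_eq)
  have hgs : Integrable (fun z : ℝ × ℝ => g z.2) (ρ.prod volume) := hg.comp_snd ρ
  have hgi : Integrable (fun z : ℝ × ℝ => g (z.2 + h * z.1)) (ρ.prod volume) :=
    (hmp.integrable_comp hgs.1).2 hgs
  have hI1 : Integrable (fun z : ℝ × ℝ => deriv φ z.2 * g (z.2 + h * z.1)) (ρ.prod volume) :=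
    hgi.bdd_mul (hφ'.comp continuous_snd).aestronglyMeasurable (ae_of_all _ fun z => hC z.2)
  have hI2 : Integrable (fun z : ℝ × ℝ => deriv φ (z.2 - h * z.1) * g z.2) (ρ.prod volume) :=
    hgs.bdd_mul (c := C) (by fun_prop) (ae_of_all _ fun z => hC _)
  have e1 : ∫ t, deriv φ t * ∫ r, g (t + h * r) ∂ρ =
      ∫ r, (∫ t, deriv φ t * g (t + h * r)) ∂ρ := by
    rw [← integral_integral_swap (f := fun t r => deriv φ t * g (t + h * r)) hI1.swap]
    simp_rw [integral_const_mul]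
  -- The translation is moved onto the smooth factor, so that after Fubini the integral over `r` is
  -- explicit by the fundamental theorem of calculus and nothing is asked of `g` beyond
  -- integrability.
  have e2 : ∀ r, ∫ t, deriv φ t * g (t + h * r) = ∫ t, deriv φ (t - h * r) * g t := by
    intro r
    rw [← integral_add_right_eq_self (fun t => deriv φ (t - h * r) * g t) (h * r)]
    simp
  have e3 : ∀ t, ∫ r, deriv φ (t - h * r) ∂ρ = h⁻¹ * (φ t - φ (t - h)) := by
    intro t
    rw [hρ, ← intervalIntegral.integral_of_le zero_le_one]
    have hd : ∀ r ∈ uIcc (0 : ℝ) 1,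
        HasDerivAt (fun r => -(h⁻¹ * φ (t - h * r))) (deriv φ (t - h * r)) r := by
      intro r _
      have h1 : HasDerivAt (fun r => t - h * r) (-h) r := by
        simpa using ((hasDerivAt_id r).const_mul h).const_sub t
      have h2 := ((hφ.differentiable (by simp) (t - h * r)).hasDerivAt.comp r h1)
      have h3 := (h2.const_mul h⁻¹).neg
      refine h3.congr_deriv ?_
      rw [mul_neg, mul_neg, neg_neg, mul_comm (deriv φ _) h, ← mul_assoc, inv_mul_cancel₀ hh.ne',
        one_mul]
    rw [intervalIntegral.integral_eq_sub_of_hasDerivAt hd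
      (Continuous.intervalIntegrable (by fun_prop) _ _)]
    simp
    ring
  rw [e1]
  simp_rw [e2]
  rw [integral_integral_swap hI2]
  simp_rw [integral_mul_const, e3]
  have i1 : Integrable fun t => φ t * g t :=
    hg.bdd_mul hφ.continuous.aestronglyMeasurable (ae_of_all _ hC₀)
  have i2 : Integrable fun t => φ (t - h) * g t :=
    hg.bdd_mul (c := C₀) (hφ.continuous.comp (by fun_prop)).aestronglyMeasurable
      (ae_of_all _ fun t => hC₀ _)
  have i3 : Integrable fun t => φ t * g (t + h) := by
    refine (hg.comp_add_right h).bdd_mul hφ.continuous.aestronglyMeasurable (ae_of_all _ hC₀)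
  have e4 : ∫ t, φ (t - h) * g t = ∫ t, φ t * g (t + h) := by
    rw [← integral_add_right_eq_self (fun t => φ (t - h) * g t) h]
    simp
  calc ∫ t, h⁻¹ * (φ t - φ (t - h)) * g t
      = h⁻¹ * ((∫ t, φ t * g t) - ∫ t, φ (t - h) * g t) := by
        rw [← integral_sub i1 i2, ← integral_const_mul]
        congr 1; ext t; ring
    _ = -(h⁻¹ * ((∫ t, φ t * g (t + h)) - ∫ t, φ t * g t)) := by rw [e4]; ring
    _ = _ := by
        rw [← integral_sub i3 i1, ← integral_const_mul]
        congr 2; ext t; ring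

/-! ### The `L²` pairing on the Sobolev space -/

theorem abs_integral_mul_le_of_memLp {α : Type*} [MeasurableSpace α] {μ : Measure α}
    [IsFiniteMeasure μ] {p : ENNReal} (hp : 2 ≤ p) {f g : α → ℝ} (hf : MemLp f p μ)
    (hg : MemLp g p μ) :
    |∫ x, f x * g x ∂μ| ≤ ((μ univ ^ (1 / (2 : ENNReal).toReal - 1 / p.toReal)) ^ 2).toReal *
      (eLpNorm f p μ).toReal * (eLpNorm g p μ).toReal := by
  set c := μ univ ^ (1 / (2 : ENNReal).toReal - 1 / p.toReal) with hc
  have hcf : c ≠ ⊤ := by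
    refine ENNReal.rpow_ne_top_of_nonneg ?_ (measure_ne_top _ _)
    by_cases hpt : p = ⊤
    · simp [hpt]
    · have h2 : (2 : ENNReal).toReal ≤ p.toReal := ENNReal.toReal_mono hpt hp
      have := one_div_le_one_div_of_le (by norm_num) h2
      linarith
  have h1 : ENNReal.ofReal |∫ x, f x * g x ∂μ| ≤ c ^ 2 * eLpNorm f p μ * eLpNorm g p μ := by
    calc ENNReal.ofReal |∫ x, f x * g x ∂μ| = ‖∫ x, f x * g x ∂μ‖ₑ := by
          rw [← Real.norm_eq_abs, ofReal_norm]
      _ ≤ eLpNorm (f • g) 1 μ := by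
          rw [eLpNorm_one_eq_lintegral_enorm]
          exact enorm_integral_le_lintegral_enorm _
      _ ≤ eLpNorm f 2 μ * eLpNorm g 2 μ := eLpNorm_smul_le_mul_eLpNorm hg.1 hf.1
      -- Since `p ≥ 2` and the measure is finite, `L^p` embeds into `L²` with constant `c`; it is
      -- used once for each factor.
      _ ≤ (eLpNorm f p μ * c) * (eLpNorm g p μ * c) := by
          gcongr
          · exact eLpNorm_le_eLpNorm_mul_rpow_measure_univ hp hf.1
          · exact eLpNorm_le_eLpNorm_mul_rpow_measure_univ hp hg.1
      _ = _ := by ring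
  have h2 := ENNReal.toReal_mono (ENNReal.mul_ne_top (ENNReal.mul_ne_top
    (ENNReal.pow_ne_top hcf) hf.2.ne) hg.2.ne) h1
  rwa [ENNReal.toReal_ofReal (abs_nonneg _), ENNReal.toReal_mul, ENNReal.toReal_mul] at h2

theorem two_le_ofReal {p : ℝ} (hp : 2 ≤ p) : (2 : ENNReal) ≤ ENNReal.ofReal p := by
  rw [← ENNReal.ofReal_ofNat]
  exact ENNReal.ofReal_le_ofReal hp

theorem integrable_mul_of_memLp {α : Type*} [MeasurableSpace α] {μ : Measure α}
    [IsFiniteMeasure μ] {p : ENNReal} (hp : 2 ≤ p) {f g : α → ℝ} (hf : MemLp f p μ)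
    (hg : MemLp g p μ) : Integrable (fun x => f x * g x) μ :=
  (hf.mono_exponent hp).integrable_mul (hg.mono_exponent hp)

theorem integrable_rep_mul {n : ℕ} {s p : ℝ} [Fact (2 ≤ p)] {Ω : Set (EuclideanSpace ℝ (Fin n))}
    [IsFiniteMeasure (volume.restrict Ω)] (v w : Sobolev s p Ω) :
    Integrable (fun x => Sobolev.rep v x * Sobolev.rep w x) (volume.restrict Ω) :=
  integrable_mul_of_memLp (two_le_ofReal Fact.out) (Lp.memLp v.1.fst) (Lp.memLp w.1.fst)

theorem rep_add {n : ℕ} {s p : ℝ} [Fact (2 ≤ p)] {Ω : Set (EuclideanSpace ℝ (Fin n))}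
    (v w : Sobolev s p Ω) :
    Sobolev.rep (v + w) =ᵐ[volume.restrict Ω] Sobolev.rep v + Sobolev.rep w :=
  Lp.coeFn_add v.1.fst w.1.fst

theorem rep_smul {n : ℕ} {s p : ℝ} [Fact (2 ≤ p)] {Ω : Set (EuclideanSpace ℝ (Fin n))}
    (c : ℝ) (w : Sobolev s p Ω) :
    Sobolev.rep (c • w) =ᵐ[volume.restrict Ω] c • Sobolev.rep w :=
  Lp.coeFn_smul c w.1.fst

/-- The `L²(Ω)` scalar product on `W^{s,p}(Ω)`, as a bilinear map. -/
def sobolevBilin {n : ℕ} (s p : ℝ) [Fact (2 ≤ p)] (Ω : Set (EuclideanSpace ℝ (Fin n)))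
    [IsFiniteMeasure (volume.restrict Ω)] :
    Sobolev s p Ω →ₗ[ℝ] Sobolev s p Ω →ₗ[ℝ] ℝ :=
  LinearMap.mk₂ ℝ (fun v w : Sobolev s p Ω => ∫ x in Ω, Sobolev.rep v x * Sobolev.rep w x)
    (fun v v' w => by
      rw [← integral_add (integrable_rep_mul v w) (integrable_rep_mul v' w)]
      refine integral_congr_ae ?_
      filter_upwards [rep_add v v'] with x hx
      rw [hx, Pi.add_apply, add_mul])
    (fun c v w => by
      rw [smul_eq_mul, ← integral_const_mul]
      refine integral_congr_ae ?_
      filter_upwards [rep_smul c v] with x hx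
      rw [hx, Pi.smul_apply, smul_eq_mul, mul_assoc])
    (fun v w w' => by
      rw [← integral_add (integrable_rep_mul v w) (integrable_rep_mul v w')]
      refine integral_congr_ae ?_
      filter_upwards [rep_add w w'] with x hx
      rw [hx, Pi.add_apply, mul_add])
    (fun c v w => by
      rw [smul_eq_mul, ← integral_const_mul]
      refine integral_congr_ae ?_
      filter_upwards [rep_smul c w] with x hx
      rw [hx, Pi.smul_apply, smul_eq_mul, mul_left_comm])

theorem exists_sobolevBilin_bound {n : ℕ} (s p : ℝ) [Fact (2 ≤ p)]
    (Ω : Set (EuclideanSpace ℝ (Fin n))) [IsFiniteMeasure (volume.restrict Ω)] :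
    ∃ C : ℝ, ∀ v w : Sobolev s p Ω, ‖sobolevBilin s p Ω v w‖ ≤ C * ‖v‖ * ‖w‖ := by
  refine ⟨((volume.restrict Ω univ ^
      (1 / (2 : ENNReal).toReal - 1 / (ENNReal.ofReal p).toReal)) ^ 2).toReal, fun v w => ?_⟩
  have h1 := abs_integral_mul_le_of_memLp (two_le_ofReal Fact.out) (Lp.memLp v.1.fst)
    (Lp.memLp w.1.fst)
  rw [← Lp.norm_def, ← Lp.norm_def] at h1
  refine h1.trans ?_
  rw [norm_sobolev v, norm_sobolev w]
  have hv : ‖v.1.fst‖ ≤ ‖v.1.fst‖ + ‖v.1.snd‖ := le_add_of_nonneg_right (norm_nonneg _)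
  have hw : ‖w.1.fst‖ ≤ ‖w.1.fst‖ + ‖w.1.snd‖ := le_add_of_nonneg_right (norm_nonneg _)
  exact mul_le_mul (mul_le_mul_of_nonneg_left hv ENNReal.toReal_nonneg) hw (norm_nonneg _)
    (mul_nonneg ENNReal.toReal_nonneg ((norm_nonneg _).trans hv))

/-- The `L²(Ω)` scalar product on `W^{s,p}(Ω)`. -/
def sobolevPairing {n : ℕ} (s p : ℝ) [Fact (2 ≤ p)] (Ω : Set (EuclideanSpace ℝ (Fin n)))
    [IsFiniteMeasure (volume.restrict Ω)] :
    Sobolev s p Ω →L[ℝ] StrongDual ℝ (Sobolev s p Ω) :=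
  (sobolevBilin s p Ω).mkContinuous₂ _ (exists_sobolevBilin_bound s p Ω).choose_spec

theorem sobolevPairing_apply {n : ℕ} {s p : ℝ} [Fact (2 ≤ p)] {Ω : Set (EuclideanSpace ℝ (Fin n))}
    [IsFiniteMeasure (volume.restrict Ω)] (v w : Sobolev s p Ω) :
    sobolevPairing s p Ω v w = ∫ x in Ω, Sobolev.rep v x * Sobolev.rep w x := rfl

theorem sobolevPairing_ofFun {n : ℕ} {s p : ℝ} [Fact (2 ≤ p)]
    {Ω : Set (EuclideanSpace ℝ (Fin n))} [IsFiniteMeasure (volume.restrict Ω)]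
    {f : EuclideanSpace ℝ (Fin n) → ℝ} (hf : MemSobolev s p Ω f) (w : Sobolev s p Ω) :
    sobolevPairing s p Ω (Sobolev.ofFun s p Ω f) w = ∫ x in Ω, f x * Sobolev.rep w x := by
  rw [sobolevPairing_apply]
  refine integral_congr_ae ?_
  filter_upwards [rep_ofFun hf] with x hx
  rw [hx]

theorem ofFun_zero {n : ℕ} (s p : ℝ) [Fact (2 ≤ p)] (D : Set (EuclideanSpace ℝ (Fin n))) :
    Sobolev.ofFun s p D (fun _ => 0) = 0 := by
  rw [← enorm_eq_zero, ← nonpos_iff_eq_zero]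
  refine enorm_ofFun_le.trans ?_
  simp [sobolevNorm]

/-- Space-time has infinite measure, so `L^p` functions with `p > 2` need not have integrable
products. It suffices that one factor lives on a set of finite measure. -/
theorem integrable_mul_of_eq_zero_off {α : Type*} [MeasurableSpace α] {μ : Measure α}
    {p : ENNReal} (hp : 2 ≤ p) {f g : α → ℝ} (hf : MemLp f p μ) (hg : MemLp g p μ) {S : Set α}
    (hS : μ S ≠ ⊤) (hfS : ∀ x, x ∉ S → f x = 0) : Integrable (fun x => f x * g x) μ := by
  have : IsFiniteMeasure (μ.restrict S) := ⟨by simpa using hS.lt_top⟩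
  rw [← integrableOn_iff_integrable_of_support_subset (s := S)]
  · exact integrable_mul_of_memLp hp (hf.restrict S) (hg.restrict S)
  · intro x hx
    by_contra hn
    exact hx (by simp [hfS x hn])

/-! ### Steklov averages as test functions -/

/-- The difference quotient of `t ↦ Q (V t)`. -/
def diffQuotient {X Y : Type*} [NormedAddCommGroup X] [NormedSpace ℝ X]
    [NormedAddCommGroup Y] [NormedSpace ℝ Y] (Q : X →L[ℝ] Y) (V : ℝ → X) (h t : ℝ) : Y :=
  h⁻¹ • (Q (V (t + h)) - Q (V t))

theorem memLp_diffQuotient {X Y : Type*} [NormedAddCommGroup X] [NormedSpace ℝ X]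
    [NormedAddCommGroup Y] [NormedSpace ℝ Y] (Q : X →L[ℝ] Y) {V : ℝ → X} {P r : ENNReal}
    (hV : MemLp V P volume) (hr : r ≤ P) (h t₁ t₂ : ℝ) :
    MemLp (diffQuotient Q V h) r (volume.restrict (Ioo t₁ t₂)) := by
  have hQV : MemLp (fun t => Q (V t)) P volume := Q.comp_memLp' hV
  have hQVh := hQV.comp_measurePreserving (measurePreserving_add_right volume h)
  exact (((hQVh.sub hQV).const_smul h⁻¹).restrict (Ioo t₁ t₂)).mono_exponent hr

section Steklov

variable {n : ℕ} {s p : ℝ} [Fact (2 ≤ p)] {Ω : Set (EuclideanSpace ℝ (Fin n))}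
  {ψ : ℝ → EuclideanSpace ℝ (Fin n) → ℝ} {a b h : ℝ}

theorem steklov_eq_zero (hh : 0 < h) (hψt : ∀ t, t ∉ Icc a b → ∀ x, ψ t x = 0) {t : ℝ}
    (ht : t ∉ Icc (a - h) b) (x : EuclideanSpace ℝ (Fin n)) : steklov h ψ t x = 0 := by
  unfold steklov
  refine setIntegral_eq_zero_of_forall_eq_zero fun r hr => hψt _ (fun hm => ht ?_) x
  have h1 : h * r ≤ h := by nlinarith [hr.2]
  have h2 : 0 < h * r := mul_pos hh hr.1
  exact ⟨by linarith [hm.1], by linarith [hm.2]⟩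

theorem steklov_eq_zero_outside (hψΩ : ∀ t, ∀ x, x ∉ Ω → ψ t x = 0) (t : ℝ)
    {x : EuclideanSpace ℝ (Fin n)} (hx : x ∉ Ω) : steklov h ψ t x = 0 := by
  unfold steklov
  exact setIntegral_eq_zero_of_forall_eq_zero fun r _ => hψΩ _ x hx

theorem one_le_of_fact (p : ℝ) [Fact (2 ≤ p)] : 1 ≤ p := by
  linarith [(Fact.out : 2 ≤ p)]

theorem ae_integral_steklov_mul [IsFiniteMeasure (volume.restrict Ω)]
    (hψ : IsSobolevCurve s p ψ) (t₁ t₂ h : ℝ) (w : Sobolev s p Ω) :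
    ∀ᵐ t ∂(volume.restrict (Ioo t₁ t₂)), ∫ x in Ω, steklov h ψ t x * Sobolev.rep w x =
      ∫ r in Ioc (0 : ℝ) 1, ∫ x in Ω, ψ (t + h * r) x * Sobolev.rep w x := by
  set ρ := (volume : Measure ℝ).restrict (Ioc 0 1) with hρ
  set T := (volume : Measure ℝ).restrict (Ioo t₁ t₂) with hT
  set O := (volume : Measure (EuclideanSpace ℝ (Fin n))).restrict Ω with hO
  have h1 : MemLp (fun z : ℝ × ℝ × EuclideanSpace ℝ (Fin n) => ψ (z.2.1 + h * z.1) z.2.2)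
      (ENNReal.ofReal p) (ρ.prod (T.prod O)) :=
    (memLp_translate (ρ := ρ) h hψ.memLp).mono_measure (Measure.prod_mono le_rfl
      (Measure.prod_mono Measure.restrict_le_self Measure.restrict_le_self))
  have h2 : MemLp (fun z : ℝ × ℝ × EuclideanSpace ℝ (Fin n) => Sobolev.rep w z.2.2)
      (ENNReal.ofReal p) (ρ.prod (T.prod O)) :=
    ((Lp.memLp w.1.fst).comp_snd T).comp_snd ρ
  have h3 := integrable_mul_of_memLp (two_le_ofReal Fact.out) h1 h2
  have h4 := ((measurePreserving_swap_mid T ρ O).integrable_comp h3.1).2 h3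
  filter_upwards [h4.prod_right_ae] with t ht
  rw [integral_integral_swap (f := fun r x => ψ (t + h * r) x * Sobolev.rep w x) ht]
  refine integral_congr_ae (ae_of_all _ fun x => ?_)
  exact (integral_mul_const _ _).symm

/-- The time derivative of a Steklov average, as a function with values in the dual of
`W^{s,p}(Ω)`. -/
def steklovDeriv (s p : ℝ) [Fact (2 ≤ p)] (Ω : Set (EuclideanSpace ℝ (Fin n)))
    [IsFiniteMeasure (volume.restrict Ω)] (ψ : ℝ → EuclideanSpace ℝ (Fin n) → ℝ) (h : ℝ) :
    ℝ → StrongDual ℝ (Sobolev s p Ω) :=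
  diffQuotient (X := Sobolev s p Ω) (Y := StrongDual ℝ (Sobolev s p Ω)) (sobolevPairing s p Ω)
    (fun t => Sobolev.ofFun s p Ω (ψ t)) h

theorem steklovDeriv_apply [IsFiniteMeasure (volume.restrict Ω)] (h t : ℝ) (w : Sobolev s p Ω) :
    steklovDeriv s p Ω ψ h t w =
      h⁻¹ * (sobolevPairing s p Ω (Sobolev.ofFun s p Ω (ψ (t + h))) w -
        sobolevPairing s p Ω (Sobolev.ofFun s p Ω (ψ t)) w) := rfl

theorem memLp_steklovDeriv [IsFiniteMeasure (volume.restrict Ω)]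
    (hψ : IsSobolevCurve s p ψ) (h t₁ t₂ : ℝ) :
    MemLp (steklovDeriv s p Ω ψ h) (ENNReal.ofReal (p / (p - 1)))
      (volume.restrict (Ioo t₁ t₂)) := by
  have hp2 : 2 ≤ p := Fact.out
  have hr : ENNReal.ofReal (p / (p - 1)) ≤ ENNReal.ofReal p := by
    refine ENNReal.ofReal_le_ofReal ?_
    rw [div_le_iff₀ (by linarith)]
    nlinarith
  have h1 := hψ.memLp_ofFun Ω
  have h2 := memLp_diffQuotient (X := Sobolev s p Ω) (Y := StrongDual ℝ (Sobolev s p Ω))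
    (sobolevPairing s p Ω) (V := fun t => Sobolev.ofFun s p Ω (ψ t)) (P := ENNReal.ofReal p) h1
    (r := ENNReal.ofReal (p / (p - 1))) hr h t₁ t₂
  exact h2

theorem ae_sobolevPairing_ofFun [IsFiniteMeasure (volume.restrict Ω)]
    (hψ : IsSobolevCurve s p ψ) :
    ∀ᵐ t, ∀ w : Sobolev s p Ω, sobolevPairing s p Ω (Sobolev.ofFun s p Ω (ψ t)) w =
      ∫ x in Ω, ψ t x * Sobolev.rep w x := by
  filter_upwards [hψ.ae_memSobolev (one_le_of_fact p) Ω] with t ht w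
  exact sobolevPairing_ofFun ht w

/-- The pairing is in `L^p` of the time axis; being supported in a bounded interval, it is also in
`L¹`. -/
theorem integrable_integral_mul_rep [IsFiniteMeasure (volume.restrict Ω)]
    (hψ : IsSobolevCurve s p ψ) (hψt : ∀ t, t ∉ Icc a b → ∀ x, ψ t x = 0) (w : Sobolev s p Ω) :
    Integrable fun t => ∫ x in Ω, ψ t x * Sobolev.rep w x := by
  have hg1 : MemLp (fun t => sobolevPairing s p Ω (Sobolev.ofFun s p Ω (ψ t)) w)
      (ENNReal.ofReal p) volume :=
    ContinuousLinearMap.comp_memLp' (E := Sobolev s p Ω) (F := ℝ) ((sobolevPairing s p Ω).flip w)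
      (hψ.memLp_ofFun Ω)
  have hg2 : MemLp (fun t => ∫ x in Ω, ψ t x * Sobolev.rep w x) (ENNReal.ofReal p) volume := by
    refine hg1.ae_eq ?_
    filter_upwards [ae_sobolevPairing_ofFun (Ω := Ω) hψ] with t ht
    exact ht w
  rw [← memLp_one_iff_integrable]
  refine hg2.mono_exponent_of_measure_support_ne_top (s := Icc a b) ?_ (by simp)
    (ENNReal.one_le_ofReal.2 (one_le_of_fact p))
  intro t ht
  simp [hψt t ht]

/-- Pairing with a fixed `w` commutes with the average by Fubini and reduces the claim to the scalar
identity `integral_deriv_mul_average`. -/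
theorem isTimeDeriv_steklov [IsFiniteMeasure (volume.restrict Ω)]
    (hψ : IsSobolevCurve s p ψ) (hψt : ∀ t, t ∉ Icc a b → ∀ x, ψ t x = 0) (hh : 0 < h)
    (t₁ t₂ : ℝ) :
    IsTimeDeriv t₁ t₂ (steklov h ψ) (steklovDeriv s p Ω ψ h) := by
  intro φ hφ hφc hφs w
  set g : ℝ → ℝ := fun t => ∫ x in Ω, ψ t x * Sobolev.rep w x with hg
  have hgi : Integrable g := integrable_integral_mul_rep hψ hψt w
  have e1 : ∫ t in Ioo t₁ t₂, deriv φ t * ∫ x in Ω, steklov h ψ t x * Sobolev.rep w x =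
      ∫ t in Ioo t₁ t₂, deriv φ t * ∫ r in Ioc (0 : ℝ) 1, g (t + h * r) := by
    refine integral_congr_ae ?_
    filter_upwards [ae_integral_steklov_mul hψ t₁ t₂ h w] with t ht
    rw [ht]
  have e2 : ∫ t in Ioo t₁ t₂, deriv φ t * ∫ r in Ioc (0 : ℝ) 1, g (t + h * r) =
      ∫ t, deriv φ t * ∫ r in Ioc (0 : ℝ) 1, g (t + h * r) := by
    refine setIntegral_eq_integral_of_forall_compl_eq_zero fun t ht => ?_
    rw [image_eq_zero_of_notMem_tsupport fun h' => ht (hφs (tsupport_deriv_subset h')), zero_mul]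
  have e3 : ∫ t in Ioo t₁ t₂, φ t * (h⁻¹ * (g (t + h) - g t)) =
      ∫ t, φ t * (h⁻¹ * (g (t + h) - g t)) := by
    refine setIntegral_eq_integral_of_forall_compl_eq_zero fun t ht => ?_
    rw [image_eq_zero_of_notMem_tsupport fun h' => ht (hφs h'), zero_mul]
  rw [e1, e2, integral_deriv_mul_average hgi hφ hφc hh, ← e3]
  congr 1
  refine integral_congr_ae (ae_restrict_of_ae ?_)
  have h0 := ae_sobolevPairing_ofFun (Ω := Ω) hψ
  have h1 := (measurePreserving_add_right volume h).quasiMeasurePreserving.ae h0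
  filter_upwards [h0, h1] with t h2 h3
  rw [steklovDeriv_apply, h2, h3]

/-- A forward average enlarges the time support by `h` to the left only, which explains the
asymmetric conditions at the ends. The averages then vanish near `t₁` and `t₂`, so the end values
are trivially zero. -/
theorem isTestFunction_steklov [IsFiniteMeasure (volume.restrict Ω)]
    (hψ : IsSobolevCurve s p ψ) (hψΩ : ∀ t, ∀ x, x ∉ Ω → ψ t x = 0)
    (hψt : ∀ t, t ∉ Icc a b → ∀ x, ψ t x = 0) (hh : 0 < h) {t₁ t₂ : ℝ} (ha : t₁ < a - h)
    (hb : b < t₂) :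
    IsTestFunction t₁ t₂ (steklov h ψ) (steklovDeriv s p Ω ψ h) where
  mem := (hψ.steklov (one_le_of_fact p) h).memLpSobolev (one_le_of_fact p) t₁ t₂
  eq_zero_outside :=
    ae_of_all _ fun t => ae_of_all _ fun x hx => steklov_eq_zero_outside hψΩ t hx
  deriv_mem := memLp_steklovDeriv hψ h t₁ t₂
  deriv_eq := isTimeDeriv_steklov hψ hψt hh t₁ t₂
  initial := by
    refine tendsto_const_nhds.congr' ?_
    have h1 : ∀ᶠ t in 𝓝[>] t₁ ⊓ ae volume, t < a - h :=
      Eventually.filter_mono inf_le_left (nhdsWithin_le_nhds (Iio_mem_nhds ha))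
    filter_upwards [h1] with t ht
    have : steklov h ψ t = fun _ => 0 :=
      funext fun x => steklov_eq_zero hh hψt (fun h' => not_lt.2 h'.1 ht) x
    simp [this]
  terminal := by
    refine tendsto_const_nhds.congr' ?_
    have h1 : ∀ᶠ t in 𝓝[<] t₂ ⊓ ae volume, b < t :=
      Eventually.filter_mono inf_le_left (nhdsWithin_le_nhds (Ioi_mem_nhds hb))
    filter_upwards [h1] with t ht
    have : steklov h ψ t = fun _ => 0 :=
      funext fun x => steklov_eq_zero hh hψt (fun h' => not_lt.2 h'.2 ht) x
    simp [this]

end Steklov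

/-! ### The flux as a function in the dual Lebesgue space -/

instance holderConjugate_ofReal (p : ℝ) [Fact (2 ≤ p)] :
    ENNReal.HolderConjugate (ENNReal.ofReal (p / (p - 1))) (ENNReal.ofReal p) := by
  have hp : 2 ≤ p := Fact.out
  rw [ENNReal.holderConjugate_iff, ← ENNReal.ofReal_inv_of_pos (div_pos (by linarith) (by linarith)),
    ← ENNReal.ofReal_inv_of_pos (by linarith), ← ENNReal.ofReal_add
      (inv_nonneg.2 (div_nonneg (by linarith) (by linarith))) (inv_nonneg.2 (by linarith)),
    ← ENNReal.ofReal_one]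
  congr 1
  have h1 : p ≠ 0 := by linarith
  field_simp
  ring

instance one_le_ofReal_conj (p : ℝ) [Fact (2 ≤ p)] :
    Fact (1 ≤ ENNReal.ofReal (p / (p - 1))) := by
  have hp : 2 ≤ p := Fact.out
  refine ⟨ENNReal.one_le_ofReal.2 ?_⟩
  rw [le_div_iff₀ (by linarith)]
  linarith

/-- The flux, divided by the weight, is the density of the energy with respect to the weighted
differences. -/
def fluxDensity {n : ℕ} (s p : ℝ)
    (K : EuclideanSpace ℝ (Fin n) → EuclideanSpace ℝ (Fin n) → ℝ → ℝ)
    (u : ℝ → EuclideanSpace ℝ (Fin n) → ℝ)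
    (z : ℝ × EuclideanSpace ℝ (Fin n) × EuclideanSpace ℝ (Fin n)) : ℝ :=
  flux p K u z.2.1 z.2.2 z.1 * (weight s p z.2)⁻¹

theorem measurable_flux {n : ℕ} {s p Λ : ℝ}
    {K : EuclideanSpace ℝ (Fin n) → EuclideanSpace ℝ (Fin n) → ℝ → ℝ}
    {u : ℝ → EuclideanSpace ℝ (Fin n) → ℝ} (hK : IsEllipticKernel s p Λ K)
    (hu : Measurable fun q : ℝ × EuclideanSpace ℝ (Fin n) => u q.1 q.2) :
    Measurable fun z : ℝ × EuclideanSpace ℝ (Fin n) × EuclideanSpace ℝ (Fin n) =>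
      flux p K u z.2.1 z.2.2 z.1 := by
  have h1 : Measurable fun z : ℝ × EuclideanSpace ℝ (Fin n) × EuclideanSpace ℝ (Fin n) =>
      K z.2.1 z.2.2 z.1 :=
    hK.measurable.comp (g := fun q : EuclideanSpace ℝ (Fin n) × EuclideanSpace ℝ (Fin n) × ℝ =>
      K q.1 q.2.1 q.2.2)
      (f := fun z : ℝ × EuclideanSpace ℝ (Fin n) × EuclideanSpace ℝ (Fin n) =>
        (z.2.1, z.2.2, z.1)) (by fun_prop)
  have h2 := measurable_diff hu
  unfold flux
  exact (h1.mul (h2.abs.pow_const _)).mul h2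

theorem weight_pos {n : ℕ} {s p : ℝ} {z : EuclideanSpace ℝ (Fin n) × EuclideanSpace ℝ (Fin n)}
    (hz : z.1 ≠ z.2) : 0 < weight s p z :=
  Real.rpow_pos_of_pos (norm_pos_iff.2 (sub_ne_zero.2 hz)) _

/-- Off the diagonal the weight is positive and cancels; on the diagonal the flux vanishes, whatever
the value of the weight there. -/
theorem fluxDensity_mul {n : ℕ} {s p : ℝ}
    {K : EuclideanSpace ℝ (Fin n) → EuclideanSpace ℝ (Fin n) → ℝ → ℝ}
    {u : ℝ → EuclideanSpace ℝ (Fin n) → ℝ}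
    (z : ℝ × EuclideanSpace ℝ (Fin n) × EuclideanSpace ℝ (Fin n))
    (d : ℝ) : fluxDensity s p K u z * (weight s p z.2 * d) = flux p K u z.2.1 z.2.2 z.1 * d := by
  unfold fluxDensity
  by_cases hz : z.2.1 = z.2.2
  · simp [flux, hz]
  · have := (weight_pos (s := s) (p := p) hz).ne'
    field_simp

section Flux

variable {n : ℕ} {s p Λ : ℝ} [Fact (2 ≤ p)]
  {K : EuclideanSpace ℝ (Fin n) → EuclideanSpace ℝ (Fin n) → ℝ → ℝ}
  {u ψ : ℝ → EuclideanSpace ℝ (Fin n) → ℝ}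

theorem abs_flux_le (hΛ : 1 ≤ Λ) (hK : IsEllipticKernel s p Λ K)
    (x y : EuclideanSpace ℝ (Fin n)) (t : ℝ) :
    |flux p K u x y t| ≤ Λ * weight s p (x, y) ^ p * |u t x - u t y| ^ (p - 1) := by
  have hp : 2 ≤ p := Fact.out
  have hw := weight_nonneg s p (x, y)
  by_cases hz : x = y
  · subst hz
    simp only [flux, sub_self, mul_zero, abs_zero]
    positivity
  have hKl := hK.lower x y t hz
  have hKu := hK.upper x y t hz
  have hK0 : 0 ≤ K x y t := le_trans (by positivity) hKl
  have e : |u t x - u t y| ^ (p - 1) = |u t x - u t y| ^ (p - 2) * |u t x - u t y| := by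
    rcases eq_or_lt_of_le (abs_nonneg (u t x - u t y)) with h | h
    · rw [← h, mul_zero, Real.zero_rpow (by linarith)]
    · rw [← Real.rpow_add_one h.ne']
      congr 1; ring
  rw [flux, abs_mul, abs_mul, abs_of_nonneg hK0, e, weight_rpow s (by linarith),
    abs_of_nonneg (Real.rpow_nonneg (abs_nonneg _) _), mul_one_div, mul_assoc]
  gcongr

/-- The upper bound for `K` gives `|flux| / weight ≤ Λ (weight |u(x) - u(y)|)^(p-1)`, and the
`(p-1)`-th power of an `L^p` function is in `L^(p/(p-1))`. -/
theorem memLp_fluxDensity (hΛ : 1 ≤ Λ) (hK : IsEllipticKernel s p Λ K)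
    (hu : IsSobolevCurve s p u) :
    MemLp (fluxDensity s p K u) (ENNReal.ofReal (p / (p - 1))) volume := by
  have hp : 2 ≤ p := Fact.out
  have h1 := (hu.memLp_diff.norm_rpow_div (ENNReal.ofReal (p - 1))).const_mul Λ
  rw [← ENNReal.ofReal_div_of_pos (by linarith), ENNReal.toReal_ofReal (by linarith)] at h1
  refine h1.mono ?_ (ae_of_all _ fun z => ?_)
  · exact ((measurable_flux hK hu.measurable).mul
      ((measurable_weight s p).comp measurable_snd).inv).aestronglyMeasurable
  refine le_trans ?_ (le_abs_self _)
  rw [Real.norm_eq_abs, Real.norm_eq_abs]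
  by_cases hz : z.2.1 = z.2.2
  · simp only [fluxDensity, flux, hz, sub_self, mul_zero, zero_mul, abs_zero]
    positivity
  have hw := weight_pos (s := s) (p := p) hz
  rw [fluxDensity, abs_mul, abs_inv, abs_of_pos hw, abs_mul, abs_of_pos hw,
    Real.mul_rpow hw.le (abs_nonneg _), ← div_eq_mul_inv, div_le_iff₀ hw]
  refine (abs_flux_le hΛ hK _ _ _).trans_eq ?_
  have e : weight s p z.2 ^ p = weight s p z.2 ^ (p - 1) * weight s p z.2 := by
    rw [← Real.rpow_add_one hw.ne']
    congr 1; ring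
  rw [Prod.mk.eta, e]
  ring

theorem integrable_flux_mul (hΛ : 1 ≤ Λ) (hK : IsEllipticKernel s p Λ K)
    (hu : IsSobolevCurve s p u) (hψ : IsSobolevCurve s p ψ) :
    Integrable fun z : ℝ × EuclideanSpace ℝ (Fin n) × EuclideanSpace ℝ (Fin n) =>
      flux p K u z.2.1 z.2.2 z.1 * (ψ z.1 z.2.1 - ψ z.1 z.2.2) := by
  have := (memLp_fluxDensity hΛ hK hu).integrable_mul hψ.memLp_diff
  refine this.congr (ae_of_all _ fun z => ?_)
  exact fluxDensity_mul z _

/-- The energy of `u` tested with the translate of `ψ` in time. -/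
def shiftedEnergy (p : ℝ) (K : EuclideanSpace ℝ (Fin n) → EuclideanSpace ℝ (Fin n) → ℝ → ℝ)
    (u ψ : ℝ → EuclideanSpace ℝ (Fin n) → ℝ) (r : ℝ) : ℝ :=
  ∫ z : ℝ × EuclideanSpace ℝ (Fin n) × EuclideanSpace ℝ (Fin n),
    flux p K u z.2.1 z.2.2 z.1 * (ψ (z.1 + r) z.2.1 - ψ (z.1 + r) z.2.2)

theorem continuous_shiftedEnergy (hΛ : 1 ≤ Λ) (hK : IsEllipticKernel s p Λ K)
    (hu : IsSobolevCurve s p u) (hψ : IsSobolevCurve s p ψ) :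
    Continuous (shiftedEnergy p K u ψ) := by
  have hhaar : ((volume : Measure ℝ).prod ((volume : Measure (EuclideanSpace ℝ (Fin n))).prod
      (volume : Measure (EuclideanSpace ℝ (Fin n))))).IsAddHaarMeasure :=
    Measure.prod.instIsAddHaarMeasure _ _
  have hhaar' : (volume : Measure (ℝ × EuclideanSpace ℝ (Fin n) ×
    EuclideanSpace ℝ (Fin n))).IsAddHaarMeasure := hhaar
  have h1 := continuous_integral_bilin_translate
    (volume : Measure (ℝ × EuclideanSpace ℝ (Fin n) × EuclideanSpace ℝ (Fin n)))
    (ContinuousLinearMap.mul ℝ ℝ) ENNReal.ofReal_ne_top (memLp_fluxDensity hΛ hK hu)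
    hψ.memLp_diff
  have h2 : Continuous fun r : ℝ =>
      (r, (0 : EuclideanSpace ℝ (Fin n) × EuclideanSpace ℝ (Fin n))) := by fun_prop
  refine (h1.comp h2).congr fun r => ?_
  unfold shiftedEnergy
  refine integral_congr_ae (ae_of_all _ fun z => ?_)
  simp only [ContinuousLinearMap.mul_apply', Prod.fst_add, Prod.snd_add, zero_add]
  rw [fluxDensity_mul, add_comm]

theorem integral_flux_steklov (hΛ : 1 ≤ Λ) (hK : IsEllipticKernel s p Λ K)
    (hu : IsSobolevCurve s p u) (hψ : IsSobolevCurve s p ψ) (h : ℝ) :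
    ∫ z : ℝ × EuclideanSpace ℝ (Fin n) × EuclideanSpace ℝ (Fin n),
      flux p K u z.2.1 z.2.2 z.1 * (steklov h ψ z.1 z.2.1 - steklov h ψ z.1 z.2.2) =
    ∫ r in Ioc (0 : ℝ) 1, shiftedEnergy p K u ψ (h * r) := by
  set ρ := (volume : Measure ℝ).restrict (Ioc 0 1) with hρ
  have h1 := (memLp_fluxDensity hΛ hK hu).comp_snd ρ
  have h2 := memLp_translate (ρ := ρ) h hψ.memLp_diff
  have h3 : Integrable (fun z : ℝ × ℝ × EuclideanSpace ℝ (Fin n) × EuclideanSpace ℝ (Fin n) =>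
      flux p K u z.2.2.1 z.2.2.2 z.2.1 *
        (ψ (z.2.1 + h * z.1) z.2.2.1 - ψ (z.2.1 + h * z.1) z.2.2.2)) (ρ.prod volume) := by
    refine (h1.integrable_mul h2).congr (ae_of_all _ fun z => ?_)
    exact fluxDensity_mul z.2 _
  unfold shiftedEnergy
  rw [integral_integral_swap (f := fun r (z : ℝ × EuclideanSpace ℝ (Fin n) ×
    EuclideanSpace ℝ (Fin n)) => flux p K u z.2.1 z.2.2 z.1 *
      (ψ (z.1 + h * r) z.2.1 - ψ (z.1 + h * r) z.2.2)) h3]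
  refine integral_congr_ae ?_
  filter_upwards [hψ.steklov_diff_ae (one_le_of_fact p) h] with z hz
  rw [hz, integral_const_mul]

end Flux

/-! ### Testing the equation with Steklov averages -/

theorem integral_flux_congr {n : ℕ} (p : ℝ)
    (K : EuclideanSpace ℝ (Fin n) → EuclideanSpace ℝ (Fin n) → ℝ → ℝ)
    {u u' η η' : ℝ → EuclideanSpace ℝ (Fin n) → ℝ} {t : ℝ} (hu : u t =ᵐ[volume] u' t)
    (hη : η t =ᵐ[volume] η' t) :
    ∫ x, ∫ y, flux p K u x y t * (η t x - η t y) =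
      ∫ x, ∫ y, flux p K u' x y t * (η' t x - η' t y) := by
  refine integral_congr_ae ?_
  filter_upwards [hu, hη] with x hx hx'
  refine integral_congr_ae ?_
  filter_upwards [hu, hη] with y hy hy'
  simp only [flux, hx, hx', hy, hy']

theorem integral_flux_eq_integral_prod {n : ℕ} {s p Λ : ℝ} [Fact (2 ≤ p)]
    {K : EuclideanSpace ℝ (Fin n) → EuclideanSpace ℝ (Fin n) → ℝ → ℝ}
    {u ψ : ℝ → EuclideanSpace ℝ (Fin n) → ℝ} (hΛ : 1 ≤ Λ)
    (hK : IsEllipticKernel s p Λ K) (hu : IsSobolevCurve s p u) (hψ : IsSobolevCurve s p ψ)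
    {t₁ t₂ : ℝ} (h0 : ∀ t, t ∉ Ioo t₁ t₂ → ∀ x, ψ t x = 0) :
    ∫ t in Ioo t₁ t₂, ∫ x, ∫ y, flux p K u x y t * (ψ t x - ψ t y) =
      ∫ z : ℝ × EuclideanSpace ℝ (Fin n) × EuclideanSpace ℝ (Fin n),
        flux p K u z.2.1 z.2.2 z.1 * (ψ z.1 z.2.1 - ψ z.1 z.2.2) := by
  have hi := integrable_flux_mul hΛ hK hu hψ
  rw [setIntegral_eq_integral_of_forall_compl_eq_zero (fun t ht => by simp [h0 t ht])]
  rw [Measure.volume_eq_prod, integral_prod _ hi]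
  refine integral_congr_ae ?_
  filter_upwards [Integrable.prod_right_ae hi] with t ht
  rw [Measure.volume_eq_prod, integral_prod _ ht]

theorem sobolevPairing_ofFun_ofFun {n : ℕ} {s p : ℝ} [Fact (2 ≤ p)]
    {Ω : Set (EuclideanSpace ℝ (Fin n))} [IsFiniteMeasure (volume.restrict Ω)]
    {f g : EuclideanSpace ℝ (Fin n) → ℝ} (hf : MemSobolev s p Ω f) (hg : MemSobolev s p Ω g) :
    sobolevPairing s p Ω (Sobolev.ofFun s p Ω f) (Sobolev.ofFun s p Ω g) =
      ∫ x in Ω, f x * g x := by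
  rw [sobolevPairing_ofFun hf]
  refine integral_congr_ae ?_
  filter_upwards [rep_ofFun hg] with x hx
  rw [hx]

theorem steklovDeriv_ofFun {n : ℕ} {s p : ℝ} [Fact (2 ≤ p)]
    {Ω : Set (EuclideanSpace ℝ (Fin n))} [IsFiniteMeasure (volume.restrict Ω)]
    {ψ : ℝ → EuclideanSpace ℝ (Fin n) → ℝ} {h t : ℝ} {f : EuclideanSpace ℝ (Fin n) → ℝ}
    (hψΩ : ∀ t, ∀ x, x ∉ Ω → ψ t x = 0) (h1 : MemSobolev s p Ω (ψ t))
    (h2 : MemSobolev s p Ω (ψ (t + h))) (hf : MemSobolev s p Ω f) :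
    steklovDeriv s p Ω ψ h t (Sobolev.ofFun s p Ω f) =
      h⁻¹ * ∫ x, (ψ (t + h) x - ψ t x) * f x := by
  rw [steklovDeriv_apply, sobolevPairing_ofFun_ofFun h1 hf, sobolevPairing_ofFun_ofFun h2 hf,
    ← setIntegral_eq_integral_of_forall_compl_eq_zero (s := Ω)
      (f := fun x => (ψ (t + h) x - ψ t x) * f x)
      (fun x hx => by rw [hψΩ _ _ hx, hψΩ _ _ hx, sub_zero, zero_mul]),
    ← integral_sub (integrable_mul_of_memLp (two_le_ofReal Fact.out) h2.1 hf.1)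
      (integrable_mul_of_memLp (two_le_ofReal Fact.out) h1.1 hf.1)]
  simp_rw [sub_mul]

/-- Testing the equation of a subsolution with Steklov averages. -/
theorem IsSubsolution.steklov_le {n : ℕ} {s p Λ : ℝ} [Fact (2 ≤ p)]
    {K : EuclideanSpace ℝ (Fin n) → EuclideanSpace ℝ (Fin n) → ℝ → ℝ} (hΛ : 1 ≤ Λ)
    (hK : IsEllipticKernel s p Λ K) {Ω : Set (EuclideanSpace ℝ (Fin n))}
    [IsFiniteMeasure (volume.restrict Ω)] {t₁ t₂ : ℝ}
    {u U ψ : ℝ → EuclideanSpace ℝ (Fin n) → ℝ} (hu : IsSubsolution s p K Ω t₁ t₂ u)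
    (hU : IsSobolevCurve s p U)
    (huU : ∀ᵐ t ∂(volume.restrict (Ioo t₁ t₂)), u t =ᵐ[volume] U t)
    (hψ : IsSobolevCurve s p ψ) (hψ0 : ∀ t x, 0 ≤ ψ t x) (hψΩ : ∀ t, ∀ x, x ∉ Ω → ψ t x = 0)
    {a b h : ℝ} (hψt : ∀ t, t ∉ Icc a b → ∀ x, ψ t x = 0) (hh : 0 < h) (ha : t₁ < a - h)
    (hb : b < t₂) :
    h * ∫ r in Ioc (0 : ℝ) 1, shiftedEnergy p K U ψ (h * r) ≤
      ∫ q : ℝ × EuclideanSpace ℝ (Fin n), (ψ (q.1 + h) q.2 - ψ q.1 q.2) * U q.1 q.2 := by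
  have hp1 := one_le_of_fact p
  have hsub := hu.2 _ _ (isTestFunction_steklov hψ hψΩ hψt hh ha hb)
    (ae_of_all _ fun t => ae_of_all _ fun x => integral_nonneg fun r => hψ0 _ _)
  have hζt : ∀ t, t ∉ Ioo t₁ t₂ → ∀ x, steklov h ψ t x = 0 := fun t ht x =>
    steklov_eq_zero hh hψt (fun h' => ht ⟨ha.trans_le h'.1, h'.2.trans_lt hb⟩) x
  have e1 : ∫ t in Ioo t₁ t₂, ∫ x, ∫ y, flux p K u x y t * (steklov h ψ t x - steklov h ψ t y) =
      ∫ r in Ioc (0 : ℝ) 1, shiftedEnergy p K U ψ (h * r) := by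
    rw [← integral_flux_steklov hΛ hK hU hψ,
      ← integral_flux_eq_integral_prod hΛ hK hU (hψ.steklov hp1 h) hζt]
    refine integral_congr_ae ?_
    filter_upwards [huU] with t ht
    exact integral_flux_congr p K ht (ae_eq_refl _)
  have hψh : MemLp (fun q : ℝ × EuclideanSpace ℝ (Fin n) => ψ (q.1 + h) q.2)
      (ENNReal.ofReal p) volume :=
    hψ.memLp.comp_measurePreserving
      ((measurePreserving_add_right volume h).prod (MeasurePreserving.id volume))
  -- The difference `ψ(t+h) - ψ(t)` is supported in this set: the support of `ψ`, enlarged to the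
  -- left by the shift.
  have hfin : volume (Icc (a - h) b ×ˢ Ω) ≠ ⊤ := by
    rw [Measure.volume_eq_prod, Measure.prod_prod]
    have : volume Ω ≠ ⊤ := by simpa using measure_ne_top (volume.restrict Ω) univ
    exact ENNReal.mul_ne_top (by simp) this
  have hint : Integrable fun q : ℝ × EuclideanSpace ℝ (Fin n) =>
      (ψ (q.1 + h) q.2 - ψ q.1 q.2) * U q.1 q.2 := by
    refine integrable_mul_of_eq_zero_off (two_le_ofReal Fact.out) (hψh.sub hψ.memLp) hU.memLp hfin
      fun q hq => ?_
    by_cases hx : q.2 ∈ Ω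
    · have ht : q.1 ∉ Icc (a - h) b := fun ht => hq ⟨ht, hx⟩
      rw [hψt _ fun h' => ht ⟨by linarith [h'.1], by linarith [h'.2]⟩,
        hψt _ fun h' => ht ⟨by linarith [h'.1], h'.2⟩, sub_zero]
    · rw [hψΩ _ _ hx, hψΩ _ _ hx, sub_zero]
  have e2 : ∫ t in Ioo t₁ t₂, steklovDeriv s p Ω ψ h t (Sobolev.ofFun s p Ω (u t)) =
      h⁻¹ * ∫ q : ℝ × EuclideanSpace ℝ (Fin n), (ψ (q.1 + h) q.2 - ψ q.1 q.2) * U q.1 q.2 := by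
    rw [Measure.volume_eq_prod, integral_prod _ hint, ← integral_const_mul]
    rw [← setIntegral_eq_integral_of_forall_compl_eq_zero (s := Ioo t₁ t₂)
      (f := fun t => h⁻¹ * ∫ x, (ψ (t + h) x - ψ t x) * U t x)]
    · refine integral_congr_ae ?_
      have h0 := hψ.ae_memSobolev hp1 Ω
      have h1 := (measurePreserving_add_right volume h).quasiMeasurePreserving.ae h0
      filter_upwards [huU, ae_restrict_of_ae h0, ae_restrict_of_ae h1,
        ae_restrict_of_ae (hU.ae_memSobolev hp1 Ω)] with t ht ht0 ht1 htU
      rw [ofFun_congr ht, steklovDeriv_ofFun hψΩ ht0 ht1 htU]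
    · intro t ht
      have hz1 : ∀ x, ψ t x = 0 := hψt t fun h' => ht ⟨by linarith [h'.1], by linarith [h'.2]⟩
      have hz2 : ∀ x, ψ (t + h) x = 0 :=
        hψt _ fun h' => ht ⟨by linarith [h'.1], by linarith [h'.2]⟩
      simp [hz1, hz2]
  rw [e1, e2, sub_nonpos] at hsub
  have := mul_le_mul_of_nonneg_left hsub hh.le
  rwa [mul_inv_cancel_left₀ hh.ne'] at this

/-! ### Functions of time with values in a dual space -/

section Abstract

variable {X : Type*} [NormedAddCommGroup X] [NormedSpace ℝ X]

theorem integrable_dual_apply_const {ξ : ℝ → StrongDual ℝ X} {μ : Measure ℝ} [IsFiniteMeasure μ]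
    {q : ENNReal} (hq : 1 ≤ q) (hξ : MemLp ξ q μ) (w : X) : Integrable (fun τ => ξ τ w) μ :=
  (ContinuousLinearMap.apply ℝ ℝ w).integrable_comp (hξ.integrable hq)

theorem apply_eq_integral_of_dense {A : StrongDual ℝ X} {ξ : ℝ → StrongDual ℝ X} {μ ν : Measure ℝ}
    [IsFiniteMeasure μ] {q : ENNReal} (hq : 1 ≤ q) (hξ : MemLp ξ q ν) (hμν : μ ≤ ν) {D : Set X} (hD : Dense D)
    (h : ∀ w ∈ D, A w = ∫ τ, ξ τ w ∂μ) (w : X) : A w = ∫ τ, ξ τ w ∂μ := by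
  have h1 : ∀ w, (∫ τ, ξ τ ∂μ) w = ∫ τ, ξ τ w ∂μ := fun w =>
    ContinuousLinearMap.integral_apply ((hξ.mono_measure hμν).integrable hq) w
  have h2 : (A : X → ℝ) = (∫ τ, ξ τ ∂μ : StrongDual ℝ X) :=
    Continuous.ext_on hD A.continuous (ContinuousLinearMap.continuous _) fun w hw => by
      rw [h w hw, h1]
  rw [h2, h1]

theorem abs_integral_apply_le {ξ : ℝ → StrongDual ℝ X} {μ ν : Measure ℝ} [IsFiniteMeasure μ]
    {q : ENNReal} (hq : 1 ≤ q) (hξ : MemLp ξ q ν) (hμν : μ ≤ ν) (w : X) :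
    |∫ τ, ξ τ w ∂μ| ≤ (∫ τ, ‖ξ τ‖ ∂μ) * ‖w‖ := by
  rw [← integral_mul_const, ← Real.norm_eq_abs]
  refine norm_integral_le_of_norm_le
    (((hξ.mono_measure hμν).integrable hq).norm.mul_const _) (ae_of_all _ fun τ => ?_)
  exact (ξ τ).le_opNorm w

/-- The pairing of `W` with the translates of `ξ`. -/
def shiftedPairing (ξ : ℝ → StrongDual ℝ X) (W : ℝ → X) (r : ℝ) : ℝ := ∫ t, ξ (t + r) (W t)

variable {p q : ENNReal} [ENNReal.HolderConjugate p q] {ξ : ℝ → StrongDual ℝ X} {W : ℝ → X}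

theorem continuous_shiftedPairing [Fact (1 ≤ p)] [Fact (1 ≤ q)] (hq : q ≠ ⊤)
    (hW : MemLp W p volume) (hξ : MemLp ξ q volume) : Continuous (shiftedPairing ξ W) := by
  have h1 := continuous_integral_bilin_translate (volume : Measure ℝ)
    (ContinuousLinearMap.apply ℝ ℝ : X →L[ℝ] StrongDual ℝ X →L[ℝ] ℝ) hq hW hξ
  refine h1.congr fun r => ?_
  unfold shiftedPairing
  simp [add_comm]

theorem integral_shiftedPairing (hW : MemLp W p volume) (hξ : MemLp ξ q volume) (h : ℝ) :
    ∫ r in Ioc (0 : ℝ) 1, shiftedPairing ξ W (h * r) =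
      ∫ t, ∫ r in Ioc (0 : ℝ) 1, ξ (t + h * r) (W t) := by
  set ρ := (volume : Measure ℝ).restrict (Ioc 0 1) with hρ
  have hmp : MeasurePreserving (fun z : ℝ × ℝ => (z.1, z.2 + h * z.1)) (ρ.prod volume)
      (ρ.prod volume) :=
    (MeasurePreserving.id ρ).skew_product (g := fun r t => t + h * r)
      (by unfold Function.uncurry; fun_prop)
      (ae_of_all _ fun r => (measurePreserving_add_right volume (h * r)).map_eq)
  have h1 : MemLp (fun z : ℝ × ℝ => W z.2) p (ρ.prod volume) := hW.comp_snd ρ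
  have h2 : MemLp (fun z : ℝ × ℝ => ξ (z.2 + h * z.1)) q (ρ.prod volume) :=
    (hξ.comp_snd ρ).comp_measurePreserving hmp
  have h3 : MemLp (fun z : ℝ × ℝ => ξ (z.2 + h * z.1) (W z.2)) 1 (ρ.prod volume) :=
    (ContinuousLinearMap.apply ℝ ℝ : X →L[ℝ] StrongDual ℝ X →L[ℝ] ℝ).memLp_of_bilin 1 h1 h2
  unfold shiftedPairing
  exact integral_integral_swap (f := fun r t => ξ (t + h * r) (W t))
    (memLp_one_iff_integrable.1 h3)

theorem integrable_dual_apply {μ : Measure ℝ} (hW : MemLp W p μ) (hξ : MemLp ξ q μ) :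
    Integrable (fun t => ξ t (W t)) μ :=
  memLp_one_iff_integrable.1
    ((ContinuousLinearMap.apply ℝ ℝ : X →L[ℝ] StrongDual ℝ X →L[ℝ] ℝ).memLp_of_bilin 1 hW hξ)

end Abstract

instance holderConjugate_ofReal' (p : ℝ) [Fact (2 ≤ p)] :
    ENNReal.HolderConjugate (ENNReal.ofReal p) (ENNReal.ofReal (p / (p - 1))) :=
  ENNReal.HolderConjugate.symm (p := ENNReal.ofReal (p / (p - 1))) (q := ENNReal.ofReal p)

/-- Every right neighbourhood of `t` has positive measure, so deleting a null set leaves it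
nonempty. Hence limits along this filter, in which the end values are prescribed, are unique. -/
theorem neBot_nhdsGT_inf_ae (t : ℝ) : (𝓝[>] t ⊓ ae (volume : Measure ℝ)).NeBot := by
  rw [Filter.inf_neBot_iff_frequently_left]
  intro P hP
  rw [Filter.frequently_iff]
  intro S hS
  obtain ⟨b, hb, hbP⟩ := mem_nhdsGT_iff_exists_Ioo_subset.1 hP
  have hpos : (volume : Measure ℝ) (Ioo t b) ≠ 0 := by simpa using hb
  by_contra hn
  push Not at hn
  have hsub : Ioo t b ⊆ Sᶜ := fun x hx hxS => hn x hxS (hbP hx)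
  exact hpos (measure_mono_null hsub hS)

theorem enorm_integral_mul_le {α : Type*} [MeasurableSpace α] {μ : Measure α} {f g : α → ℝ}
    (hf : AEStronglyMeasurable f μ) (hg : AEStronglyMeasurable g μ) :
    ‖∫ x, f x * g x ∂μ‖ₑ ≤ eLpNorm f 2 μ * eLpNorm g 2 μ := by
  calc ‖∫ x, f x * g x ∂μ‖ₑ ≤ eLpNorm (f • g) 1 μ := by
        rw [eLpNorm_one_eq_lintegral_enorm]
        exact enorm_integral_le_lintegral_enorm _
    _ ≤ eLpNorm f 2 μ * eLpNorm g 2 μ := eLpNorm_smul_le_mul_eLpNorm hg hf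

/-! ### Test functions as primitives of their time derivative -/

section TestFunction

variable {n : ℕ} {s p : ℝ} [Fact (2 ≤ p)] {Ω : Set (EuclideanSpace ℝ (Fin n))}
  [IsFiniteMeasure (volume.restrict Ω)] {t₁ t₂ : ℝ}
  {η N : ℝ → EuclideanSpace ℝ (Fin n) → ℝ} {ξ : ℝ → StrongDual ℝ (Sobolev s p Ω)}

/-- A test function is the primitive of its time derivative, tested with a fixed function. -/
theorem IsTestFunction.ae_integral_mul_rep (ht : t₁ < t₂) (hη : IsTestFunction t₁ t₂ η ξ)
    (hN : IsSobolevCurve s p N)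
    (hηN : ∀ᵐ t ∂(volume.restrict (Ioo t₁ t₂)), η t =ᵐ[volume] N t) (w : Sobolev s p Ω) :
    ∀ᵐ t ∂(volume.restrict (Ioo t₁ t₂)),
      ∫ x in Ω, η t x * Sobolev.rep w x = ∫ τ in Ioo t₁ t, ξ τ w := by
  have hq : (1 : ENNReal) ≤ ENNReal.ofReal (p / (p - 1)) := (one_le_ofReal_conj p).out
  have hf : IntegrableOn (fun τ => ξ τ w) (Ioo t₁ t₂) :=
    integrable_dual_apply_const (X := Sobolev s p Ω) hq hη.deriv_mem w
  have hg1 : MemLp (fun t => sobolevPairing s p Ω (Sobolev.ofFun s p Ω (N t)) w)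
      (ENNReal.ofReal p) volume :=
    ContinuousLinearMap.comp_memLp' (E := Sobolev s p Ω) (F := ℝ) ((sobolevPairing s p Ω).flip w)
      (hN.memLp_ofFun Ω)
  have hg2 : IntegrableOn (fun t => sobolevPairing s p Ω (Sobolev.ofFun s p Ω (N t)) w)
      (Ioo t₁ t₂) :=
    (hg1.restrict (Ioo t₁ t₂)).integrable (ENNReal.one_le_ofReal.2 (one_le_of_fact p))
  have hg : IntegrableOn (fun t => ∫ x in Ω, η t x * Sobolev.rep w x) (Ioo t₁ t₂) := by
    refine hg2.congr ?_
    filter_upwards [hηN, ae_restrict_of_ae (ae_sobolevPairing_ofFun (Ω := Ω) hN)] with t h1 h2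
    rw [h2]
    refine integral_congr_ae ?_
    filter_upwards [ae_restrict_of_ae h1] with x hx
    rw [hx]
  obtain ⟨c, hc⟩ := ae_eq_const_add_primitive ht hf hg
    (fun φ hφ hφc hφs => hη.deriv_eq φ hφ hφc hφs w)
  -- Towards `t₁`, up to null sets of times, the pairing tends to zero by the initial condition and
  -- Cauchy–Schwarz, and the primitive tends to zero by continuity. The constant is therefore zero.
  suffices c = 0 by simpa [this] using hc
  have := neBot_nhdsGT_inf_ae t₁
  have hT : ∀ᶠ t in 𝓝[>] t₁ ⊓ ae volume, t ∈ Ioo t₁ t₂ :=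
    Eventually.filter_mono inf_le_left (Ioo_mem_nhdsGT ht)
  have hev : ∀ {P : ℝ → Prop}, (∀ᵐ t ∂(volume.restrict (Ioo t₁ t₂)), P t) →
      ∀ᶠ t in 𝓝[>] t₁ ⊓ ae volume, P t := by
    intro P hP
    rw [ae_restrict_iff' measurableSet_Ioo] at hP
    filter_upwards [hT, Eventually.filter_mono inf_le_right hP] with t h1 h2 using h2 h1
  have hprim : Tendsto (fun t => ∫ τ in Ioo t₁ t, ξ τ w) (𝓝[>] t₁ ⊓ ae volume) (𝓝 0) := by
    have hf' : IntegrableOn (fun τ => ξ τ w) (Icc t₁ t₂) :=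
      (integrableOn_Icc_iff_integrableOn_Ioo (by finiteness) (by finiteness)).2 hf
    have h1 := (intervalIntegral.continuousOn_primitive hf') t₁ (left_mem_Icc.2 ht.le)
    have h2 : Tendsto (fun t => ∫ τ in Ioc t₁ t, ξ τ w) (𝓝[Icc t₁ t₂] t₁) (𝓝 0) := by
      simpa [ContinuousWithinAt] using h1
    have h3 : 𝓝[>] t₁ ⊓ ae volume ≤ 𝓝[Icc t₁ t₂] t₁ := by
      refine inf_le_left.trans ?_
      rw [← nhdsWithin_Ioo_eq_nhdsGT ht]
      exact nhdsWithin_mono _ Ioo_subset_Icc_self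
    refine (h2.mono_left h3).congr fun t => ?_
    exact integral_Ioc_eq_integral_Ioo
  have hgl : Tendsto (fun t => ∫ x in Ω, η t x * Sobolev.rep w x) (𝓝[>] t₁ ⊓ ae volume)
      (𝓝 0) := by
    have hw2 : eLpNorm (Sobolev.rep w) 2 (volume.restrict Ω) ≠ ⊤ :=
      ((Lp.memLp w.1.fst).mono_exponent (two_le_ofReal Fact.out)).2.ne
    have h1 : Tendsto (fun t => eLpNorm (η t) 2 (volume.restrict Ω) *
        eLpNorm (Sobolev.rep w) 2 (volume.restrict Ω)) (𝓝[>] t₁ ⊓ ae volume) (𝓝 0) := by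
      simpa using ENNReal.Tendsto.mul_const hη.initial (Or.inr hw2)
    have h2 : Tendsto (fun t => ‖∫ x in Ω, η t x * Sobolev.rep w x‖ₑ) (𝓝[>] t₁ ⊓ ae volume)
        (𝓝 0) := by
      refine tendsto_of_tendsto_of_tendsto_of_le_of_le' tendsto_const_nhds h1
        (Eventually.of_forall fun _ => zero_le) ?_
      filter_upwards [hev hηN] with t h3
      refine enorm_integral_mul_le ?_ (Lp.memLp w.1.fst).1
      exact (measurable_slice hN.measurable t).aestronglyMeasurable.congr
        (ae_restrict_of_ae h3.symm)
    have h3 := (ENNReal.tendsto_toReal ENNReal.zero_ne_top).comp h2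
    rw [tendsto_zero_iff_norm_tendsto_zero]
    simpa [Function.comp_def] using h3
  have hlim : Tendsto (fun t => ∫ x in Ω, η t x * Sobolev.rep w x) (𝓝[>] t₁ ⊓ ae volume)
      (𝓝 (c + 0)) := by
    refine (tendsto_const_nhds.add hprim).congr' ?_
    filter_upwards [hev hc] with t h1
    exact h1.symm
  rw [add_zero] at hlim
  exact tendsto_nhds_unique hlim hgl

/-- For a fixed `w` the exceptional times depend on `w`. A countable dense set gives one null set,
and both sides are continuous in `w`. Uniformity in `f` is needed because the slices paired with `N
t` vary in time. -/
theorem IsTestFunction.ae_integral_mul (ht : t₁ < t₂) (hη : IsTestFunction t₁ t₂ η ξ)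
    (hN : IsSobolevCurve s p N)
    (hηN : ∀ᵐ t ∂(volume.restrict (Ioo t₁ t₂)), η t =ᵐ[volume] N t) :
    ∀ᵐ t ∂(volume.restrict (Ioo t₁ t₂)), ∀ f, MemSobolev s p Ω f →
      ∫ x in Ω, N t x * f x = ∫ τ in Ioo t₁ t, ξ τ (Sobolev.ofFun s p Ω f) := by
  have hq : (1 : ENNReal) ≤ ENNReal.ofReal (p / (p - 1)) := (one_le_ofReal_conj p).out
  obtain ⟨D, hDc, hD⟩ := TopologicalSpace.exists_countable_dense (Sobolev s p Ω)
  have h1 : ∀ᵐ t ∂(volume.restrict (Ioo t₁ t₂)), ∀ w ∈ D,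
      ∫ x in Ω, η t x * Sobolev.rep w x = ∫ τ in Ioo t₁ t, ξ τ w :=
    (ae_ball_iff hDc).2 fun w _ => hη.ae_integral_mul_rep ht hN hηN w
  filter_upwards [h1, hηN, ae_restrict_of_ae (hN.ae_memSobolev (one_le_of_fact p) Ω),
    ae_restrict_mem measurableSet_Ioo] with t h2 h3 h4 h5 f hf
  rw [← sobolevPairing_ofFun_ofFun h4 hf]
  have h6 := apply_eq_integral_of_dense (X := Sobolev s p Ω)
    (A := sobolevPairing s p Ω (Sobolev.ofFun s p Ω (N t))) (ξ := ξ)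
    (μ := volume.restrict (Ioo t₁ t)) hq hη.deriv_mem
    (Measure.restrict_mono (Ioo_subset_Ioo_right h5.2.le) le_rfl) hD (fun w hw => by
      rw [sobolevPairing_ofFun h4, ← h2 w hw]
      refine integral_congr_ae ?_
      filter_upwards [ae_restrict_of_ae h3] with x hx
      rw [hx])
  exact h6 _

end TestFunction

/-! ### The cutoff, the truncated test function and the discrete chain rule -/

/-- A Lipschitz cutoff function in time, with values in `[0, 1]`. -/
def cutoff (t₁ t₂ m t : ℝ) : ℝ := max 0 (min 1 (m * min (t - t₁) (t₂ - t) - 1))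

section Cutoff

variable {t₁ t₂ m t h : ℝ}

theorem cutoff_nonneg : 0 ≤ cutoff t₁ t₂ m t := le_max_left _ _

theorem cutoff_le_one : cutoff t₁ t₂ m t ≤ 1 := max_le zero_le_one (min_le_left _ _)

theorem measurable_cutoff : Measurable (cutoff t₁ t₂ m) := by
  unfold cutoff; fun_prop

theorem cutoff_eq_zero (hm : 0 < m) (ht : t ∉ Icc (t₁ + 1 / m) (t₂ - 1 / m)) :
    cutoff t₁ t₂ m t = 0 := by
  refine max_eq_left ((min_le_right _ _).trans ?_)
  suffices min (t - t₁) (t₂ - t) ≤ 1 / m by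
    rw [le_div_iff₀ hm] at this
    linarith
  by_contra! hn
  rw [lt_min_iff] at hn
  exact ht ⟨by linarith, by linarith⟩

theorem tendsto_cutoff (ht : t ∈ Ioo t₁ t₂) : ∀ᶠ m : ℕ in atTop, cutoff t₁ t₂ m t = 1 := by
  have h0 : 0 < min (t - t₁) (t₂ - t) := lt_min (sub_pos.2 ht.1) (sub_pos.2 ht.2)
  filter_upwards [(tendsto_natCast_atTop_atTop (R := ℝ)).eventually_ge_atTop
    (2 / min (t - t₁) (t₂ - t))] with m hm
  rw [div_le_iff₀ h0] at hm
  unfold cutoff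
  rw [min_eq_left (by linarith), max_eq_right zero_le_one]

/-- The cutoff is `m`-Lipschitz and is zero up to `t₁ + 1/m`, so a shift by `h < 1/m` from a time `t
≤ t₁` still gives zero. From `t₁ + 2/m` onwards the branch rising from `t₁` is saturated and only
the decreasing branch at `t₂` remains. -/
theorem cutoff_add_sub_le (hm : 0 < m) (hh : 0 ≤ h) (hhm : h < 1 / m) :
    cutoff t₁ t₂ m (t + h) - cutoff t₁ t₂ m t ≤
      (Ioo t₁ (t₁ + 2 / m)).indicator (fun _ => m * h) t := by
  have hmm : m * (1 / m) = 1 := by field_simp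
  have hmh : 0 ≤ m * h := by positivity
  have hmono : ∀ {a b : ℝ}, a ≤ b → max 0 (min 1 a) ≤ max 0 (min 1 b) := fun hab =>
    max_le_max le_rfl (min_le_min le_rfl hab)
  by_cases ht : t ∈ Ioo t₁ (t₁ + 2 / m)
  · rw [indicator_of_mem ht]
    have h1 : min (t + h - t₁) (t₂ - (t + h)) ≤ min (t - t₁) (t₂ - t) + h := by
      rw [← min_add_add_right]
      exact min_le_min (by linarith) (by linarith)
    have h2 := mul_le_mul_of_nonneg_left h1 hm.le
    have h3 : ∀ a c : ℝ, 0 ≤ c → max 0 (min 1 (a + c)) ≤ max 0 (min 1 a) + c := by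
      intro a c hc
      refine max_le (add_nonneg (le_max_left _ _) hc) ?_
      rcases le_total 1 a with ha | ha
      · rw [min_eq_left ha]
        exact (min_le_left _ _).trans (by linarith [le_max_right (0 : ℝ) 1])
      · rw [min_eq_right ha]
        exact (min_le_right _ _).trans (by linarith [le_max_right (0 : ℝ) a])
    have h4 := (hmono (show m * min (t + h - t₁) (t₂ - (t + h)) - 1 ≤
      (m * min (t - t₁) (t₂ - t) - 1) + m * h by linarith)).trans (h3 _ _ hmh)
    unfold cutoff
    linarith
  · rw [indicator_of_notMem ht, sub_nonpos]
    by_cases h1 : t ≤ t₁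
    · rw [cutoff_eq_zero hm fun h' => ?_]
      · exact cutoff_nonneg
      · linarith [h'.1]
    · have h2 : t₁ + 2 / m ≤ t := by
        by_contra! hn
        exact ht ⟨not_le.1 h1, hn⟩
      have h3 : 2 ≤ m * (t - t₁) := by
        have : 2 / m ≤ t - t₁ := by linarith
        rw [div_le_iff₀ hm] at this
        linarith
      unfold cutoff
      rw [mul_min_of_nonneg _ _ hm.le, mul_min_of_nonneg _ _ hm.le]
      refine max_le_max le_rfl (le_min (min_le_left _ _) ?_)
      rw [← min_sub_sub_right, ← min_sub_sub_right]
      refine le_min ((min_le_left _ _).trans (by linarith)) ((min_le_right _ _).trans ?_)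
      refine (min_le_right _ _).trans ?_
      nlinarith

end Cutoff

section Truncation

variable {n : ℕ}

/-- The truncated test function `min {χ N, m u₊}`. -/
def truncTest (t₁ t₂ m : ℝ) (U N : ℝ → EuclideanSpace ℝ (Fin n) → ℝ) (t : ℝ)
    (x : EuclideanSpace ℝ (Fin n)) : ℝ :=
  min (cutoff t₁ t₂ m t * N t x) (m * max (U t x) 0)

/-- The excess `(u₊ - χ N / m)₊`. -/
def excess (t₁ t₂ m : ℝ) (U N : ℝ → EuclideanSpace ℝ (Fin n) → ℝ) (t : ℝ)
    (x : EuclideanSpace ℝ (Fin n)) : ℝ :=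
  max (max (U t x) 0 - cutoff t₁ t₂ m t * N t x / m) 0

/-- Summation by parts moves the difference onto `U`, giving `ψ(t+h) (U(t) - U(t+h))`. Convexity in
`r`, with `d` frozen at time `t + h`, bounds it by a difference of primitives; concavity in `d`,
with `r = U t x`, then brings `d` back to time `t` at the cost of the excess times the increment of
`χ N`. That increment splits into `χ(t) (N(t+h) - N(t))` and `N(t+h) (χ(t+h) - χ(t))`. -/
theorem truncTest_diff_mul_le {t₁ t₂ m h t : ℝ} (hm : 0 < m) (hh : 0 ≤ h) (hhm : h < 1 / m)
    {U N : ℝ → EuclideanSpace ℝ (Fin n) → ℝ} (hN : ∀ t x, 0 ≤ N t x)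
    (x : EuclideanSpace ℝ (Fin n)) {G : ℝ → EuclideanSpace ℝ (Fin n) → ℝ}
    (hG : ∀ t x, G t x = truncTest t₁ t₂ m U N t x *
      (U t x - (max (U t x) 0 + excess t₁ t₂ m U N t x) / 2)) :
    (truncTest t₁ t₂ m U N (t + h) x - truncTest t₁ t₂ m U N t x) * U t x ≤
      (G (t + h) x - G t x) +
      ((N (t + h) x - N t x) * (cutoff t₁ t₂ m t * excess t₁ t₂ m U N t x) + m * h *
        (N (t + h) x * (Ioo t₁ (t₁ + 2 / m)).indicator (fun t => max (U t x) 0) t)) := by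
  have hmn := hm.ne'
  set χ := cutoff t₁ t₂ m with hχ
  have hd0 : ∀ t, 0 ≤ χ t * N t x / m := fun t =>
    div_nonneg (mul_nonneg cutoff_nonneg (hN _ _)) hm.le
  have hψ : ∀ t, truncTest t₁ t₂ m U N t x = m * min (χ t * N t x / m) (max (U t x) 0) := by
    intro t
    rw [truncTest, mul_min_of_nonneg _ _ hm.le, mul_div_cancel₀ _ hmn]
  -- This factorization exhibits `G` as the truncation times a function in `L^p`, from which its
  -- integrability is read off later.
  have hprim : ∀ d R : ℝ, 0 ≤ d → min d R * (R + max (R - d) 0) = R ^ 2 - max (R - d) 0 ^ 2 := by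
    intro d R _
    rcases le_total d R with h' | h'
    · rw [min_eq_left h', max_eq_left (sub_nonneg.2 h')]; ring
    · rw [min_eq_right h', max_eq_right (sub_nonpos.2 h')]; ring
  have hG' : ∀ t, G t x = truncTest t₁ t₂ m U N t x * U t x -
      m / 2 * truncPrimitive (χ t * N t x / m) (U t x) := by
    intro t
    rw [hG, hψ, truncPrimitive, excess, ← hprim _ _ (hd0 t)]
    ring
  have h1 := truncPrimitive_sub_le (r := U (t + h) x) (r' := U t x) (hd0 (t + h))
  have h2 := truncPrimitive_sub_le' (χ t * N t x / m) (χ (t + h) * N (t + h) x / m) (U t x)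
  have h3 : χ (t + h) - χ t ≤ (Ioo t₁ (t₁ + 2 / m)).indicator (fun _ => m * h) t :=
    cutoff_add_sub_le hm hh hhm
  have hw0 : 0 ≤ excess t₁ t₂ m U N t x := le_max_right _ _
  have hwU : excess t₁ t₂ m U N t x ≤ max (U t x) 0 :=
    max_le (by linarith [hd0 t]) (le_max_right _ _)
  have h5 : N (t + h) x * (χ (t + h) - χ t) * excess t₁ t₂ m U N t x ≤
      m * h * (N (t + h) x * (Ioo t₁ (t₁ + 2 / m)).indicator (fun t => max (U t x) 0) t) := by
    have a1 := mul_le_mul_of_nonneg_left h3 (hN (t + h) x)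
    have a2 := mul_le_mul_of_nonneg_right a1 hw0
    refine a2.trans ?_
    by_cases ht : t ∈ Ioo t₁ (t₁ + 2 / m)
    · simp only [indicator_of_mem ht]
      have : 0 ≤ m * h * N (t + h) x := mul_nonneg (by positivity) (hN _ _)
      nlinarith
    · simp only [indicator_of_notMem ht]
      simp
  have h6 : m / 2 * (2 * excess t₁ t₂ m U N t x *
      (χ (t + h) * N (t + h) x / m - χ t * N t x / m)) =
      excess t₁ t₂ m U N t x * (χ (t + h) * N (t + h) x - χ t * N t x) := by
    field_simp
  have h7 := mul_le_mul_of_nonneg_left h1 (show 0 ≤ m / 2 by positivity)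
  have h8 := mul_le_mul_of_nonneg_left h2 (show 0 ≤ m / 2 by positivity)
  rw [← hχ] at *
  change m / 2 * _ ≤ m / 2 * (2 * excess t₁ t₂ m U N t x * _) at h8
  rw [h6] at h8
  rw [hG', hG', hψ (t + h)]
  have h9 : m / 2 * (min (χ (t + h) * N (t + h) x / m) (max (U (t + h) x) 0) *
      (U t x - U (t + h) x) * 2) = m * min (χ (t + h) * N (t + h) x / m) (max (U (t + h) x) 0) *
      (U t x - U (t + h) x) := by ring
  rw [h9] at h7
  nlinarith

end Truncation

/-! ### Integrability and integration of the discrete chain rule -/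

section Curve

variable {n : ℕ} {s p t₁ t₂ m : ℝ} {U N : ℝ → EuclideanSpace ℝ (Fin n) → ℝ}

theorem abs_min_sub_min_le' (a b c d : ℝ) : |min a b - min c d| ≤ |a - c| + |b - d| :=
  (abs_min_sub_min_le_max a b c d).trans (max_le_add_of_nonneg (abs_nonneg _) (abs_nonneg _))

theorem abs_max_zero_sub_le (a b : ℝ) : |max a 0 - max b 0| ≤ |a - b| := by
  simpa using abs_max_sub_max_le_max a 0 b 0

theorem IsSobolevCurve.const_mul (hU : IsSobolevCurve s p U) (c : ℝ) :
    IsSobolevCurve s p fun t x => c * U t x where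
  measurable := hU.measurable.const_mul c
  memLp := hU.memLp.const_mul c
  memLp_diff := by
    refine (hU.memLp_diff.const_mul c).ae_eq (ae_of_all _ fun z => ?_)
    simp only
    ring

theorem IsSobolevCurve.posPart (hU : IsSobolevCurve s p U) :
    IsSobolevCurve s p fun t x => max (U t x) 0 :=
  hU.mono (hU.measurable.max measurable_const)
    (fun t x => by simpa using abs_max_zero_sub_le (U t x) 0)
    (fun t x y => abs_max_zero_sub_le _ _)

theorem IsSobolevCurve.cutoff_mul (hN : IsSobolevCurve s p N) :
    IsSobolevCurve s p fun t x => cutoff t₁ t₂ m t * N t x := by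
  have h1 : ∀ t r, |cutoff t₁ t₂ m t * r| ≤ |r| := fun t r => by
    rw [abs_mul, abs_of_nonneg cutoff_nonneg]
    exact mul_le_of_le_one_left (abs_nonneg _) cutoff_le_one
  refine hN.mono ((measurable_cutoff.comp measurable_fst).mul hN.measurable)
    (fun t x => h1 _ _) fun t x y => ?_
  rw [← mul_sub]
  exact h1 _ _

theorem IsSobolevCurve.truncTest (hU : IsSobolevCurve s p U) (hN : IsSobolevCurve s p N) :
    IsSobolevCurve s p (truncTest t₁ t₂ m U N) := by
  have h1 := hN.cutoff_mul (t₁ := t₁) (t₂ := t₂) (m := m)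
  have h2 := hU.posPart.const_mul m
  refine h1.of_le h2 (h1.measurable.min h2.measurable) (fun t x => ?_)
    fun t x y => abs_min_sub_min_le' _ _ _ _
  simpa [FracParabolic.truncTest] using abs_min_sub_min_le' (cutoff t₁ t₂ m t * N t x) (m * max (U t x) 0) 0 0

theorem IsSobolevCurve.excess (hU : IsSobolevCurve s p U) (hN : IsSobolevCurve s p N) :
    IsSobolevCurve s p (excess t₁ t₂ m U N) := by
  have h1 := (hN.cutoff_mul (t₁ := t₁) (t₂ := t₂) (m := m)).const_mul m⁻¹
  have h2 := hU.posPart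
  refine h2.of_le h1 (((h2.measurable.sub ((hN.cutoff_mul (t₁ := t₁) (t₂ := t₂)
    (m := m)).measurable.div_const m)).max measurable_const)) (fun t x => ?_) fun t x y => ?_
  · refine (by simpa [FracParabolic.excess] using
      abs_max_zero_sub_le (max (U t x) 0 - cutoff t₁ t₂ m t * N t x / m) 0 :
      |FracParabolic.excess t₁ t₂ m U N t x| ≤ _).trans ?_
    rw [div_eq_inv_mul]
    exact abs_sub _ _
  · refine (abs_max_zero_sub_le _ _).trans ?_
    rw [div_eq_inv_mul, div_eq_inv_mul, sub_sub_sub_comm]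
    exact abs_sub _ _

end Curve

section Inequality

variable {n : ℕ} {s p t₁ t₂ m h : ℝ} {Ω : Set (EuclideanSpace ℝ (Fin n))}
  {U N : ℝ → EuclideanSpace ℝ (Fin n) → ℝ}

theorem measure_prod_ne_top {Ω : Set (EuclideanSpace ℝ (Fin n))}
    [IsFiniteMeasure (volume.restrict Ω)] (a b : ℝ) :
    (volume : Measure (ℝ × EuclideanSpace ℝ (Fin n))) (Icc a b ×ˢ Ω) ≠ ⊤ := by
  rw [Measure.volume_eq_prod, Measure.prod_prod]
  have : volume Ω ≠ ⊤ := by simpa using measure_ne_top (volume.restrict Ω) univ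
  exact ENNReal.mul_ne_top (by simp) this

theorem IsSobolevCurve.memLp_shift (hN : IsSobolevCurve s p N) (h : ℝ) :
    MemLp (fun q : ℝ × EuclideanSpace ℝ (Fin n) => N (q.1 + h) q.2) (ENNReal.ofReal p) volume :=
  hN.memLp.comp_measurePreserving
    ((measurePreserving_add_right volume h).prod (MeasurePreserving.id volume))

variable [Fact (2 ≤ p)] [IsFiniteMeasure (volume.restrict Ω)]

theorem integrable_shift_mul (hN : IsSobolevCurve s p N) (hNΩ : ∀ t, ∀ x, x ∉ Ω → N t x = 0)
    (hNt : ∀ t, t ∉ Ioo t₁ t₂ → ∀ x, N t x = 0)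
    {g : ℝ × EuclideanSpace ℝ (Fin n) → ℝ} (hg : MemLp g (ENNReal.ofReal p) volume) (h : ℝ) :
    Integrable fun q : ℝ × EuclideanSpace ℝ (Fin n) => N (q.1 + h) q.2 * g q := by
  refine integrable_mul_of_eq_zero_off (two_le_ofReal Fact.out) (hN.memLp_shift h) hg
    (measure_prod_ne_top (Ω := Ω) (t₁ - h) (t₂ - h)) fun q hq => ?_
  by_cases hx : q.2 ∈ Ω
  · refine hNt _ (fun ht => hq ⟨⟨by linarith [ht.1], by linarith [ht.2]⟩, hx⟩) _
  · exact hNΩ _ _ hx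

theorem integrable_curve_mul (hN : IsSobolevCurve s p N) (hNΩ : ∀ t, ∀ x, x ∉ Ω → N t x = 0)
    (hNt : ∀ t, t ∉ Ioo t₁ t₂ → ∀ x, N t x = 0)
    {g : ℝ × EuclideanSpace ℝ (Fin n) → ℝ} (hg : MemLp g (ENNReal.ofReal p) volume) :
    Integrable fun q : ℝ × EuclideanSpace ℝ (Fin n) => N q.1 q.2 * g q := by
  simpa using integrable_shift_mul hN hNΩ hNt hg 0

/-- Integrating the pointwise chain rule over all of space-time removes `G(t+h) - G(t)` by
translation invariance, because `G` is integrable. -/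
theorem integral_truncTest_diff_mul_le (hm : 0 < m) (hh : 0 ≤ h) (hhm : h < 1 / m)
    (hU : IsSobolevCurve s p U) (hN : IsSobolevCurve s p N) (hN0 : ∀ t x, 0 ≤ N t x)
    (hNΩ : ∀ t, ∀ x, x ∉ Ω → N t x = 0) (hNt : ∀ t, t ∉ Ioo t₁ t₂ → ∀ x, N t x = 0) :
    ∫ q : ℝ × EuclideanSpace ℝ (Fin n),
      (truncTest t₁ t₂ m U N (q.1 + h) q.2 - truncTest t₁ t₂ m U N q.1 q.2) * U q.1 q.2 ≤
    (∫ q : ℝ × EuclideanSpace ℝ (Fin n), (N (q.1 + h) q.2 - N q.1 q.2) *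
      (cutoff t₁ t₂ m q.1 * excess t₁ t₂ m U N q.1 q.2)) +
    m * h * ∫ q : ℝ × EuclideanSpace ℝ (Fin n), N (q.1 + h) q.2 *
      (Ioo t₁ (t₁ + 2 / m)).indicator (fun t => max (U t q.2) 0) q.1 := by
  have hψ : IsSobolevCurve s p (truncTest t₁ t₂ m U N) := hU.truncTest hN
  have hw : IsSobolevCurve s p (excess t₁ t₂ m U N) := hU.excess hN
  have hv : IsSobolevCurve s p (fun t x => cutoff t₁ t₂ m t * excess t₁ t₂ m U N t x) :=
    hw.cutoff_mul
  have hψN : ∀ t x, N t x = 0 → truncTest t₁ t₂ m U N t x = 0 := fun t x h' => by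
    rw [truncTest, h', mul_zero]
    exact min_eq_left (mul_nonneg hm.le (le_max_right _ _))
  have hψΩ : ∀ t, ∀ x, x ∉ Ω → truncTest t₁ t₂ m U N t x = 0 := fun t x hx =>
    hψN _ _ (hNΩ t x hx)
  have hψt : ∀ t, t ∉ Ioo t₁ t₂ → ∀ x, truncTest t₁ t₂ m U N t x = 0 := fun t ht x =>
    hψN _ _ (hNt t ht x)
  set G : ℝ → EuclideanSpace ℝ (Fin n) → ℝ := fun t x => truncTest t₁ t₂ m U N t x *
      (U t x - (max (U t x) 0 + excess t₁ t₂ m U N t x) / 2) with hG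
  have hg : MemLp (fun q : ℝ × EuclideanSpace ℝ (Fin n) => U q.1 q.2 -
      (max (U q.1 q.2) 0 + excess t₁ t₂ m U N q.1 q.2) / 2) (ENNReal.ofReal p) volume := by
    have := hU.memLp.sub ((hU.posPart.memLp.add hw.memLp).const_mul 2⁻¹)
    refine this.ae_eq (ae_of_all _ fun q => ?_)
    simp only [Pi.sub_apply, Pi.add_apply]
    ring
  have hGi : Integrable fun q : ℝ × EuclideanSpace ℝ (Fin n) => G q.1 q.2 :=
    integrable_curve_mul hψ hψΩ hψt hg
  have hmp : MeasurePreserving (fun q : ℝ × EuclideanSpace ℝ (Fin n) => (q.1 + h, q.2))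
      volume volume := (measurePreserving_add_right volume h).prod (MeasurePreserving.id volume)
  have hGhi : Integrable fun q : ℝ × EuclideanSpace ℝ (Fin n) => G (q.1 + h) q.2 :=
    hmp.integrable_comp_of_integrable hGi
  have hGG : ∫ q : ℝ × EuclideanSpace ℝ (Fin n), (G (q.1 + h) q.2 - G q.1 q.2) = 0 := by
    rw [integral_sub hGhi hGi, sub_eq_zero]
    have he : MeasurableEmbedding fun q : ℝ × EuclideanSpace ℝ (Fin n) => (q.1 + h, q.2) :=
      ((MeasurableEquiv.addRight h).prodCongr (MeasurableEquiv.refl _)).measurableEmbedding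
    exact hmp.integral_comp he (fun q => G q.1 q.2)
  have hi1 : Integrable fun q : ℝ × EuclideanSpace ℝ (Fin n) =>
      (truncTest t₁ t₂ m U N (q.1 + h) q.2 - truncTest t₁ t₂ m U N q.1 q.2) * U q.1 q.2 := by
    simp_rw [sub_mul]
    exact (integrable_shift_mul hψ hψΩ hψt hU.memLp h).sub
      (integrable_curve_mul hψ hψΩ hψt hU.memLp)
  have hi2 : Integrable fun q : ℝ × EuclideanSpace ℝ (Fin n) => (N (q.1 + h) q.2 - N q.1 q.2) *
      (cutoff t₁ t₂ m q.1 * excess t₁ t₂ m U N q.1 q.2) := by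
    simp_rw [sub_mul]
    exact (integrable_shift_mul hN hNΩ hNt hv.memLp h).sub
      (integrable_curve_mul hN hNΩ hNt hv.memLp)
  have hi3 : Integrable fun q : ℝ × EuclideanSpace ℝ (Fin n) => N (q.1 + h) q.2 *
      (Ioo t₁ (t₁ + 2 / m)).indicator (fun t => max (U t q.2) 0) q.1 := by
    have hS : MeasurableSet (Ioo t₁ (t₁ + 2 / m) ×ˢ (univ : Set (EuclideanSpace ℝ (Fin n)))) :=
      measurableSet_Ioo.prod MeasurableSet.univ
    refine (integrable_shift_mul hN hNΩ hNt (hU.posPart.memLp.indicator hS) h).congr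
      (ae_of_all _ fun q => ?_)
    by_cases hq : q.1 ∈ Ioo t₁ (t₁ + 2 / m) <;> simp [indicator, hq]
  have hi4 := hi3.const_mul (m * h)
  refine (integral_mono hi1 ((hGhi.sub hGi).add (hi2.add hi4)) fun q => ?_).trans_eq ?_
  · exact truncTest_diff_mul_le hm hh hhm hN0 q.2 (fun _ _ => rfl)
  · rw [integral_add' (hGhi.sub hGi) (hi2.add hi4), integral_add' hi2 hi4, integral_const_mul]
    exact (congrArg (· + _) hGG).trans (zero_add _)

end Inequality

/-! ### Pairing differences of a primitive with curves -/

theorem integral_Ioo_sub_eq_average {f : ℝ → ℝ} {t₁ t₂ t h : ℝ} (hf : IntegrableOn f (Ioo t₁ t₂))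
    (ht : t₁ ≤ t) (hh : 0 ≤ h) (hth : t + h ≤ t₂) :
    (∫ τ in Ioo t₁ (t + h), f τ) - ∫ τ in Ioo t₁ t, f τ =
      h * ∫ r in Ioc (0 : ℝ) 1, (Ioo t₁ t₂).indicator f (t + h * r) := by
  have hg : Integrable ((Ioo t₁ t₂).indicator f) := (integrable_indicator_iff measurableSet_Ioo).2 hf
  have h1 : ∀ c, t₁ ≤ c → c ≤ t₂ →
      ∫ τ in Ioo t₁ c, f τ = ∫ τ in t₁..c, (Ioo t₁ t₂).indicator f τ := by
    intro c hc1 hc2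
    rw [intervalIntegral.integral_of_le hc1, integral_Ioc_eq_integral_Ioo]
    refine setIntegral_congr_fun measurableSet_Ioo fun τ hτ => ?_
    exact (indicator_of_mem (show τ ∈ Ioo t₁ t₂ from ⟨hτ.1, hτ.2.trans_le hc2⟩) f).symm
  rw [h1 _ (by linarith) hth, h1 _ ht (by linarith),
    intervalIntegral.integral_interval_sub_left hg.intervalIntegrable hg.intervalIntegrable,
    ← intervalIntegral.integral_of_le zero_le_one,
    intervalIntegral.mul_integral_comp_add_mul]
  simp

/-- The extension by zero of a function on a time interval to the whole time axis. -/
def zeroExtend {F : Type*} [NormedAddCommGroup F] (t₁ t₂ : ℝ) (f : ℝ → F) : ℝ → F :=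
  (Ioo t₁ t₂).indicator f

theorem zeroExtend_of_mem {F : Type*} [NormedAddCommGroup F] {t₁ t₂ t : ℝ} (f : ℝ → F)
    (ht : t ∈ Ioo t₁ t₂) : zeroExtend t₁ t₂ f t = f t :=
  indicator_of_mem ht f

theorem zeroExtend_of_notMem {F : Type*} [NormedAddCommGroup F] {t₁ t₂ t : ℝ} (f : ℝ → F)
    (ht : t ∉ Ioo t₁ t₂) : zeroExtend t₁ t₂ f t = 0 :=
  indicator_of_notMem ht f

theorem memLp_zeroExtend {F : Type*} [NormedAddCommGroup F] {t₁ t₂ : ℝ} {f : ℝ → F} {q : ENNReal}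
    (hf : MemLp f q (volume.restrict (Ioo t₁ t₂))) : MemLp (zeroExtend t₁ t₂ f) q volume :=
  (memLp_indicator_iff_restrict measurableSet_Ioo).2 hf

section Abstract

variable {X : Type*} [NormedAddCommGroup X] [NormedSpace ℝ X] {ξ : ℝ → StrongDual ℝ X}
  {t₁ t₂ : ℝ} {q : ENNReal}

theorem integral_dual_sub_eq_average (hq : 1 ≤ q) (hξ : MemLp ξ q (volume.restrict (Ioo t₁ t₂)))
    {t h : ℝ} (ht : t₁ ≤ t) (hh : 0 ≤ h) (hth : t + h ≤ t₂) (w : X) :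
    (∫ τ in Ioo t₁ (t + h), ξ τ w) - ∫ τ in Ioo t₁ t, ξ τ w =
      h * ∫ r in Ioc (0 : ℝ) 1, zeroExtend t₁ t₂ ξ (t + h * r) w := by
  rw [integral_Ioo_sub_eq_average (integrable_dual_apply_const hq hξ w) ht hh hth]
  congr 1
  refine setIntegral_congr_fun measurableSet_Ioc fun r _ => ?_
  by_cases hr : t + h * r ∈ Ioo t₁ t₂
  · rw [indicator_of_mem hr, zeroExtend_of_mem _ hr]
  · rw [indicator_of_notMem hr, zeroExtend_of_notMem _ hr]
    rfl

theorem integral_dual_le (hq : 1 ≤ q) (hξ : MemLp ξ q (volume.restrict (Ioo t₁ t₂))) {b c : ℝ}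
    (hbc : b ≤ c) (hc : c ≤ t₂) (w : X) :
    ∫ τ in Ioo t₁ b, ξ τ w ≤ (∫ τ in Ioo t₁ c, ‖zeroExtend t₁ t₂ ξ τ‖) * ‖w‖ := by
  have h1 := (le_abs_self _).trans (abs_integral_apply_le (μ := volume.restrict (Ioo t₁ b)) hq hξ
    (Measure.restrict_mono (Ioo_subset_Ioo_right (hbc.trans hc)) le_rfl) w)
  refine h1.trans (mul_le_mul_of_nonneg_right ?_ (norm_nonneg _))
  have h2 : ∀ c', c' ≤ t₂ → ∫ τ in Ioo t₁ c', ‖ξ τ‖ =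
      ∫ τ in Ioo t₁ c', ‖zeroExtend t₁ t₂ ξ τ‖ := by
    intro c' hc'
    refine setIntegral_congr_fun measurableSet_Ioo fun τ hτ => ?_
    exact congrArg norm
      (zeroExtend_of_mem _ (show τ ∈ Ioo t₁ t₂ from ⟨hτ.1, hτ.2.trans_le hc'⟩)).symm
  rw [h2 b (hbc.trans hc)]
  refine setIntegral_mono_set ?_ (ae_of_all _ fun _ => norm_nonneg _)
    (Ioo_subset_Ioo_right hbc).eventuallyLE
  exact (((memLp_zeroExtend hξ).restrict (Ioo t₁ c)).integrable hq).norm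

variable {E : Type*} [MeasureSpace E] [SFinite (volume : Measure E)] {m h : ℝ} {p : ENNReal}
  {N v : ℝ → E → ℝ} {W : ℝ → X}

/-- The function `N` is the primitive of `ξ` when paired with the slices of `v`, which are
represented by `W`. -/
def IsPrimitiveAgainst (t₁ t₂ : ℝ) (N : ℝ → E → ℝ) (ξ : ℝ → StrongDual ℝ X) (v : ℝ → E → ℝ)
    (W : ℝ → X) : Prop :=
  -- The times of `N` and of `v` are decoupled: below, `N` is evaluated at `t + h` and `v` at `t`,
  -- and a null set of times for `N` may be translated by `h`.
  ∃ S : Set ℝ, (∀ᵐ t, t ∈ S) ∧ ∀ᵐ t, t ∈ Ioo t₁ t₂ → ∀ τ ∈ S,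
    Integrable (fun x => N t x * v τ x) ∧
      ∫ x, N t x * v τ x = ∫ r in Ioo t₁ t, ξ r (W τ)

/-- At each time the difference of the two primitives is the integral of `ξ` over `(t, t + h)`, that
is, `h` times an average of shifts. The bounds on the support of `v` keep this interval inside `(t₁,
t₂)`. -/
theorem IsPrimitiveAgainst.integral_shift_diff_mul_eq [ENNReal.HolderConjugate p q]
    (hq : 1 ≤ q) (hN : IsPrimitiveAgainst t₁ t₂ N ξ v W)
    (hξ : MemLp ξ q (volume.restrict (Ioo t₁ t₂))) (hW : MemLp W p volume)
    (hi : Integrable fun z : ℝ × E => (N (z.1 + h) z.2 - N z.1 z.2) * v z.1 z.2)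
    {a b : ℝ} (hvt : ∀ t, t ∉ Icc a b → (∀ x, v t x = 0) ∧ W t = 0)
    (ha : t₁ < a) (hb : b + h < t₂) (hh : 0 ≤ h) :
    ∫ z : ℝ × E, (N (z.1 + h) z.2 - N z.1 z.2) * v z.1 z.2 =
      h * ∫ r in Ioc (0 : ℝ) 1, shiftedPairing (zeroExtend t₁ t₂ ξ) W (h * r) := by
  obtain ⟨S, hS, hNξ⟩ := hN
  rw [integral_shiftedPairing hW (memLp_zeroExtend hξ), Measure.volume_eq_prod, integral_prod _ hi,
    ← integral_const_mul]
  refine integral_congr_ae ?_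
  filter_upwards [hNξ, (measurePreserving_add_right volume h).quasiMeasurePreserving.ae hNξ, hS]
    with t h1 h2 h5
  by_cases ht : t ∈ Icc a b
  · have hT : t ∈ Ioo t₁ t₂ := ⟨by linarith [ht.1], by linarith [ht.2]⟩
    have hTh : t + h ∈ Ioo t₁ t₂ := ⟨by linarith [ht.1], by linarith [ht.2]⟩
    rw [← integral_dual_sub_eq_average hq hξ hT.1.le hh hTh.2.le (W t), ← (h1 hT _ h5).2,
      ← (h2 hTh _ h5).2, ← integral_sub (h2 hTh _ h5).1 (h1 hT _ h5).1]
    simp_rw [sub_mul]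
  · simp only [(hvt t ht).1, (hvt t ht).2, mul_zero, integral_zero, map_zero]

/-- Here the zero initial value matters: `N(t+h)` is controlled by the integral of `‖ξ‖` from `t₁`
to `t + h`, and `t + h < t₁ + 3/m` when `t < t₁ + 2/m` and `h < 1/m`. Integrating over the layer
yields a product of two small integrals. -/
theorem IsPrimitiveAgainst.integral_shift_mul_indicator_le [ENNReal.HolderConjugate p q]
    (hp : 1 ≤ p) (hq : 1 ≤ q) (hN : IsPrimitiveAgainst t₁ t₂ N ξ v W)
    (hξ : MemLp ξ q (volume.restrict (Ioo t₁ t₂))) (hW : MemLp W p volume)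
    (hm : 0 < m) (hmt : 3 / m ≤ t₂ - t₁) (hh : 0 ≤ h) (hhm : h < 1 / m)
    (hi : Integrable fun z : ℝ × E => N (z.1 + h) z.2 *
      (Ioo t₁ (t₁ + 2 / m)).indicator (fun t => v t z.2) z.1) :
    ∫ z : ℝ × E, N (z.1 + h) z.2 * (Ioo t₁ (t₁ + 2 / m)).indicator (fun t => v t z.2) z.1 ≤
    (∫ t in Ioo t₁ (t₁ + 3 / m), ‖zeroExtend t₁ t₂ ξ t‖) *
      ∫ t in Ioo t₁ (t₁ + 3 / m), ‖W t‖ := by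
  obtain ⟨S, hS, hNξ⟩ := hN
  have h23 : t₁ + 2 / m + 1 / m = t₁ + 3 / m := by ring
  have hm1 : 0 < 1 / m := by positivity
  have hWi : IntegrableOn (fun t => ‖W t‖) (Ioo t₁ (t₁ + 3 / m)) :=
    ((hW.restrict _).integrable hp).norm
  have hsub : Ioo t₁ (t₁ + 2 / m) ⊆ Ioo t₁ (t₁ + 3 / m) :=
    Ioo_subset_Ioo_right (by linarith)
  set A := ∫ t in Ioo t₁ (t₁ + 3 / m), ‖zeroExtend t₁ t₂ ξ t‖ with hA
  have hA0 : 0 ≤ A := integral_nonneg fun _ => norm_nonneg _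
  rw [Measure.volume_eq_prod] at hi ⊢
  rw [integral_prod _ hi, ← setIntegral_eq_integral_of_forall_compl_eq_zero
    (s := Ioo t₁ (t₁ + 2 / m)) (fun t ht => by simp [indicator_of_notMem ht]),
    ← integral_const_mul]
  refine le_trans (integral_mono_ae (g := fun t => A * ‖W t‖)
    hi.integral_prod_left.integrableOn ((hWi.mono_set hsub).const_mul A) ?_)
    (setIntegral_mono_set (hWi.const_mul A)
      (ae_of_all _ fun t => mul_nonneg hA0 (norm_nonneg _)) hsub.eventuallyLE)
  filter_upwards [ae_restrict_of_ae
    ((measurePreserving_add_right volume h).quasiMeasurePreserving.ae hNξ), ae_restrict_of_ae hS,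
    ae_restrict_mem measurableSet_Ioo] with t h2 h5 ht
  have hTh : t + h ∈ Ioo t₁ t₂ := ⟨by linarith [ht.1], by linarith [ht.2]⟩
  refine le_trans (le_of_eq ?_) (integral_dual_le hq hξ (b := t + h) (c := t₁ + 3 / m)
    (by linarith [ht.2]) (by linarith) (W t))
  rw [← (h2 hTh _ h5).2]
  simp only [indicator_of_mem ht]

end Abstract

/-! ### Limits of the pairing and of the layer at the initial time -/

section Abstract

variable {X : Type*} [NormedAddCommGroup X] [NormedSpace ℝ X] {ξ : ℝ → StrongDual ℝ X}
  {p q : ENNReal} [ENNReal.HolderConjugate p q]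

theorem tendsto_shiftedPairing_zero (hξ : MemLp ξ q volume) {V : ℕ → ℝ → X} {W : ℝ → X}
    (hV : ∀ m, MemLp (V m) p volume) {G : ℝ → ℝ} (hG : MemLp G p volume)
    (hVG : ∀ m, ∀ᵐ t, ‖V m t‖ ≤ G t) (hlim : ∀ᵐ t, Tendsto (fun m => V m t) atTop (𝓝 (W t))) :
    Tendsto (fun m => shiftedPairing ξ (V m) 0) atTop (𝓝 (∫ t, ξ t (W t))) := by
  simp only [shiftedPairing, add_zero]
  refine tendsto_integral_of_dominated_convergence (fun t => ‖ξ t‖ * G t)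
    (fun m => (integrable_dual_apply (hV m) hξ).1) (hξ.norm.integrable_mul hG) (fun m => ?_) ?_
  · filter_upwards [hVG m] with t ht
    exact ((ξ t).le_opNorm _).trans (mul_le_mul_of_nonneg_left ht (norm_nonneg _))
  · filter_upwards [hlim] with t ht
    exact ((ξ t).continuous.tendsto _).comp ht

end Abstract

/-- Hölder's inequality on a short interval. -/
theorem tendsto_mul_integral_mul_integral {p q : ENNReal} [ENNReal.HolderConjugate p q]
    {f g : ℝ → ℝ} (hp : p ≠ ⊤) (hp1 : 1 ≤ p) (hq1 : 1 ≤ q) (hf : MemLp f p volume)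
    (hg : MemLp g q volume) (t₁ c : ℝ) :
    Tendsto (fun m : ℕ => (m : ℝ) * ((∫ t in Ioo t₁ (t₁ + c / m), ‖f t‖) *
      ∫ t in Ioo t₁ (t₁ + c / m), ‖g t‖)) atTop (𝓝 0) := by
  have key : ∀ {r : ENNReal} {F : ℝ → ℝ} (_ : 1 ≤ r) (_ : MemLp F r volume) (J : Set ℝ),
      ENNReal.ofReal (∫ t in J, ‖F t‖) ≤
        eLpNorm F r (volume.restrict J) * volume J ^ (1 - r⁻¹.toReal) := by
    intro r F hr hF J
    have h1 := eLpNorm_le_eLpNorm_mul_rpow_measure_univ (μ := volume.restrict J) hr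
      hF.1.restrict
    rw [Measure.restrict_apply_univ, ENNReal.toReal_one, div_one, one_div,
      ← ENNReal.toReal_inv] at h1
    refine le_trans ?_ h1
    rw [eLpNorm_one_eq_lintegral_enorm]
    have h2 := enorm_integral_le_lintegral_enorm (μ := volume.restrict J) (fun t => ‖F t‖)
    simp only [enorm_norm] at h2
    rwa [Real.enorm_of_nonneg (integral_nonneg fun _ => norm_nonneg _)] at h2
  -- The two Hölder factors multiply to `|J|`, which exactly compensates the factor `m`. Smallness
  -- then comes only from the norm of `f` on the shrinking interval.
  have hpq : (1 - p⁻¹.toReal) + (1 - q⁻¹.toReal) = 1 := by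
    have h1 : p⁻¹ + q⁻¹ = 1 := ENNReal.HolderConjugate.inv_add_inv_eq_one p q
    have hpi : p⁻¹ ≠ ⊤ := by simpa using (zero_lt_one.trans_le hp1).ne'
    have hqi : q⁻¹ ≠ ⊤ := by simpa using (zero_lt_one.trans_le hq1).ne'
    have := congrArg ENNReal.toReal h1
    rw [ENNReal.toReal_add hpi hqi, ENNReal.toReal_one] at this
    linarith
  have hnn : ∀ r : ENNReal, 1 ≤ r → 0 ≤ 1 - r⁻¹.toReal := by
    intro r hr
    have : r⁻¹ ≤ 1 := ENNReal.inv_le_one.2 hr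
    have := ENNReal.toReal_mono ENNReal.one_ne_top this
    rw [ENNReal.toReal_one] at this
    linarith
  have hbound : ∀ m : ℕ, m ≠ 0 → ENNReal.ofReal ((m : ℝ) *
      ((∫ t in Ioo t₁ (t₁ + c / m), ‖f t‖) * ∫ t in Ioo t₁ (t₁ + c / m), ‖g t‖)) ≤
      eLpNorm f p (volume.restrict (Ioo t₁ (t₁ + c / m))) *
        (eLpNorm g q volume * ENNReal.ofReal c) := by
    intro m hm
    have hm0 : (0 : ℝ) < m := by positivity
    set J := Ioo t₁ (t₁ + c / m) with hJ
    have hJv : volume J = ENNReal.ofReal (c / m) := by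
      rw [hJ, Real.volume_Ioo]; congr 1; ring
    rw [ENNReal.ofReal_mul hm0.le, ENNReal.ofReal_mul (integral_nonneg fun _ => norm_nonneg _)]
    calc _ ≤ ENNReal.ofReal m * ((eLpNorm f p (volume.restrict J) *
          volume J ^ (1 - p⁻¹.toReal)) * (eLpNorm g q (volume.restrict J) *
          volume J ^ (1 - q⁻¹.toReal))) := by
          gcongr
          · exact key hp1 hf J
          · exact key hq1 hg J
      _ = eLpNorm f p (volume.restrict J) * (eLpNorm g q (volume.restrict J) *
          (ENNReal.ofReal m * (volume J ^ (1 - p⁻¹.toReal) * volume J ^ (1 - q⁻¹.toReal)))) := by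
          ring
      _ = eLpNorm f p (volume.restrict J) * (eLpNorm g q (volume.restrict J) *
          ENNReal.ofReal c) := by
          rw [← ENNReal.rpow_add_of_nonneg _ _ (hnn p hp1) (hnn q hq1), hpq, ENNReal.rpow_one, hJv,
            ← ENNReal.ofReal_mul hm0.le, mul_div_cancel₀ _ hm0.ne']
      _ ≤ _ := by
          gcongr
          exact Measure.restrict_le_self
  have hp0 : p ≠ 0 := (zero_lt_one.trans_le hp1).ne'
  have hlim : Tendsto (fun m : ℕ => eLpNorm f p (volume.restrict (Ioo t₁ (t₁ + c / m)))) atTop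
      (𝓝 0) := by
    simp_rw [eLpNorm_eq_lintegral_rpow_enorm_toReal hp0 hp]
    have hv : Tendsto (fun m : ℕ => (volume : Measure ℝ) (Ioo t₁ (t₁ + c / m))) atTop (𝓝 0) := by
      have h1 : Tendsto (fun m : ℕ => ENNReal.ofReal (c / m)) atTop (𝓝 (ENNReal.ofReal 0)) :=
        (ENNReal.continuous_ofReal.tendsto 0).comp (tendsto_const_div_atTop_nhds_zero_nat c)
      rw [ENNReal.ofReal_zero] at h1
      refine h1.congr fun m => ?_
      rw [Real.volume_Ioo]; congr 1; ring
    have hfin : ∫⁻ t, ‖f t‖ₑ ^ p.toReal ≠ ⊤ :=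
      ((eLpNorm_lt_top_iff_lintegral_rpow_enorm_lt_top hp0 hp).1 hf.2).ne
    have h2 := tendsto_setLIntegral_zero (μ := volume) hfin hv
    have hpos : 0 < 1 / p.toReal := one_div_pos.2 (ENNReal.toReal_pos hp0 hp)
    have h3 := (ENNReal.continuous_rpow_const (y := 1 / p.toReal)).continuousAt.tendsto.comp h2
    rw [ENNReal.zero_rpow_of_pos hpos] at h3
    exact h3
  have hfin2 : eLpNorm g q volume * ENNReal.ofReal c ≠ ⊤ :=
    ENNReal.mul_ne_top hg.2.ne ENNReal.ofReal_ne_top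
  have h4 := ENNReal.Tendsto.mul_const hlim (Or.inr hfin2)
  rw [zero_mul] at h4
  have h5 : Tendsto (fun m : ℕ => ENNReal.ofReal ((m : ℝ) *
      ((∫ t in Ioo t₁ (t₁ + c / m), ‖f t‖) * ∫ t in Ioo t₁ (t₁ + c / m), ‖g t‖))) atTop (𝓝 0) :=
    tendsto_of_tendsto_of_tendsto_of_le_of_le' tendsto_const_nhds h4
      (Eventually.of_forall fun _ => zero_le)
      ((eventually_ne_atTop 0).mono hbound)
  have h6 := (ENNReal.tendsto_toReal ENNReal.zero_ne_top).comp h5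
  rw [ENNReal.toReal_zero] at h6
  refine h6.congr fun m => ?_
  exact ENNReal.toReal_ofReal (mul_nonneg (Nat.cast_nonneg _)
    (mul_nonneg (integral_nonneg fun _ => norm_nonneg _) (integral_nonneg fun _ => norm_nonneg _)))

/-! ### Lower bound for the energies of the truncated test functions -/

section Energy

variable {n : ℕ} {s p Λ t₁ t₂ : ℝ}
  {K : EuclideanSpace ℝ (Fin n) → EuclideanSpace ℝ (Fin n) → ℝ → ℝ}
  {U N : ℝ → EuclideanSpace ℝ (Fin n) → ℝ}

theorem IsEllipticKernel.nonneg (hΛ : 1 ≤ Λ) (hK : IsEllipticKernel s p Λ K)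
    {x y : EuclideanSpace ℝ (Fin n)} (hxy : x ≠ y) (t : ℝ) : 0 ≤ K x y t :=
  le_trans (by positivity) (hK.lower x y t hxy)

/-- Passing to positive parts changes something only if one value is negative. Its test value is
then zero, so only the other one counts, and there the positive difference `a - b` or `b - a` gets
smaller. -/
theorem abs_rpow_mul_posPart_le {e a b ψ φ : ℝ} (he : 0 ≤ e) (hψ : 0 ≤ ψ) (hφ : 0 ≤ φ)
    (ha : a ≤ 0 → ψ = 0) (hb : b ≤ 0 → φ = 0) :
    |max a 0 - max b 0| ^ e * (max a 0 - max b 0) * (ψ - φ) ≤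
      |a - b| ^ e * (a - b) * (ψ - φ) := by
  have key : ∀ {a b ψ : ℝ}, 0 ≤ ψ → 0 ≤ a → b ≤ 0 → |a| ^ e * a * ψ ≤
      |a - b| ^ e * (a - b) * ψ := by
    intro a b ψ hψ ha hb
    refine mul_le_mul_of_nonneg_right ?_ hψ
    rw [abs_of_nonneg ha, abs_of_nonneg (by linarith : (0 : ℝ) ≤ a - b)]
    have h1 : a ^ e ≤ (a - b) ^ e := Real.rpow_le_rpow ha (by linarith) he
    exact mul_le_mul h1 (by linarith) ha (Real.rpow_nonneg (by linarith) _)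
  rcases le_total a 0 with h1 | h1 <;> rcases le_total b 0 with h2 | h2
  · rw [ha h1, hb h2]; simp
  · rw [max_eq_right h1, max_eq_left h2, ha h1]
    have := key hφ h2 h1
    rw [zero_sub, abs_neg, abs_sub_comm a b]
    nlinarith
  · rw [max_eq_left h1, max_eq_right h2, hb h2]
    have := key hψ h1 h2
    simpa using this
  · rw [max_eq_left h1, max_eq_left h2]

variable [Fact (2 ≤ p)]

theorem flux_posPart_mul_le (hΛ : 1 ≤ Λ) (hK : IsEllipticKernel s p Λ K)
    {ψ : ℝ → EuclideanSpace ℝ (Fin n) → ℝ} (hψ : ∀ t x, 0 ≤ ψ t x)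
    (hψU : ∀ t x, U t x ≤ 0 → ψ t x = 0) (x y : EuclideanSpace ℝ (Fin n)) (t : ℝ) :
    flux p K (fun t x => max (U t x) 0) x y t * (ψ t x - ψ t y) ≤
      flux p K U x y t * (ψ t x - ψ t y) := by
  have hp : 2 ≤ p := Fact.out
  by_cases hxy : x = y
  · simp [hxy]
  · have := mul_le_mul_of_nonneg_left (abs_rpow_mul_posPart_le (e := p - 2) (by linarith)
      (hψ t x) (hψ t y) (hψU t x) (hψU t y)) (hK.nonneg hΛ hxy t)
    simp only [flux]
    linarith

/-- The sign of `f` orders `c` and `d`. Subtracting `m c` and `m d` therefore decreases the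
difference in the direction that matters, so the bound does not depend on `m`. -/
theorem mul_excess_sub_le {a b c d f m : ℝ} (hm : 0 ≤ m) (hf : 0 ≤ f * (c - d)) :
    f * (max (a - m * c) 0 - max (b - m * d) 0) ≤ |f| * |a - b| := by
  rcases eq_or_ne f 0 with h0 | h0
  · simp [h0]
  have key : ∀ {a b c d : ℝ}, d ≤ c → max (a - m * c) 0 - max (b - m * d) 0 ≤ |a - b| := by
    intro a b c d hcd
    have h1 : m * d ≤ m * c := mul_le_mul_of_nonneg_left hcd hm
    have h2 : max (a - m * c) 0 ≤ max (b - m * d) 0 + |a - b| := by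
      refine max_le ?_ (add_nonneg (le_max_right _ _) (abs_nonneg _))
      linarith [le_max_left (b - m * d) 0, le_abs_self (a - b)]
    linarith
  rcases lt_or_gt_of_ne h0 with h | h
  · have hcd : c ≤ d := by nlinarith
    have := key (a := b) (b := a) hcd
    rw [abs_of_neg h, abs_sub_comm]
    nlinarith
  · have hcd : d ≤ c := by nlinarith
    rw [abs_of_pos h]
    exact mul_le_mul_of_nonneg_left (key hcd) h.le

/-- If `c ≠ d`, the larger one is positive and its excess is eventually zero, so what is left has
the opposite sign to `f`. If `c = d`, then `f = 0`. -/
theorem eventually_mul_excess_sub_nonpos {A B : ℕ → ℝ} {a b c d f : ℝ} (hA : ∀ m, A m ≤ a)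
    (hB : ∀ m, B m ≤ b) (hc : 0 ≤ c) (hd : 0 ≤ d) (hf : 0 ≤ f * (c - d))
    (hcd : c = d → f = 0) :
    ∀ᶠ m : ℕ in atTop, f * (max (A m - m * c) 0 - max (B m - m * d) 0) ≤ 0 := by
  have key : ∀ {A : ℕ → ℝ} {a c : ℝ}, (∀ m, A m ≤ a) → 0 < c →
      ∀ᶠ m : ℕ in atTop, max (A m - m * c) 0 = 0 := by
    intro A a c hA hc
    filter_upwards [(tendsto_natCast_atTop_atTop (R := ℝ)).eventually_ge_atTop (a / c)] with m hm
    rw [div_le_iff₀ hc] at hm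
    exact max_eq_right (by linarith [hA m])
  rcases lt_trichotomy c d with h | h | h
  · have hf0 : f ≤ 0 := by nlinarith
    filter_upwards [key hB (hc.trans_lt h)] with m hm
    rw [hm, sub_zero]
    exact mul_nonpos_of_nonpos_of_nonneg hf0 (le_max_right _ _)
  · simp [hcd h]
  · have hf0 : 0 ≤ f := by nlinarith
    filter_upwards [key hA (hd.trans_lt h)] with m hm
    rw [hm, zero_sub]
    exact mul_nonpos_of_nonneg_of_nonpos hf0 (neg_nonpos.2 (le_max_right _ _))

/-- The energy of the positive part is an asymptotic lower bound for the energies of the truncated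
test functions. -/
theorem exists_tendsto_le_shiftedEnergy (hΛ : 1 ≤ Λ) (hK : IsEllipticKernel s p Λ K)
    (hU : IsSobolevCurve s p U) (hN : IsSobolevCurve s p N) (hN0 : ∀ t x, 0 ≤ N t x)
    (hNt : ∀ t, t ∉ Ioo t₁ t₂ → ∀ x, N t x = 0) :
    ∃ a : ℕ → ℝ, (∀ m : ℕ, a m ≤ shiftedEnergy p K U (truncTest t₁ t₂ m U N) 0) ∧
      Tendsto a atTop (𝓝 (∫ z : ℝ × EuclideanSpace ℝ (Fin n) × EuclideanSpace ℝ (Fin n),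
        flux p K (fun t x => max (U t x) 0) z.2.1 z.2.2 z.1 * (N z.1 z.2.1 - N z.1 z.2.2))) := by
  have hp : 2 ≤ p := Fact.out
  set f : ℝ × EuclideanSpace ℝ (Fin n) × EuclideanSpace ℝ (Fin n) → ℝ := fun z =>
    flux p K (fun t x => max (U t x) 0) z.2.1 z.2.2 z.1 with hf
  set M : ℕ → ℝ → EuclideanSpace ℝ (Fin n) → ℝ := fun m t x => cutoff t₁ t₂ m t * N t x with hM
  set D : ℕ → ℝ × EuclideanSpace ℝ (Fin n) × EuclideanSpace ℝ (Fin n) → ℝ := fun m z =>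
    max (M m z.1 z.2.1 - m * max (U z.1 z.2.1) 0) 0 -
      max (M m z.1 z.2.2 - m * max (U z.1 z.2.2) 0) 0 with hD
  -- Only an upper bound for `f D` is uniform in `m`, so `f D` is replaced by its positive part.
  -- This keeps `F` below the energy density and makes it dominated.
  set F : ℕ → ℝ × EuclideanSpace ℝ (Fin n) × EuclideanSpace ℝ (Fin n) → ℝ := fun m z =>
    f z * (M m z.1 z.2.1 - M m z.1 z.2.2) - max (f z * D m z) 0 with hF
  have hfint := integrable_flux_mul hΛ hK hU.posPart hN
  have hfm : Measurable f := measurable_flux hK hU.posPart.measurable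
  have hMc : ∀ m, IsSobolevCurve s p (M m) := fun m => hN.cutoff_mul
  have hDm : ∀ m, Measurable (D m) := fun m =>
    measurable_diff (u := fun t x => max (M m t x - m * max (U t x) 0) 0)
      (((hMc m).measurable.sub (hU.posPart.measurable.const_mul _)).max measurable_const)
  have hFm : ∀ m, Measurable (F m) := fun m =>
    (hfm.mul (measurable_diff (hMc m).measurable)).sub ((hfm.mul (hDm m)).max measurable_const)
  have hfsign : ∀ z, 0 ≤ f z * (max (U z.1 z.2.1) 0 - max (U z.1 z.2.2) 0) := by
    intro z
    by_cases hz : z.2.1 = z.2.2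
    · simp [hz]
    · simp only [hf, flux]
      rw [mul_assoc, mul_assoc]
      exact mul_nonneg (hK.nonneg hΛ hz _) (mul_nonneg (by positivity) (mul_self_nonneg _))
  have hMle : ∀ (m : ℕ) (z : ℝ × EuclideanSpace ℝ (Fin n) × EuclideanSpace ℝ (Fin n)),
      |M m z.1 z.2.1 - M m z.1 z.2.2| ≤ |N z.1 z.2.1 - N z.1 z.2.2| := by
    intro m z
    simp only [hM]
    rw [← mul_sub, abs_mul, abs_of_nonneg cutoff_nonneg]
    exact mul_le_of_le_one_left (abs_nonneg _) cutoff_le_one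
  have hDle : ∀ m z, max (f z * D m z) 0 ≤ |f z| * |N z.1 z.2.1 - N z.1 z.2.2| := fun m z =>
    max_le ((mul_excess_sub_le (Nat.cast_nonneg m) (hfsign z)).trans
      (mul_le_mul_of_nonneg_left (hMle m z) (abs_nonneg _))) (by positivity)
  have hbound : ∀ m z, ‖F m z‖ ≤ 2 * ‖f z * (N z.1 z.2.1 - N z.1 z.2.2)‖ := by
    intro m z
    have h1 := mul_le_mul_of_nonneg_left (hMle m z) (abs_nonneg (f z))
    have h2 := abs_sub (f z * (M m z.1 z.2.1 - M m z.1 z.2.2)) (max (f z * D m z) 0)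
    rw [abs_of_nonneg (le_max_right (f z * D m z) 0), abs_mul] at h2
    rw [Real.norm_eq_abs, Real.norm_eq_abs, abs_mul]
    linarith [hDle m z]
  have hlim : ∀ z, Tendsto (fun m => F m z) atTop
      (𝓝 (f z * (N z.1 z.2.1 - N z.1 z.2.2))) := by
    intro z
    -- At every point `F m` equals its limit for large `m`: the cutoff has become one, or `N`
    -- vanishes at that time, and the positive part of `f D` is zero.
    refine tendsto_const_nhds.congr' ?_
    have hMN : ∀ x, ∀ m, M m z.1 x ≤ N z.1 x := fun x m =>
      mul_le_of_le_one_left (hN0 _ _) cutoff_le_one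
    have hzero : (max (U z.1 z.2.1) 0 = max (U z.1 z.2.2) 0) → f z = 0 := by
      intro h
      simp [hf, flux, h]
    have h1 := eventually_mul_excess_sub_nonpos (hMN z.2.1) (hMN z.2.2) (le_max_right _ _)
      (le_max_right _ _) (hfsign z) hzero
    have h2 : ∀ᶠ m : ℕ in atTop, ∀ x, M m z.1 x = N z.1 x := by
      by_cases hz : z.1 ∈ Ioo t₁ t₂
      · filter_upwards [tendsto_cutoff hz] with m hm x
        simp [hM, hm]
      · exact Eventually.of_forall fun m x => by simp [hM, hNt _ hz]
    filter_upwards [h1, h2] with m h3 h4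
    simp only [hF]
    rw [max_eq_right h3, sub_zero, h4, h4]
  refine ⟨fun m => ∫ z, F m z, fun m => ?_, ?_⟩
  · have hψ : IsSobolevCurve s p (truncTest t₁ t₂ m U N) := hU.truncTest hN
    have hFi : Integrable (F m) :=
      (hfint.norm.const_mul 2).mono' (hFm m).aestronglyMeasurable (ae_of_all _ (hbound m))
    unfold shiftedEnergy
    simp only [add_zero]
    refine integral_mono hFi (integrable_flux_mul hΛ hK hU hψ) fun z => ?_
    have hψ0 : ∀ t x, 0 ≤ truncTest t₁ t₂ m U N t x := fun t x =>
      le_min (mul_nonneg cutoff_nonneg (hN0 _ _)) (mul_nonneg (Nat.cast_nonneg _) (le_max_right _ _))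
    have hψU : ∀ t x, U t x ≤ 0 → truncTest t₁ t₂ m U N t x = 0 := fun t x h => by
      rw [truncTest, max_eq_right h, mul_zero]
      exact min_eq_right (mul_nonneg cutoff_nonneg (hN0 _ _))
    refine le_trans ?_ (flux_posPart_mul_le hΛ hK hψ0 hψU z.2.1 z.2.2 z.1)
    have hmin : ∀ t x, truncTest t₁ t₂ m U N t x =
        M m t x - max (M m t x - m * max (U t x) 0) 0 := by
      intro t x
      simp only [truncTest, hM]
      rcases le_total (cutoff t₁ t₂ m t * N t x) (m * max (U t x) 0) with h | h
      · rw [min_eq_left h, max_eq_right (sub_nonpos.2 h), sub_zero]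
      · rw [min_eq_right h, max_eq_left (sub_nonneg.2 h)]; ring
    rw [hmin, hmin]
    have := le_max_left (f z * D m z) 0
    simp only [hF, hD, hf] at this ⊢
    linarith
  · exact tendsto_integral_of_dominated_convergence _ (fun m => (hFm m).aestronglyMeasurable)
      (hfint.norm.const_mul 2) (fun m => ae_of_all _ (hbound m)) (ae_of_all _ hlim)

end Energy

/-! ### The inequality at a fixed truncation level -/

section Approximation

variable {n : ℕ} {s p Λ t₁ t₂ m : ℝ} [Fact (2 ≤ p)]
  {K : EuclideanSpace ℝ (Fin n) → EuclideanSpace ℝ (Fin n) → ℝ → ℝ}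
  {Ω : Set (EuclideanSpace ℝ (Fin n))} [IsFiniteMeasure (volume.restrict Ω)]
  {u U N : ℝ → EuclideanSpace ℝ (Fin n) → ℝ}

/-- For every `h < 1/m` the tested equation, the integrated chain rule and the primitive relation
combine to an inequality with a common factor `h`. After division, continuity of the shifted energy
and of the shifted pairing allows `h → 0`. -/
theorem IsSubsolution.shiftedEnergy_truncTest_le {X : Type*} [NormedAddCommGroup X]
    [NormedSpace ℝ X] (hΛ : 1 ≤ Λ) (hK : IsEllipticKernel s p Λ K)
    (hu : IsSubsolution s p K Ω t₁ t₂ u) (hU : IsSobolevCurve s p U)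
    (huU : ∀ᵐ t ∂(volume.restrict (Ioo t₁ t₂)), u t =ᵐ[volume] U t)
    (hN : IsSobolevCurve s p N) (hN0 : ∀ t x, 0 ≤ N t x)
    (hNΩ : ∀ t, ∀ x, x ∉ Ω → N t x = 0) (hNt : ∀ t, t ∉ Ioo t₁ t₂ → ∀ x, N t x = 0)
    (hm : 0 < m) (hmt : 3 / m ≤ t₂ - t₁) {ξ : ℝ → StrongDual ℝ X} {V W : ℝ → X}
    (hξ : MemLp ξ (ENNReal.ofReal (p / (p - 1))) (volume.restrict (Ioo t₁ t₂)))
    (hV : MemLp V (ENNReal.ofReal p) volume) (hW : MemLp W (ENNReal.ofReal p) volume)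
    (hV0 : ∀ t, t ∉ Icc (t₁ + 1 / m) (t₂ - 1 / m) → V t = 0)
    (hNV : IsPrimitiveAgainst t₁ t₂ N ξ
      (fun t x => cutoff t₁ t₂ m t * excess t₁ t₂ m U N t x) V)
    (hNW : IsPrimitiveAgainst t₁ t₂ N ξ (fun t x => max (U t x) 0) W) :
    shiftedEnergy p K U (truncTest t₁ t₂ m U N) 0 ≤
      shiftedPairing (zeroExtend t₁ t₂ ξ) V 0 +
        m * ((∫ t in Ioo t₁ (t₁ + 3 / m), ‖zeroExtend t₁ t₂ ξ t‖) *
          ∫ t in Ioo t₁ (t₁ + 3 / m), ‖W t‖) := by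
  have hp1 := one_le_of_fact p
  have hP : (1 : ENNReal) ≤ ENNReal.ofReal p := ENNReal.one_le_ofReal.2 hp1
  have hq : (1 : ENNReal) ≤ ENNReal.ofReal (p / (p - 1)) := (one_le_ofReal_conj p).out
  have hm1 : 0 < 1 / m := by positivity
  have hψ : IsSobolevCurve s p (truncTest t₁ t₂ m U N) := hU.truncTest hN
  have hw : IsSobolevCurve s p (excess t₁ t₂ m U N) := hU.excess hN
  have hv : IsSobolevCurve s p (fun t x => cutoff t₁ t₂ m t * excess t₁ t₂ m U N t x) :=
    hw.cutoff_mul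
  have hψ0 : ∀ t x, 0 ≤ truncTest t₁ t₂ m U N t x := fun t x =>
    le_min (mul_nonneg cutoff_nonneg (hN0 _ _)) (mul_nonneg hm.le (le_max_right _ _))
  have hψz : ∀ t x, cutoff t₁ t₂ m t * N t x = 0 → truncTest t₁ t₂ m U N t x = 0 := fun t x h' => by
    rw [truncTest, h']
    exact min_eq_left (mul_nonneg hm.le (le_max_right _ _))
  have hL := (tendsto_average (continuous_shiftedEnergy hΛ hK hU hψ))
  have hR := (tendsto_average (continuous_shiftedPairing (p := ENNReal.ofReal p)
    (q := ENNReal.ofReal (p / (p - 1))) ENNReal.ofReal_ne_top hV (memLp_zeroExtend hξ))).add_const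
    (m * ((∫ t in Ioo t₁ (t₁ + 3 / m), ‖zeroExtend t₁ t₂ ξ t‖) *
          ∫ t in Ioo t₁ (t₁ + 3 / m), ‖W t‖))
  refine le_of_tendsto_of_tendsto hL hR ?_
  filter_upwards [Ioo_mem_nhdsGT hm1] with h hh
  have hh0 : 0 < h := hh.1
  have e1 := hu.steklov_le hΛ hK hU huU hψ hψ0
    (fun t x hx => hψz t x (by rw [hNΩ t x hx, mul_zero]))
    (a := t₁ + 1 / m) (b := t₂ - 1 / m)
    (fun t ht x => hψz t x (by rw [cutoff_eq_zero hm ht, zero_mul])) hh0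
    (by linarith [hh.2]) (by linarith)
  have e2 := integral_truncTest_diff_mul_le hm hh0.le hh.2 hU hN hN0 hNΩ hNt
  have hi1 : Integrable fun q : ℝ × EuclideanSpace ℝ (Fin n) => (N (q.1 + h) q.2 - N q.1 q.2) *
      (cutoff t₁ t₂ m q.1 * excess t₁ t₂ m U N q.1 q.2) := by
    simp_rw [sub_mul]
    exact (integrable_shift_mul hN hNΩ hNt hv.memLp h).sub
      (integrable_curve_mul hN hNΩ hNt hv.memLp)
  have hi2 : Integrable fun q : ℝ × EuclideanSpace ℝ (Fin n) => N (q.1 + h) q.2 *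
      (Ioo t₁ (t₁ + 2 / m)).indicator (fun t => max (U t q.2) 0) q.1 := by
    have hS : MeasurableSet (Ioo t₁ (t₁ + 2 / m) ×ˢ (univ : Set (EuclideanSpace ℝ (Fin n)))) :=
      measurableSet_Ioo.prod MeasurableSet.univ
    refine (integrable_shift_mul hN hNΩ hNt (hU.posPart.memLp.indicator hS) h).congr
      (ae_of_all _ fun q => ?_)
    by_cases hq : q.1 ∈ Ioo t₁ (t₁ + 2 / m) <;> simp [indicator, hq]
  have e3 := hNV.integral_shift_diff_mul_eq hq hξ hV hi1 (a := t₁ + 1 / m) (b := t₂ - 1 / m)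
    (fun t ht => ⟨fun x => by rw [cutoff_eq_zero hm ht, zero_mul], hV0 t ht⟩) (by linarith)
    (by linarith [hh.2]) hh0.le
  have e4 := mul_le_mul_of_nonneg_left
    (hNW.integral_shift_mul_indicator_le hP hq hξ hW hm hmt hh0.le hh.2 hi2)
    (show 0 ≤ m * h by positivity)
  rw [e3] at e2
  refine le_of_mul_le_mul_left ?_ hh0
  linarith

/-- The good times for `v` are those at which its slice is in `W^{s,p}(Ω)`. Integrals over the whole
space reduce to `Ω` because `N` vanishes outside. -/
theorem IsTestFunction.isPrimitiveAgainst {η v : ℝ → EuclideanSpace ℝ (Fin n) → ℝ}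
    {ξ : ℝ → StrongDual ℝ (Sobolev s p Ω)} (ht : t₁ < t₂) (hη : IsTestFunction t₁ t₂ η ξ)
    (hN : IsSobolevCurve s p N) (hNΩ : ∀ t, ∀ x, x ∉ Ω → N t x = 0)
    (hηN : ∀ᵐ t ∂(volume.restrict (Ioo t₁ t₂)), η t =ᵐ[volume] N t)
    (hv : IsSobolevCurve s p v) :
    IsPrimitiveAgainst t₁ t₂ N ξ v (fun t => Sobolev.ofFun s p Ω (v t)) := by
  have hp1 := one_le_of_fact p
  refine ⟨{t | MemSobolev s p Ω (v t)}, hv.ae_memSobolev hp1 Ω, ?_⟩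
  have h1 := hη.ae_integral_mul ht hN hηN
  rw [ae_restrict_iff' measurableSet_Ioo] at h1
  filter_upwards [h1, hN.ae_memSobolev hp1 Ω] with t h2 h3 hT τ hτ
  have hz : ∀ x, x ∉ Ω → N t x * v τ x = 0 := fun x hx => by rw [hNΩ t x hx, zero_mul]
  refine ⟨?_, ?_⟩
  · rw [← integrableOn_iff_integrable_of_support_subset (s := Ω)]
    · exact integrable_mul_of_memLp (two_le_ofReal Fact.out) h3.1 hτ.1
    · intro x hx
      by_contra hn
      exact hx (hz x hn)
  · rw [← setIntegral_eq_integral_of_forall_compl_eq_zero hz]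
    exact h2 hT _ hτ

end Approximation

/-! ### Convergence of slices in the Sobolev space -/

section Slices

variable {n : ℕ} {s p : ℝ} [Fact (2 ≤ p)] {D : Set (EuclideanSpace ℝ (Fin n))}

theorem enorm_ofFun_sub_ofFun {f g : EuclideanSpace ℝ (Fin n) → ℝ} (hf : MemSobolev s p D f)
    (hg : MemSobolev s p D g) :
    ‖Sobolev.ofFun s p D f - Sobolev.ofFun s p D g‖ₑ =
      sobolevNorm s p D (fun x => f x - g x) := by
  have hg1 : (Sobolev.ofFun s p D g).1.fst =ᵐ[volume.restrict D] g := by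
    rw [fst_ofFun hg hg.1]
    exact hg.1.coeFn_toLp
  have hg2 : (Sobolev.ofFun s p D g).1.snd =ᵐ[gagliardoMeasure s p D] fun z => g z.1 - g z.2 := by
    rw [snd_ofFun hg hg.2]
    exact hg.2.coeFn_toLp
  have e1 : eLpNorm (fun x => f x - (Sobolev.ofFun s p D g).1.fst x) (ENNReal.ofReal p)
      (volume.restrict D) = eLpNorm (fun x => f x - g x) (ENNReal.ofReal p)
      (volume.restrict D) := by
    refine eLpNorm_congr_ae ?_
    filter_upwards [hg1] with x hx
    rw [hx]
  have e2 : eLpNorm (fun z => (f z.1 - f z.2) - (Sobolev.ofFun s p D g).1.snd z)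
      (ENNReal.ofReal p) (gagliardoMeasure s p D) =
      eLpNorm (fun z => (f z.1 - g z.1) - (f z.2 - g z.2)) (ENNReal.ofReal p)
        (gagliardoMeasure s p D) := by
    refine eLpNorm_congr_ae ?_
    filter_upwards [hg2] with z hz
    rw [hz]
    ring
  have h1 : eLpNorm (fun x => f x - g x) (ENNReal.ofReal p) (volume.restrict D) ≠ ⊤ :=
    (hf.1.sub hg.1).2.ne
  have h2 : eLpNorm (fun z => (f z.1 - g z.1) - (f z.2 - g z.2)) (ENNReal.ofReal p)
        (gagliardoMeasure s p D) ≠ ⊤ := by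
    rw [← e2]
    have := (hf.2.sub hg.2).2.ne
    rwa [← eLpNorm_congr_ae (show (fun z => (f z.1 - f z.2) - (Sobolev.ofFun s p D g).1.snd z)
      =ᵐ[gagliardoMeasure s p D] _ from ?_)] at this
    filter_upwards [hg2] with z hz
    simp only [Pi.sub_apply]
    rw [hz]
  rw [← ofReal_norm, norm_ofFun_sub hf, e1, e2, ← ENNReal.toReal_add h1 h2,
    ENNReal.ofReal_toReal (ENNReal.add_ne_top.2 ⟨h1, h2⟩)]
  rfl

/-- Dominated convergence in `W^{s,p}(D)`. -/
theorem tendsto_ofFun_of_dominated {f : ℕ → EuclideanSpace ℝ (Fin n) → ℝ}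
    {g a b : EuclideanSpace ℝ (Fin n) → ℝ} (hf : ∀ m, MemSobolev s p D (f m))
    (hg : MemSobolev s p D g) (ha : MemSobolev s p D a) (hb : MemSobolev s p D b)
    (h1 : ∀ m x, |f m x - g x| ≤ |a x| + |b x|)
    (h2 : ∀ m x y, |(f m x - g x) - (f m y - g y)| ≤ |a x - a y| + |b x - b y|)
    (hlim : ∀ x, Tendsto (fun m => f m x) atTop (𝓝 (g x))) :
    Tendsto (fun m => Sobolev.ofFun s p D (f m)) atTop (𝓝 (Sobolev.ofFun s p D g)) := by
  have hp1 := one_le_of_fact p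
  have hlim' : ∀ x, Tendsto (fun m => f m x - g x) atTop (𝓝 0) := fun x => by
    simpa using (hlim x).sub_const (g x)
  rw [tendsto_iff_edist_tendsto_0]
  have e1 := tendsto_eLpNorm_zero_of_dominated hp1 (μ := volume.restrict D)
    (f := fun m x => f m x - g x) (g := fun x => |a x| + |b x|)
    (fun m => ((hf m).1.sub hg.1).1) (ha.1.norm.add hb.1.norm).2.ne
    (fun m => ae_of_all _ (h1 m)) (ae_of_all _ hlim')
  have e2 := tendsto_eLpNorm_zero_of_dominated hp1 (μ := gagliardoMeasure s p D)
    (f := fun m z => (f m z.1 - g z.1) - (f m z.2 - g z.2))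
    (g := fun z => |a z.1 - a z.2| + |b z.1 - b z.2|)
    (fun m => (((hf m).2.sub hg.2).1).congr (ae_of_all _ fun z => by
      simp only [Pi.sub_apply]; ring)) (ha.2.norm.add hb.2.norm).2.ne
    (fun m => ae_of_all _ fun z => h2 m z.1 z.2)
    (ae_of_all _ fun z => by simpa using (hlim' z.1).sub (hlim' z.2))
  have e3 := e1.add e2
  rw [add_zero] at e3
  refine e3.congr fun m => ?_
  rw [edist_eq_enorm_sub, enorm_ofFun_sub_ofFun (hf m) hg]
  rfl

theorem norm_ofFun_le_add {f a b : EuclideanSpace ℝ (Fin n) → ℝ} (ha : MemSobolev s p D a)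
    (hb : MemSobolev s p D b) (h1 : ∀ x, |f x| ≤ |a x| + |b x|)
    (h2 : ∀ x y, |f x - f y| ≤ |a x - a y| + |b x - b y|) :
    ‖Sobolev.ofFun s p D f‖ ≤ ‖Sobolev.ofFun s p D a‖ + ‖Sobolev.ofFun s p D b‖ := by
  have hP : (1 : ENNReal) ≤ ENNReal.ofReal p := ENNReal.one_le_ofReal.2 (one_le_of_fact p)
  have hle : sobolevNorm s p D f ≤ sobolevNorm s p D a + sobolevNorm s p D b := by
    unfold sobolevNorm
    rw [add_add_add_comm]
    refine add_le_add ?_ ?_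
    · refine le_trans (eLpNorm_mono_real (g := fun x => |a x| + |b x|) h1) ?_
      refine (eLpNorm_add_le ha.1.1.norm hb.1.1.norm hP).trans_eq ?_
      rw [eLpNorm_norm, eLpNorm_norm]
    · refine le_trans (eLpNorm_mono_real (g := fun z => |a z.1 - a z.2| + |b z.1 - b z.2|)
        fun z => h2 z.1 z.2) ?_
      refine (eLpNorm_add_le ha.2.1.norm hb.2.1.norm hP).trans_eq ?_
      rw [eLpNorm_norm, eLpNorm_norm]
  have ha' : sobolevNorm s p D a ≠ ⊤ := ENNReal.add_ne_top.2 ⟨ha.1.2.ne, ha.2.2.ne⟩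
  have hb' : sobolevNorm s p D b ≠ ⊤ := ENNReal.add_ne_top.2 ⟨hb.1.2.ne, hb.2.2.ne⟩
  rw [norm_ofFun ha, norm_ofFun hb, ← ENNReal.toReal_add ha' hb', ← toReal_enorm]
  exact ENNReal.toReal_mono (ENNReal.add_ne_top.2 ⟨ha', hb'⟩) (enorm_ofFun_le.trans hle)

end Slices

theorem le_integral_pairing_of_tendsto {X : Type*} [NormedAddCommGroup X] [NormedSpace ℝ X]
    {p q : ENNReal} [ENNReal.HolderConjugate p q] (hp : p ≠ ⊤) (hp1 : 1 ≤ p) (hq1 : 1 ≤ q)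
    {t₁ t₂ c : ℝ} {ξ : ℝ → StrongDual ℝ X} (hξ : MemLp ξ q (volume.restrict (Ioo t₁ t₂)))
    {V : ℕ → ℝ → X} {W : ℝ → X} (hV : ∀ m, MemLp (V m) p volume) (hW : MemLp W p volume)
    {G : ℝ → ℝ} (hG : MemLp G p volume) (hVG : ∀ m, ∀ᵐ t, ‖V m t‖ ≤ G t)
    (hlim : ∀ᵐ t, Tendsto (fun m => V m t) atTop (𝓝 (W t))) {a : ℕ → ℝ} {A : ℝ}
    (ha : Tendsto a atTop (𝓝 A))
    (hle : ∀ᶠ m : ℕ in atTop, a m ≤ shiftedPairing (zeroExtend t₁ t₂ ξ) (V m) 0 +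
        m * ((∫ t in Ioo t₁ (t₁ + c / m), ‖zeroExtend t₁ t₂ ξ t‖) *
          ∫ t in Ioo t₁ (t₁ + c / m), ‖W t‖)) :
    A ≤ ∫ t in Ioo t₁ t₂, ξ t (W t) := by
  have hξ' := memLp_zeroExtend hξ
  have h1 := tendsto_shiftedPairing_zero hξ' hV hG hVG hlim
  have h2 := tendsto_mul_integral_mul_integral hp hp1 hq1 hW.norm hξ'.norm t₁ c
  simp only [norm_norm] at h2
  have h3 := h1.add h2
  have e : ∫ t, zeroExtend t₁ t₂ ξ t (W t) = ∫ t in Ioo t₁ t₂, ξ t (W t) := by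
    rw [← setIntegral_eq_integral_of_forall_compl_eq_zero (s := Ioo t₁ t₂) fun t ht => by
      rw [zeroExtend_of_notMem _ ht]; rfl]
    refine setIntegral_congr_fun measurableSet_Ioo fun t ht => ?_
    simp only [zeroExtend_of_mem ξ ht]
  rw [add_zero, e] at h3
  refine le_of_tendsto_of_tendsto ha h3 ?_
  filter_upwards [hle] with m hm
  rwa [mul_comm (∫ t in Ioo t₁ (t₁ + c / m), ‖W t‖)]

section Slices

variable {n : ℕ} {s p t₁ t₂ : ℝ} [Fact (2 ≤ p)] {D : Set (EuclideanSpace ℝ (Fin n))}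
  {U N : ℝ → EuclideanSpace ℝ (Fin n) → ℝ}

theorem div_natCast_le_self {r : ℝ} (hr : 0 ≤ r) (k : ℕ) : r / k ≤ r := by
  rcases Nat.eq_zero_or_pos k with h | h
  · simp [h, hr]
  · exact div_le_self hr (by exact_mod_cast h)

theorem abs_div_natCast_le (r : ℝ) (k : ℕ) : |r / k| ≤ |r| := by
  rw [abs_div, Nat.abs_cast]
  exact div_natCast_le_self (abs_nonneg _) k

/-- Once the cutoff equals one at `t`, the error is `-min {U₊, N / m}`. It tends to zero pointwise,
and its values and differences are dominated by those of `U₊` and `N`. -/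
theorem tendsto_ofFun_cutoff_mul_excess {t : ℝ} (ht : t ∈ Ioo t₁ t₂)
    (hU : MemSobolev s p D fun x => max (U t x) 0) (hN : MemSobolev s p D (N t))
    (hv : ∀ m : ℕ, MemSobolev s p D fun x => cutoff t₁ t₂ m t * excess t₁ t₂ m U N t x) :
    Tendsto (fun m : ℕ => Sobolev.ofFun s p D
      (fun x => cutoff t₁ t₂ m t * excess t₁ t₂ m U N t x)) atTop
      (𝓝 (Sobolev.ofFun s p D fun x => max (U t x) 0)) := by
  obtain ⟨k, hk⟩ := eventually_atTop.1 (tendsto_cutoff ht)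
  have hshift : ∀ (m : ℕ) x, cutoff t₁ t₂ (m + k : ℕ) t * excess t₁ t₂ (m + k : ℕ) U N t x =
      max (max (U t x) 0 - N t x / (m + k : ℕ)) 0 := fun m x => by
    rw [excess, hk (m + k) (Nat.le_add_left k m), one_mul, one_mul]
  have hdiff : ∀ (m : ℕ) x, cutoff t₁ t₂ (m + k : ℕ) t * excess t₁ t₂ (m + k : ℕ) U N t x -
      max (U t x) 0 = -min (max (U t x) 0) (N t x / (m + k : ℕ)) := fun m x => by
    rw [hshift]
    rcases le_total (max (U t x) 0) (N t x / (m + k : ℕ)) with h | h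
    · rw [min_eq_left h, max_eq_right (sub_nonpos.2 h), zero_sub]
    · rw [min_eq_right h, max_eq_left (sub_nonneg.2 h)]; ring
  -- The sequence is shifted by `k`, from which on the cutoff is one, since the domination is
  -- required for all indices.
  refine (tendsto_add_atTop_iff_nat k).1 (tendsto_ofFun_of_dominated (f := fun m x =>
    cutoff t₁ t₂ (m + k : ℕ) t * excess t₁ t₂ (m + k : ℕ) U N t x)
    (fun m => hv (m + k)) hU hU hN (fun m x => ?_) (fun m x y => ?_) fun x => ?_)
  · rw [hdiff, abs_neg]
    have := abs_min_sub_min_le' (max (U t x) 0) (N t x / (m + k : ℕ)) 0 0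
    simp only [min_self, sub_zero] at this
    exact this.trans (add_le_add le_rfl (abs_div_natCast_le _ _))
  · rw [hdiff, hdiff, neg_sub_neg, abs_sub_comm]
    refine (abs_min_sub_min_le' _ _ _ _).trans ?_
    rw [← sub_div]
    exact add_le_add le_rfl (abs_div_natCast_le _ _)
  · have h1 : Tendsto (fun m : ℕ => N t x / (m + k : ℕ)) atTop (𝓝 0) :=
      (tendsto_add_atTop_iff_nat k).2 (tendsto_const_div_atTop_nhds_zero_nat (N t x))
    have h2 := (tendsto_const_nhds (x := max (U t x) 0)).sub h1
    have h3 := h2.max (tendsto_const_nhds (x := (0 : ℝ)))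
    rw [sub_zero, max_eq_left (le_max_right (U t x) 0)] at h3
    exact h3.congr fun m => (hshift m x).symm

theorem norm_ofFun_cutoff_mul_excess_le {t : ℝ} (m : ℕ)
    (hU : MemSobolev s p D fun x => max (U t x) 0) (hN : MemSobolev s p D (N t)) :
    ‖Sobolev.ofFun s p D (fun x => cutoff t₁ t₂ m t * excess t₁ t₂ m U N t x)‖ ≤
      ‖Sobolev.ofFun s p D fun x => max (U t x) 0‖ + ‖Sobolev.ofFun s p D (N t)‖ := by
  have hc : ∀ r : ℝ, |cutoff t₁ t₂ m t * r| ≤ |r| := fun r => by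
    rw [abs_mul, abs_of_nonneg cutoff_nonneg]
    exact mul_le_of_le_one_left (abs_nonneg _) cutoff_le_one
  have hd : ∀ r : ℝ, |cutoff t₁ t₂ m t * r / m| ≤ |r| := fun r =>
    (abs_div_natCast_le _ _).trans (hc r)
  refine norm_ofFun_le_add hU hN (fun x => ?_) fun x y => ?_
  · refine (hc _).trans ?_
    have := abs_max_zero_sub_le (max (U t x) 0 - cutoff t₁ t₂ m t * N t x / m) 0
    rw [max_self, sub_zero, sub_zero] at this
    exact (this.trans (abs_sub _ _)).trans (add_le_add le_rfl (hd _))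
  · rw [← mul_sub]
    refine (hc _).trans ((abs_max_zero_sub_le _ _).trans ?_)
    rw [sub_sub_sub_comm]
    refine (abs_sub _ _).trans ?_
    rw [← sub_div, ← mul_sub]
    exact add_le_add le_rfl (hd _)

end Slices

/-! ### Passage to the limit and conclusion -/

/-- A nonnegative test function has a measurable representative that is nonnegative and vanishes
outside of the space-time cylinder everywhere. -/
theorem IsTestFunction.exists_curve {n : ℕ} {s p t₁ t₂ : ℝ} [Fact (2 ≤ p)]
    {Ω : Set (EuclideanSpace ℝ (Fin n))} (hΩ : MeasurableSet Ω)
    {η : ℝ → EuclideanSpace ℝ (Fin n) → ℝ} {ξ : ℝ → StrongDual ℝ (Sobolev s p Ω)}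
    (hη : IsTestFunction t₁ t₂ η ξ)
    (hη0 : ∀ᵐ t ∂(volume.restrict (Ioo t₁ t₂)), ∀ᵐ x, 0 ≤ η t x) :
    ∃ N : ℝ → EuclideanSpace ℝ (Fin n) → ℝ, IsSobolevCurve s p N ∧ (∀ t x, 0 ≤ N t x) ∧
      (∀ t, ∀ x, x ∉ Ω → N t x = 0) ∧ (∀ t, t ∉ Ioo t₁ t₂ → ∀ x, N t x = 0) ∧
      ∀ᵐ t ∂(volume.restrict (Ioo t₁ t₂)), η t =ᵐ[volume] N t := by
  have hp1 := one_le_of_fact p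
  obtain ⟨M, hM, hM0, hηM⟩ := hη.mem.exists_curve hp1
  set N : ℝ → EuclideanSpace ℝ (Fin n) → ℝ := fun t => Ω.indicator fun x => max (M t x) 0 with hN
  have hNm : Measurable fun q : ℝ × EuclideanSpace ℝ (Fin n) => N q.1 q.2 := by
    have := (hM.measurable.max (measurable_const (a := (0 : ℝ)))).indicator
      ((MeasurableSet.univ (α := ℝ)).prod hΩ)
    refine (congrArg Measurable ?_).mp this
    funext q
    by_cases hq : q.2 ∈ Ω <;> simp [hN, hq, indicator]
  have hN0 : ∀ t, t ∉ Ioo t₁ t₂ → ∀ x, N t x = 0 := fun t ht x => by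
    simp [hN, indicator, hM0 t ht]
  have hMN : ∀ᵐ t, M t =ᵐ[volume] N t := by
    have h1 := hη.eq_zero_outside
    rw [ae_restrict_iff' measurableSet_Ioo] at hηM hη0 h1
    filter_upwards [hηM, hη0, h1] with t h2 h3 h4
    by_cases ht : t ∈ Ioo t₁ t₂
    · filter_upwards [h2 ht, h3 ht, h4 ht] with x h5 h6 h7
      by_cases hx : x ∈ Ω
      · rw [hN]
        simp only [indicator_of_mem hx]
        rw [← h5, max_eq_left h6]
      · rw [hN]
        simp only [indicator_of_notMem hx]
        rw [← h5, h7 hx]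
    · exact ae_of_all _ fun x => by rw [hM0 t ht, hN0 t ht]
  refine ⟨N, ?_, fun t x => indicator_nonneg (fun _ _ => le_max_right _ _) _,
    fun t x hx => indicator_of_notMem hx _, hN0, ?_⟩
  · rw [← lintegral_sobolevNorm_lt_top_iff s hp1 hNm]
    refine lt_of_le_of_lt (lintegral_mono_ae ?_) (hM.lintegral_lt_top hp1)
    filter_upwards [hMN] with t ht
    rw [sobolevNorm_congr s p univ ht]
  · filter_upwards [hηM, ae_restrict_of_ae hMN] with t h1 h2 using h1.trans h2

theorem MemLpSobolev.posPart {n : ℕ} {s p t₁ t₂ : ℝ} (hp : 1 ≤ p)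
    {u : ℝ → EuclideanSpace ℝ (Fin n) → ℝ} (hu : MemLpSobolev s p t₁ t₂ u) :
    MemLpSobolev s p t₁ t₂ fun t x => max (u t x) 0 := by
  obtain ⟨U, hU, -, huU⟩ := hu.exists_curve hp
  refine ⟨hu.aestronglyMeasurable.sup aestronglyMeasurable_const, ?_⟩
  refine lt_of_le_of_lt (lintegral_mono_ae ?_) (hU.posPart.memLpSobolev hp t₁ t₂).lintegral_lt_top
  filter_upwards [huU] with t ht
  rw [sobolevNorm_congr s p univ (g := fun x => max (U t x) 0)]
  filter_upwards [ht] with x hx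
  rw [hx]

theorem IsSubsolution.posPart {n : ℕ} {s p Λ t₁ t₂ : ℝ} [Fact (2 ≤ p)]
    {K : EuclideanSpace ℝ (Fin n) → EuclideanSpace ℝ (Fin n) → ℝ → ℝ} (hΛ : 1 ≤ Λ)
    (hK : IsEllipticKernel s p Λ K) {Ω : Set (EuclideanSpace ℝ (Fin n))} (hΩ : MeasurableSet Ω)
    [IsFiniteMeasure (volume.restrict Ω)] (ht : t₁ < t₂)
    {u : ℝ → EuclideanSpace ℝ (Fin n) → ℝ} (hu : IsSubsolution s p K Ω t₁ t₂ u) :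
    IsSubsolution s p K Ω t₁ t₂ fun t x => max (u t x) 0 := by
  have hp1 := one_le_of_fact p
  refine ⟨hu.1.posPart hp1, fun η ξ hη hη0 => ?_⟩
  obtain ⟨U, hU, hU0, huU⟩ := hu.1.exists_curve hp1
  obtain ⟨N, hN, hN0, hNΩ, hNt, hηN⟩ := hη.exists_curve hΩ hη0
  have hUp := hU.posPart
  have huUp : ∀ᵐ t ∂(volume.restrict (Ioo t₁ t₂)),
      (fun x => max (u t x) 0) =ᵐ[volume] fun x => max (U t x) 0 := by
    filter_upwards [huU] with t h
    filter_upwards [h] with x hx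
    rw [hx]
  have hv : ∀ m : ℕ, IsSobolevCurve s p
      (fun t x => cutoff t₁ t₂ m t * excess t₁ t₂ m U N t x) := fun m =>
    (hU.excess hN).cutoff_mul
  have e1 : ∫ t in Ioo t₁ t₂, ∫ x, ∫ y, flux p K (fun t x => max (u t x) 0) x y t *
      (η t x - η t y) = ∫ z : ℝ × EuclideanSpace ℝ (Fin n) × EuclideanSpace ℝ (Fin n),
        flux p K (fun t x => max (U t x) 0) z.2.1 z.2.2 z.1 * (N z.1 z.2.1 - N z.1 z.2.2) := by
    rw [← integral_flux_eq_integral_prod hΛ hK hUp hN hNt]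
    refine integral_congr_ae ?_
    filter_upwards [huUp, hηN] with t h1 h2
    exact integral_flux_congr p K h1 h2
  have e2 : ∫ t in Ioo t₁ t₂, ξ t (Sobolev.ofFun s p Ω fun x => max (u t x) 0) =
      ∫ t in Ioo t₁ t₂, ξ t (Sobolev.ofFun s p Ω fun x => max (U t x) 0) := by
    refine integral_congr_ae ?_
    filter_upwards [huUp] with t h1
    rw [ofFun_congr h1]
  rw [e1, e2, sub_nonpos]
  obtain ⟨a, ha, hlim⟩ := exists_tendsto_le_shiftedEnergy hΛ hK hU hN hN0 hNt
  have hG : MemLp (fun t => ‖Sobolev.ofFun s p Ω fun x => max (U t x) 0‖ +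
      ‖Sobolev.ofFun s p Ω (N t)‖) (ENNReal.ofReal p) volume :=
    (hUp.memLp_ofFun Ω).norm.add (hN.memLp_ofFun Ω).norm
  have hVG : ∀ m : ℕ, ∀ᵐ t, ‖Sobolev.ofFun s p Ω
      (fun x => cutoff t₁ t₂ m t * excess t₁ t₂ m U N t x)‖ ≤
      ‖Sobolev.ofFun s p Ω fun x => max (U t x) 0‖ + ‖Sobolev.ofFun s p Ω (N t)‖ := by
    intro m
    filter_upwards [hUp.ae_memSobolev hp1 Ω, hN.ae_memSobolev hp1 Ω] with t h1 h2
    exact norm_ofFun_cutoff_mul_excess_le m h1 h2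
  have hVW : ∀ᵐ t, Tendsto (fun m : ℕ => Sobolev.ofFun s p Ω
      (fun x => cutoff t₁ t₂ m t * excess t₁ t₂ m U N t x)) atTop
      (𝓝 (Sobolev.ofFun s p Ω fun x => max (U t x) 0)) := by
    filter_upwards [hUp.ae_memSobolev hp1 Ω, hN.ae_memSobolev hp1 Ω,
      ae_all_iff.2 fun m : ℕ => (hv m).ae_memSobolev hp1 Ω] with t h1 h2 h3
    by_cases hT : t ∈ Ioo t₁ t₂
    · exact tendsto_ofFun_cutoff_mul_excess hT h1 h2 h3
    · simp only [excess, hU0 t hT, hNt t hT, max_self, mul_zero, zero_div, sub_self]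
      exact tendsto_const_nhds
  refine le_integral_pairing_of_tendsto (X := Sobolev s p Ω) (p := ENNReal.ofReal p)
    (q := ENNReal.ofReal (p / (p - 1))) (c := 3) (ξ := ξ)
    (V := fun m t => Sobolev.ofFun s p Ω
      (fun x => cutoff t₁ t₂ (m : ℝ) t * excess t₁ t₂ (m : ℝ) U N t x))
    (W := fun t => Sobolev.ofFun s p Ω fun x => max (U t x) 0) ENNReal.ofReal_ne_top
    (ENNReal.one_le_ofReal.2 hp1) (one_le_ofReal_conj p).out hη.deriv_mem
    (fun m => (hv m).memLp_ofFun Ω) (hUp.memLp_ofFun Ω) hG hVG hVW hlim ?_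
  -- For `m` this large the layer of length `3 / m` fits into the time interval.
  filter_upwards [eventually_gt_atTop 0, (tendsto_natCast_atTop_atTop (R := ℝ)).eventually_ge_atTop
    (3 / (t₂ - t₁))] with m hm0 hm
  have hm0' : (0 : ℝ) < m := by exact_mod_cast hm0
  have hmt : 3 / (m : ℝ) ≤ t₂ - t₁ := by
    rw [div_le_iff₀ (sub_pos.2 ht)] at hm
    rw [div_le_iff₀ hm0']
    linarith
  refine (ha m).trans ?_
  exact hu.shiftedEnergy_truncTest_le (X := Sobolev s p Ω) hΛ hK hU huU hN hN0 hNΩ hNt hm0' hmt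
    hη.deriv_mem ((hv m).memLp_ofFun Ω) (hUp.memLp_ofFun Ω)
    (fun t ht' => by simp only [cutoff_eq_zero hm0' ht', zero_mul, ofFun_zero])
    (hη.isPrimitiveAgainst ht hN hNΩ hηN (hv m)) (hη.isPrimitiveAgainst ht hN hNΩ hηN hUp)

end FracParabolic

end

/-- If `u` is a weak subsolution to `∂_t u + L u = 0` in `Ω × (t₁, t₂)`, so is `max {u, 0}`. -/
theorem lemma2p1 {n : ℕ} (hn : 1 ≤ n) (s p Λ : ℝ) (hs0 : 0 < s) (hs1 : s < 1)
    [hp : Fact (2 ≤ p)] (hΛ : 1 ≤ Λ)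
    (K : EuclideanSpace ℝ (Fin n) → EuclideanSpace ℝ (Fin n) → ℝ → ℝ)
    (hK : FracParabolic.IsEllipticKernel s p Λ K)
    (Ω : Set (EuclideanSpace ℝ (Fin n))) (hΩo : IsOpen Ω) (hΩc : IsConnected Ω)
    (hΩb : Bornology.IsBounded Ω) (t₁ t₂ : ℝ) (ht : t₁ < t₂)
    (u : ℝ → EuclideanSpace ℝ (Fin n) → ℝ)
    (hu : FracParabolic.IsSubsolution s p K Ω t₁ t₂ u) :
    FracParabolic.IsSubsolution s p K Ω t₁ t₂ (fun t x => max (u t x) 0) := by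
  have : IsFiniteMeasure (volume.restrict Ω) := ⟨by simpa using hΩb.measure_lt_top⟩
  exact hu.posPart hΛ hK hΩo.measurableSet ht
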